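/- Let $\mathbb K$ be a field of characteristic $0$. For a $\mathbb Z$-graded vector space $\mathfrak L$ let $S^c(\mathfrak L)=\bigoplus_{k\ge 0} S^k(\mathfrak L[1])$ be the graded symmetric coalgebra on $\mathfrak L[1]$, with the signed unshuffle coproduct and the counit given by the projection to $\mathbb K$. An $L_\infty$-structure on $\mathfrak L$ is a coderivation $Q$ of degree $+1$ of $S^c(\mathfrak L)$ with $Q^2=0$; its components are $Q_n\colon S^n(\mathfrak L[1])\to\mathfrak L[2]$, and it is flat if $Q_0=0$. An $L_\infty$-morphism $F\colon\mathfrak L\to\mathfrak L'$ is a morphism $S^c(\mathfrak L)\to S^c(\mathfrak L')$ of counital coalgebras, of degree $0$, commuting with the codifferentials; for flat $L_\infty$-algebras it is a quasi-isomorphism if its linear component $F_1\colon(\mathfrak L,Q_1)\to(\mathfrak L',Q_1')$ is a quasi-isomorphism of complexes. The cohomology $H(\mathfrak L)=\ker Q_1/\operatorname{im}Q_1$ of a flat $L_\infty$-algebra carries the canonical $L_\infty$-structure with $Q_2([a]\wedge[b])=[Q_2(a\wedge b)]$ and $Q_n=0$ for $n\neq 2$. A flat $\mathfrak L$ is formal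 if there is an $L_\infty$-quasi-isomorphism $H(\mathfrak L)\to\mathfrak L$. Let $\mathfrak L$ and $\mathfrak L'$ be formal $L_\infty$-algebras over $\mathbb K$, let $i_l\colon H(\mathfrak L)\to\mathfrak L$ and $i_r\colon H(\mathfrak L')\to\mathfrak L'$ be any $L_\infty$-quasi-isomorphisms, and let $f\colon H(\mathfrak L)\to H(\mathfrak L')$ be an $L_\infty$-morphism. Then there is an $L_\infty$-morphism $\tilde f\colon\mathfrak L\to\mathfrak L'$ with $$\tilde f\circ i_l=i_r\circ f$$ (equality of $L_\infty$-morphisms, not only up to homotopy). Suppose moreover that $\mathfrak L,\mathfrak L',H(\mathfrak L),H(\mathfrak L')$ are equipped with decreasing filtrations $\mathcal F^0\supseteq\mathcal F^1\supseteq\cdots$ by graded subspaces, with $\mathcal F^0$ the whole space, which are complete (in every degree: $\bigcap_k\mathcal F^k=0$ and Cauchy sequences converge) and respected by the $L_\infty$-structures, where $\mathcal F^kS^c$ is spanned by the products $\gamma_1\wedge\dots\wedge\gamma_n$ with $\gamma_j\in\mathcal F^{k_j}$ and $\sum_j k_j\ge k$. If $i_l,i_r,f$ preserve the filtrations, and if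 for every $k$ the linear component of $i_l$ restricts to a quasi-isomorphism $\mathcal F^kH(\mathfrak L)\to\mathcal F^k\mathfrak L$, then $\tilde f$ with $\tilde f\circ i_l=i_r\circ f$ can be chosen to preserve the filtrations. -/

import Mathlib

open scoped TensorProduct

noncomputable section

namespace LInfty

universe u v w

section Basics

variable {K : Type u} [Field K] {L : Type v} [AddCommGroup L] [Module K L]

/-- The sign `(-1)^n` as an element of `K`. -/
def sgn (K : Type u) [Field K] (n : ℤ) : K := ((n.negOnePow : ℤ) : K)

@[simp] lemma sgn_zero : sgn K 0 = 1 := by simp [sgn]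

lemma sgn_add (m n : ℤ) : sgn K (m + n) = sgn K m * sgn K n := by
  simp [sgn, Int.negOnePow_add]

lemma sgn_even {n : ℤ} (h : Even n) : sgn K n = 1 := by
  simp [sgn, Int.negOnePow_even n h]

lemma sgn_congr {m n : ℤ} (h : Even (m - n)) : sgn K m = sgn K n := by
  rw [sgn, sgn, (Int.negOnePow_eq_iff m n).2 h]

@[simp] lemma sgn_mul_self (n : ℤ) : sgn K n * sgn K n = 1 := by
  rw [← sgn_add]; exact sgn_even ⟨n, rfl⟩

@[simp] lemma sgn_one : sgn K 1 = -1 := by simp [sgn]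

/-- The linear map on a graded vector space determined by its restrictions to the homogeneous
pieces. -/
def gradedLift (𝓛 : ℤ → Submodule K L) [DirectSum.Decomposition 𝓛] {M : Type w} [AddCommGroup M]
    [Module K M] (φ : ∀ i, 𝓛 i →ₗ[K] M) : L →ₗ[K] M :=
  DirectSum.toModule K ℤ M φ ∘ₗ (DirectSum.decomposeLinearEquiv 𝓛).toLinearMap

lemma gradedLift_apply (𝓛 : ℤ → Submodule K L) [DirectSum.Decomposition 𝓛] {M : Type w}
    [AddCommGroup M] [Module K M] (φ : ∀ i, 𝓛 i →ₗ[K] M) {i : ℤ} {a : L} (ha : a ∈ 𝓛 i) :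
    gradedLift 𝓛 φ a = φ i ⟨a, ha⟩ := by
  have := DirectSum.decomposeLinearEquiv_apply_coe (R := K) 𝓛 i ⟨a, ha⟩
  simp only at this
  simp [gradedLift, this]

/-- The relations `a ∧ b = (-1)^{|a||b|} b ∧ a`, where `|a| = i - 1` is the degree in `L[1]` of an
element `a` of degree `i` in `L`. -/
inductive SymRel (𝓛 : ℤ → Submodule K L) : TensorAlgebra K L → TensorAlgebra K L → Prop
  | swap {i j : ℤ} {a b : L} (ha : a ∈ 𝓛 i) (hb : b ∈ 𝓛 j) :
      SymRel 𝓛 (TensorAlgebra.ι K a * TensorAlgebra.ι K b)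
        (sgn K ((i - 1) * (j - 1)) • (TensorAlgebra.ι K b * TensorAlgebra.ι K a))

/-- The graded symmetric algebra `S(L[1])`: the tensor algebra of `L` modulo the (graded)
action of the symmetric groups on `L[1]`. It carries the coalgebra structure of `S^c(L)` below. -/
def Sc (𝓛 : ℤ → Submodule K L) : Type (max u v) := RingQuot (SymRel 𝓛)

instance (𝓛 : ℤ → Submodule K L) : Ring (Sc 𝓛) := inferInstanceAs (Ring (RingQuot (SymRel 𝓛)))

instance (𝓛 : ℤ → Submodule K L) : Algebra K (Sc 𝓛) :=
  inferInstanceAs (Algebra K (RingQuot (SymRel 𝓛)))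

/-- The quotient map from the tensor algebra. -/
def mk (𝓛 : ℤ → Submodule K L) : TensorAlgebra K L →ₐ[K] Sc 𝓛 := RingQuot.mkAlgHom K (SymRel 𝓛)

lemma mk_surjective (𝓛 : ℤ → Submodule K L) : Function.Surjective (mk 𝓛) :=
  RingQuot.mkAlgHom_surjective K (SymRel 𝓛)

/-- The inclusion of the cogenerators `L[1]` into `S^c(L)`. -/
def ι (𝓛 : ℤ → Submodule K L) : L →ₗ[K] Sc 𝓛 :=
  (mk 𝓛).toLinearMap ∘ₗ TensorAlgebra.ι K

variable (𝓛 : ℤ → Submodule K L)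

lemma ι_mul_ι {i j : ℤ} {a b : L} (ha : a ∈ 𝓛 i) (hb : b ∈ 𝓛 j) :
    ι 𝓛 a * ι 𝓛 b = sgn K ((i - 1) * (j - 1)) • (ι 𝓛 b * ι 𝓛 a) := by
  have := RingQuot.mkAlgHom_rel K (SymRel.swap ha hb)
  rw [map_smul, map_mul, map_mul] at this
  exact this

/-- The universal property of the graded symmetric algebra. -/
def lift {A : Type w} [Ring A] [Algebra K A] (f : L →ₗ[K] A)
    (hf : ∀ i j : ℤ, ∀ a ∈ 𝓛 i, ∀ b ∈ 𝓛 j,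
      f a * f b = sgn K ((i - 1) * (j - 1)) • (f b * f a)) : Sc 𝓛 →ₐ[K] A :=
  RingQuot.liftAlgHom K ⟨TensorAlgebra.lift K f, by
    rintro _ _ ⟨ha, hb⟩
    simpa using hf _ _ _ ha _ hb⟩

@[simp] lemma lift_ι {A : Type w} [Ring A] [Algebra K A] (f : L →ₗ[K] A)
    (hf : ∀ i j : ℤ, ∀ a ∈ 𝓛 i, ∀ b ∈ 𝓛 j,
      f a * f b = sgn K ((i - 1) * (j - 1)) • (f b * f a)) (a : L) :
    lift 𝓛 f hf (ι 𝓛 a) = f a := by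
  have := RingQuot.liftAlgHom_mkAlgHom_apply K (TensorAlgebra.lift K f) (s := SymRel 𝓛) (by
    rintro _ _ ⟨ha, hb⟩
    simpa using hf _ _ _ ha _ hb) (TensorAlgebra.ι K a)
  rw [TensorAlgebra.lift_ι_apply] at this
  exact this

/-- `IsWord 𝓛 n d x`: the element `x` is a product `γ₁ ∧ … ∧ γₙ` of homogeneous elements whose
degrees in `L[1]` add up to `d`. -/
inductive IsWord : ℕ → ℤ → Sc 𝓛 → Prop
  | one : IsWord 0 0 1
  | cons {n : ℕ} {i d : ℤ} {a : L} {x : Sc 𝓛} (ha : a ∈ 𝓛 i) (hx : IsWord n d x) :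
      IsWord (n + 1) ((i - 1) + d) (ι 𝓛 a * x)

/-- The part of degree `d` of `S^c(L)`. -/
def deg (d : ℤ) : Submodule K (Sc 𝓛) := Submodule.span K {x | ∃ n, IsWord 𝓛 n d x}

variable {𝓛}

lemma IsWord.mem_deg {n : ℕ} {d : ℤ} {x : Sc 𝓛} (h : IsWord 𝓛 n d x) : x ∈ deg 𝓛 d :=
  Submodule.subset_span ⟨n, h⟩

lemma isWord_ι {i : ℤ} {a : L} (ha : a ∈ 𝓛 i) : IsWord 𝓛 1 (i - 1) (ι 𝓛 a) := by
  simpa using IsWord.cons ha IsWord.one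

variable (𝓛) in
/-- The counit of `S^c(L)`: the projection onto `K`. -/
def counit : Sc 𝓛 →ₐ[K] K := lift 𝓛 0 (by simp)

@[simp] lemma counit_ι (a : L) : counit 𝓛 (ι 𝓛 a) = 0 := by simp [counit]

/-- Auxiliary action of the generators on `K × L` used to define the projection onto `L[1]`. -/
def projAct : L →ₗ[K] Module.End K (K × L) where
  toFun v := LinearMap.inr K K L ∘ₗ LinearMap.toSpanSingleton K L v ∘ₗ LinearMap.fst K K L
  map_add' a b := by ext <;> simp
  map_smul' c a := by ext <;> simp

variable (𝓛) in
/-- The projection of `S^c(L)` onto `L[1]`: it vanishes on `1` and on products of at least two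
elements of `L[1]`, and is the identity on `L[1]`; see `proj_one`, `proj_ι_mul` and `proj_ι`. -/
def proj : Sc 𝓛 →ₗ[K] L :=
  LinearMap.snd K K L ∘ₗ LinearMap.applyₗ ((1, 0) : K × L) ∘ₗ
    (lift 𝓛 (projAct (K := K) (L := L)) (by
      intros; ext <;> simp [projAct])).toLinearMap

@[simp] lemma proj_one : proj 𝓛 1 = 0 := by simp [proj]

lemma counit_word {n : ℕ} {d : ℤ} {x : Sc 𝓛} (hx : IsWord 𝓛 (n + 1) d x) : counit 𝓛 x = 0 := by
  cases hx; simp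

lemma ι_mul_mem_deg {i n : ℤ} {a : L} (ha : a ∈ 𝓛 i) {x : Sc 𝓛} (hx : x ∈ deg 𝓛 n) :
    ι 𝓛 a * x ∈ deg 𝓛 ((i - 1) + n) := by
  refine Submodule.span_induction (p := fun x _ => ι 𝓛 a * x ∈ deg 𝓛 ((i - 1) + n))
    ?_ (by simp) ?_ ?_ hx
  · rintro y ⟨m, hy⟩; exact (IsWord.cons ha hy).mem_deg
  · intro x y _ _ hx hy; rw [mul_add]; exact Submodule.add_mem _ hx hy
  · intro c x _ hx; rw [mul_smul_comm]; exact Submodule.smul_mem _ _ hx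

/-- `q : S^c(L) → L[1]` is homogeneous of degree `d`. -/
def Homog (q : Sc 𝓛 →ₗ[K] L) (d : ℤ) : Prop := ∀ n : ℤ, ∀ x ∈ deg 𝓛 n, q x ∈ 𝓛 (n + d + 1)

lemma Homog.comp_mulLeft {q : Sc 𝓛 →ₗ[K] L} {d : ℤ} (hq : Homog q d) {i : ℤ} {a : L}
    (ha : a ∈ 𝓛 i) : Homog (q ∘ₗ LinearMap.mulLeft K (ι 𝓛 a)) (d + (i - 1)) := by
  intro n x hx
  have := hq _ _ (ι_mul_mem_deg ha hx)
  have e : i - 1 + n + d + 1 = n + (d + (i - 1)) + 1 := by ring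
  rw [e] at this
  exact this

/-- The algebra endomorphism multiplying the generators by `c`. -/
def scale (c : K) : Sc 𝓛 →ₐ[K] Sc 𝓛 := lift 𝓛 (c • ι 𝓛) (by
  intro i j a ha b hb
  simp only [LinearMap.smul_apply, smul_mul_assoc, mul_smul_comm]
  rw [ι_mul_ι 𝓛 ha hb]
  simp only [smul_smul]
  ring_nf)

lemma scale_ι (c : K) (a : L) : scale c (ι 𝓛 a) = c • ι 𝓛 a := by simp [scale]

lemma scale_word (c : K) {n : ℕ} {d : ℤ} {x : Sc 𝓛} (hx : IsWord 𝓛 n d x) :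
    scale c x = c ^ n • x := by
  induction hx with
  | one => simp
  | cons ha _ ih => rw [map_mul, ih, scale_ι, smul_mul_smul_comm, pow_succ']

variable [DirectSum.Decomposition 𝓛]

/-- A submodule of `L` containing all homogeneous elements is everything. -/
lemma homog_induction {p : L → Prop} (h0 : p 0) (hadd : ∀ a b, p a → p b → p (a + b))
    (hh : ∀ i : ℤ, ∀ a ∈ 𝓛 i, p a) (a : L) : p a :=
  DirectSum.Decomposition.inductionOn 𝓛 h0 (fun m => hh _ _ m.2) hadd a

lemma span_words : Submodule.span K {x : Sc 𝓛 | ∃ n d, IsWord 𝓛 n d x} = ⊤ := by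
  set W := Submodule.span K {x : Sc 𝓛 | ∃ n d, IsWord 𝓛 n d x} with hW
  have h1 : (1 : Sc 𝓛) ∈ W := Submodule.subset_span ⟨_, _, IsWord.one⟩
  have hι : ∀ a : L, ∀ x ∈ W, ι 𝓛 a * x ∈ W := by
    intro a x hx
    refine homog_induction (𝓛 := 𝓛) (p := fun a => ι 𝓛 a * x ∈ W) (by simp) ?_ ?_ a
    · intro a b ha hb
      simpa [add_mul] using W.add_mem ha hb
    · intro i a ha
      refine Submodule.span_induction (p := fun x _ => ι 𝓛 a * x ∈ W) ?_ (by simp) ?_ ?_ hx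
      · rintro y ⟨n, d, hy⟩
        exact Submodule.subset_span ⟨_, _, IsWord.cons ha hy⟩
      · intro x y _ _ hx hy
        simpa [mul_add] using W.add_mem hx hy
      · intro c x _ hx
        simpa using W.smul_mem c hx
  have key : ∀ t : TensorAlgebra K L, ∀ x ∈ W, mk 𝓛 t * x ∈ W := by
    intro t
    induction t using TensorAlgebra.induction with
    | algebraMap r =>
      intro x hx
      rw [AlgHom.commutes]
      rw [← Algebra.smul_def]; exact W.smul_mem r hx
    | ι a => intro x hx; exact hι a x hx
    | mul a b ha hb =>
      intro x hx
      rw [map_mul, mul_assoc]; exact ha _ (hb _ hx)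
    | add a b ha hb =>
      intro x hx
      rw [map_add, add_mul]; exact W.add_mem (ha _ hx) (hb _ hx)
  rw [eq_top_iff]
  intro x _
  obtain ⟨t, rfl⟩ := mk_surjective 𝓛 x
  have := key t 1 h1
  rwa [mul_one] at this

/-- Two linear maps agreeing on words are equal. -/
lemma ext_words {M : Type w} [AddCommGroup M] [Module K M] {f g : Sc 𝓛 →ₗ[K] M}
    (h : ∀ n d x, IsWord 𝓛 n d x → f x = g x) : f = g := by
  refine LinearMap.ext_on (span_words (𝓛 := 𝓛)) ?_
  rintro x ⟨n, d, hx⟩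
  exact h n d x hx

/-- Two linear maps on `S^c(L)` are equal if they agree on `1` and if agreement on `x` implies
agreement on `a ∧ x` for homogeneous `a`. -/
lemma ext_cons {M : Type w} [AddCommGroup M] [Module K M] {f g : Sc 𝓛 →ₗ[K] M} (h1 : f 1 = g 1)
    (h : ∀ i : ℤ, ∀ a ∈ 𝓛 i, ∀ x, f x = g x → f (ι 𝓛 a * x) = g (ι 𝓛 a * x)) : f = g := by
  refine ext_words ?_
  intro n d x hx
  induction hx with
  | one => exact h1
  | cons ha _ ih => exact h _ _ ha _ ih

lemma algHom_ext_ι {A : Type w} [Ring A] [Algebra K A] {f g : Sc 𝓛 →ₐ[K] A}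
    (h : ∀ i : ℤ, ∀ a ∈ 𝓛 i, f (ι 𝓛 a) = g (ι 𝓛 a)) : f = g := by
  have : f.toLinearMap = g.toLinearMap := by
    refine ext_cons (by simp) ?_
    intro i a ha x hx
    simp only [AlgHom.toLinearMap_apply] at hx ⊢
    rw [map_mul, map_mul, hx, h i a ha]
  exact AlgHom.toLinearMap_injective this

variable (𝓛) in
/-- The automorphism of `S^c(L)` acting as `(-1)^{i d}` on the part of degree `d`. It is used to
write the Koszul sign rule: for a linear map `g` of degree `i` one has
`(id ⊗ g)(x ⊗ y) = (-1)^{i |x|} x ⊗ g y`, that is `id ⊗ g = (koszul i) ⊗ g` with the tensor product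
of linear maps without signs on the right hand side. -/
def koszul (i : ℤ) : Sc 𝓛 →ₐ[K] Sc 𝓛 :=
  lift 𝓛 (gradedLift 𝓛 fun j => sgn K (i * (j - 1)) • (ι 𝓛 ∘ₗ (𝓛 j).subtype)) (by
    intro j k a ha b hb
    rw [gradedLift_apply 𝓛 _ ha, gradedLift_apply 𝓛 _ hb]
    simp only [LinearMap.smul_apply, LinearMap.comp_apply, Submodule.subtype_apply,
      smul_mul_assoc, mul_smul_comm]
    rw [ι_mul_ι 𝓛 ha hb]
    simp only [smul_smul]
    ring_nf)

lemma koszul_ι (i : ℤ) {j : ℤ} {a : L} (ha : a ∈ 𝓛 j) :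
    koszul 𝓛 i (ι 𝓛 a) = sgn K (i * (j - 1)) • ι 𝓛 a := by
  simp [koszul, gradedLift_apply 𝓛 _ ha]

lemma koszul_word (i : ℤ) {n : ℕ} {d : ℤ} {x : Sc 𝓛} (hx : IsWord 𝓛 n d x) :
    koszul 𝓛 i x = sgn K (i * d) • x := by
  induction hx with
  | one => simp
  | cons ha _ ih =>
    rw [map_mul, ih, koszul_ι i ha, smul_mul_smul_comm, ← sgn_add]
    ring_nf

lemma koszul_deg (i : ℤ) {d : ℤ} {x : Sc 𝓛} (hx : x ∈ deg 𝓛 d) :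
    koszul 𝓛 i x = sgn K (i * d) • x := by
  refine Submodule.span_induction (p := fun x _ => koszul 𝓛 i x = sgn K (i * d) • x)
    ?_ (by simp) ?_ ?_ hx
  · rintro y ⟨n, hy⟩; exact koszul_word i hy
  · intro x y _ _ hx hy; rw [map_add, hx, hy, smul_add]
  · intro c x _ hx; rw [map_smul, hx, smul_comm]

@[simp] lemma koszul_koszul (i j : ℤ) (x : Sc 𝓛) : koszul 𝓛 i (koszul 𝓛 j x) = koszul 𝓛 (i + j) x := by
  have : (koszul 𝓛 i).comp (koszul 𝓛 j) = koszul 𝓛 (i + j) := by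
    refine algHom_ext_ι ?_
    intro k a ha
    simp only [AlgHom.comp_apply, koszul_ι _ ha, map_smul, smul_smul]
    rw [← sgn_add]; ring_nf
  exact DFunLike.congr_fun this x

lemma koszul_congr {i j : ℤ} (h : Even (i - j)) : koszul 𝓛 i = koszul 𝓛 j := by
  refine algHom_ext_ι ?_
  intro k a ha
  rw [koszul_ι _ ha, koszul_ι _ ha, sgn_congr]
  rw [← sub_mul]; exact h.mul_right _

@[simp] lemma koszul_zero (x : Sc 𝓛) : koszul 𝓛 0 x = x := by
  have : koszul 𝓛 0 = AlgHom.id K (Sc 𝓛) := algHom_ext_ι (fun k a ha => by simp [koszul_ι _ ha])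
  rw [this]; rfl

/-- Graded commutativity with a generator. -/
lemma koszul_mul_ι {i : ℤ} {a : L} (ha : a ∈ 𝓛 i) (x : Sc 𝓛) :
    koszul 𝓛 (i - 1) x * ι 𝓛 a = ι 𝓛 a * x := by
  have : LinearMap.mulRight K (ι 𝓛 a) ∘ₗ (koszul 𝓛 (i - 1)).toLinearMap =
      LinearMap.mulLeft K (ι 𝓛 a) := by
    refine ext_cons (by simp) ?_
    intro j b hb x hx
    simp only [LinearMap.comp_apply, AlgHom.toLinearMap_apply, LinearMap.mulRight_apply,
      LinearMap.mulLeft_apply] at hx ⊢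
    rw [map_mul, mul_assoc, hx, koszul_ι _ hb, ← mul_assoc, ← mul_assoc, ι_mul_ι 𝓛 ha hb,
      smul_mul_assoc]
  exact DFunLike.congr_fun this x

/-- The linear map `x ⊗ y ↦ a ∧ x ⊗ y + (-1)^{|a||x|} x ⊗ a ∧ y` on `S^c(L) ⊗ S^c(L)`, for `a`
homogeneous of degree `i` in `L` (so that `|a| = i - 1`): multiplication by `a ⊗ 1 + 1 ⊗ a` in the
graded tensor product of algebras. -/
def mulPrim (i : ℤ) : 𝓛 i →ₗ[K] Module.End K (Sc 𝓛 ⊗[K] Sc 𝓛) where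
  toFun a := TensorProduct.map (LinearMap.mulLeft K (ι 𝓛 a)) LinearMap.id +
    TensorProduct.map (koszul 𝓛 (i - 1)).toLinearMap (LinearMap.mulLeft K (ι 𝓛 a))
  map_add' a b := by
    refine TensorProduct.ext' fun x y => ?_
    simp [add_mul, TensorProduct.add_tmul, TensorProduct.tmul_add]; abel
  map_smul' c a := by
    refine TensorProduct.ext' fun x y => ?_
    simp [TensorProduct.smul_tmul']

lemma mulPrim_tmul (i : ℤ) (a : 𝓛 i) (x y : Sc 𝓛) :
    mulPrim i a (x ⊗ₜ y) = (ι 𝓛 a * x) ⊗ₜ y + koszul 𝓛 (i - 1) x ⊗ₜ (ι 𝓛 a * y) := rfl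

variable (𝓛) in
/-- The action of the algebra `S(L[1])` on `S(L[1]) ⊗ S(L[1])` through the coproduct. -/
def comulAct : Sc 𝓛 →ₐ[K] Module.End K (Sc 𝓛 ⊗[K] Sc 𝓛) :=
  lift 𝓛 (gradedLift 𝓛 mulPrim) (by
    intro i j a ha b hb
    rw [gradedLift_apply 𝓛 _ ha, gradedLift_apply 𝓛 _ hb]
    refine TensorProduct.ext' fun x y => ?_
    simp only [Module.End.mul_apply, mulPrim_tmul, map_add, LinearMap.smul_apply, map_mul,
      koszul_koszul, koszul_ι _ ha, koszul_ι _ hb, ← mul_assoc, smul_mul_assoc,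
      ← TensorProduct.smul_tmul', smul_add, smul_smul]
    rw [ι_mul_ι 𝓛 ha hb]
    simp only [smul_mul_assoc, TensorProduct.tmul_smul, ← TensorProduct.smul_tmul']
    rw [mul_comm (j - 1) (i - 1), sgn_mul_self, one_smul, add_comm (j - 1) (i - 1)]
    abel)

variable (𝓛) in
/-- The coproduct of `S^c(L)`. It is the unique linear map with `Δ(1) = 1 ⊗ 1` and
`Δ(a ∧ x) = (a ⊗ 1 + 1 ⊗ a) Δ(x)` (product in the graded tensor product), that is, the signed
unshuffle coproduct; see `comul_one` and `comul_ι_mul`. -/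
def comul : Sc 𝓛 →ₗ[K] Sc 𝓛 ⊗[K] Sc 𝓛 :=
  LinearMap.applyₗ (1 ⊗ₜ 1) ∘ₗ (comulAct 𝓛).toLinearMap

@[simp] lemma comul_one : comul 𝓛 1 = 1 ⊗ₜ 1 := by simp [comul]

lemma comul_ι_mul {i : ℤ} {a : L} (ha : a ∈ 𝓛 i) (x : Sc 𝓛) :
    comul 𝓛 (ι 𝓛 a * x) =
      TensorProduct.map (LinearMap.mulLeft K (ι 𝓛 a)) LinearMap.id (comul 𝓛 x) +
      TensorProduct.map (koszul 𝓛 (i - 1)).toLinearMap (LinearMap.mulLeft K (ι 𝓛 a))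
        (comul 𝓛 x) := by
  simp [comul, comulAct, gradedLift_apply 𝓛 _ ha, mulPrim]

lemma counit_koszul (i : ℤ) (x : Sc 𝓛) : counit 𝓛 (koszul 𝓛 i x) = counit 𝓛 x := by
  have : (counit 𝓛).comp (koszul 𝓛 i) = counit 𝓛 :=
    algHom_ext_ι (fun j a ha => by simp [koszul_ι _ ha])
  exact DFunLike.congr_fun this x

instance : CoalgebraStruct K (Sc 𝓛) where
  comul := comul 𝓛
  counit := (counit 𝓛).toLinearMap

lemma comul_def : (CoalgebraStruct.comul : Sc 𝓛 →ₗ[K] _) = comul 𝓛 := rfl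

lemma counit_def : (CoalgebraStruct.counit : Sc 𝓛 →ₗ[K] K) = (counit 𝓛).toLinearMap := rfl

/-- How a tensor product of linear maps, composed with the coproduct, behaves under multiplication
by a generator. -/
lemma map_comul_ι_mul {M N : Type*} [AddCommGroup M] [Module K M] [AddCommGroup N] [Module K N]
    (f : Sc 𝓛 →ₗ[K] M) (g : Sc 𝓛 →ₗ[K] N) {i : ℤ} {a : L} (ha : a ∈ 𝓛 i) (x : Sc 𝓛) :
    TensorProduct.map f g (comul 𝓛 (ι 𝓛 a * x)) =
      TensorProduct.map (f ∘ₗ LinearMap.mulLeft K (ι 𝓛 a)) g (comul 𝓛 x) +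
      TensorProduct.map (f ∘ₗ (koszul 𝓛 (i - 1)).toLinearMap)
        (g ∘ₗ LinearMap.mulLeft K (ι 𝓛 a)) (comul 𝓛 x) := by
  rw [comul_ι_mul ha, map_add, TensorProduct.map_map, TensorProduct.map_map,
    LinearMap.comp_id]

lemma koszul_comul (i : ℤ) (x : Sc 𝓛) : comul 𝓛 (koszul 𝓛 i x) =
    TensorProduct.map (koszul 𝓛 i).toLinearMap (koszul 𝓛 i).toLinearMap (comul 𝓛 x) := by
  have : comul 𝓛 ∘ₗ (koszul 𝓛 i).toLinearMap =
    TensorProduct.map (koszul 𝓛 i).toLinearMap (koszul 𝓛 i).toLinearMap ∘ₗ comul 𝓛 := by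
    refine ext_cons (by simp) ?_
    intro j a ha x hx
    simp only [LinearMap.comp_apply, AlgHom.toLinearMap_apply] at hx ⊢
    rw [map_comul_ι_mul _ _ ha, map_mul, koszul_ι _ ha, smul_mul_assoc, map_smul, comul_ι_mul ha, hx,
      TensorProduct.map_map, TensorProduct.map_map, smul_add,
      ← LinearMap.smul_apply, ← LinearMap.smul_apply, ← TensorProduct.map_smul_left,
      ← TensorProduct.map_smul_right]
    have e1 : sgn K (i * (j - 1)) • (LinearMap.mulLeft K (ι 𝓛 a) ∘ₗ (koszul 𝓛 i).toLinearMap) =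
        (koszul 𝓛 i).toLinearMap ∘ₗ LinearMap.mulLeft K (ι 𝓛 a) := by
      ext y; simp [koszul_ι _ ha]
    have e2 : (koszul 𝓛 (j - 1)).toLinearMap ∘ₗ (koszul 𝓛 i).toLinearMap =
        (koszul 𝓛 i).toLinearMap ∘ₗ (koszul 𝓛 (j - 1)).toLinearMap := by
      ext y; simp [add_comm]
    rw [e1, e2, LinearMap.id_comp]
  exact DFunLike.congr_fun this x

lemma lTensor_counit_comul (x : Sc 𝓛) :
    (counit 𝓛).toLinearMap.lTensor (Sc 𝓛) (comul 𝓛 x) = x ⊗ₜ 1 := by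
  have : (counit 𝓛).toLinearMap.lTensor (Sc 𝓛) ∘ₗ comul 𝓛 = (TensorProduct.mk K _ _).flip 1 := by
    refine ext_cons (by simp) ?_
    intro j a ha x hx
    simp only [LinearMap.comp_apply, LinearMap.lTensor, LinearMap.flip_apply,
      TensorProduct.mk_apply] at hx ⊢
    rw [map_comul_ι_mul _ _ ha]
    have e : (counit 𝓛).toLinearMap ∘ₗ LinearMap.mulLeft K (ι 𝓛 a) = 0 := by ext y; simp
    rw [e, TensorProduct.map_zero_right, LinearMap.zero_apply, add_zero, LinearMap.id_comp]
    have := congrArg (TensorProduct.map (LinearMap.mulLeft K (ι 𝓛 a)) LinearMap.id) hx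
    rw [TensorProduct.map_map] at this
    simpa using this
  exact DFunLike.congr_fun this x

lemma rTensor_counit_comul (x : Sc 𝓛) :
    (counit 𝓛).toLinearMap.rTensor (Sc 𝓛) (comul 𝓛 x) = 1 ⊗ₜ x := by
  have : (counit 𝓛).toLinearMap.rTensor (Sc 𝓛) ∘ₗ comul 𝓛 = TensorProduct.mk K _ _ 1 := by
    refine ext_cons (by simp) ?_
    intro j a ha x hx
    simp only [LinearMap.comp_apply, LinearMap.rTensor, TensorProduct.mk_apply] at hx ⊢
    rw [map_comul_ι_mul _ _ ha]
    have e : (counit 𝓛).toLinearMap ∘ₗ LinearMap.mulLeft K (ι 𝓛 a) = 0 := by ext y; simp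
    have e' : (counit 𝓛).toLinearMap ∘ₗ (koszul 𝓛 (j - 1)).toLinearMap =
      (counit 𝓛).toLinearMap := by ext y; simp [counit_koszul]
    rw [e, TensorProduct.map_zero_left, LinearMap.zero_apply, zero_add, LinearMap.id_comp, e']
    have := congrArg (TensorProduct.map LinearMap.id (LinearMap.mulLeft K (ι 𝓛 a))) hx
    rw [TensorProduct.map_map] at this
    simpa using this
  exact DFunLike.congr_fun this x

lemma coassoc_aux (x : Sc 𝓛) :
    TensorProduct.assoc K _ _ _ ((comul 𝓛).rTensor (Sc 𝓛) (comul 𝓛 x)) =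
      (comul 𝓛).lTensor (Sc 𝓛) (comul 𝓛 x) := by
  have : (TensorProduct.assoc K _ _ _).toLinearMap ∘ₗ (comul 𝓛).rTensor (Sc 𝓛) ∘ₗ comul 𝓛 =
      (comul 𝓛).lTensor (Sc 𝓛) ∘ₗ comul 𝓛 := by
    refine ext_cons (by simp) ?_
    intro j a ha x hx
    set k := (koszul 𝓛 (j - 1)).toLinearMap with hk
    set m := LinearMap.mulLeft K (ι 𝓛 a) with hm
    have e1 : comul 𝓛 ∘ₗ m = TensorProduct.map m LinearMap.id ∘ₗ comul 𝓛 +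
        TensorProduct.map k m ∘ₗ comul 𝓛 := by
      ext y; simp [hm, hk, comul_ι_mul ha]
    have e2 : comul 𝓛 ∘ₗ k = TensorProduct.map k k ∘ₗ comul 𝓛 := by
      ext y; simp [hk, koszul_comul]
    simp only [LinearMap.comp_apply, LinearMap.rTensor, LinearMap.lTensor] at hx ⊢
    rw [map_comul_ι_mul _ _ ha, map_comul_ι_mul _ _ ha, ← hm, ← hk, e1, e2]
    simp only [TensorProduct.map_add_left, TensorProduct.map_add_right, LinearMap.add_apply]
    simp only [LinearMap.id_comp]
    have a1 : TensorProduct.map (TensorProduct.map m LinearMap.id ∘ₗ comul 𝓛) LinearMap.id =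
      TensorProduct.map (TensorProduct.map m LinearMap.id) LinearMap.id ∘ₗ
        TensorProduct.map (comul 𝓛) (LinearMap.id (R := K) (M := Sc 𝓛)) := by
      rw [← TensorProduct.map_comp]; rfl
    have a2 : TensorProduct.map (TensorProduct.map k m ∘ₗ comul 𝓛) LinearMap.id =
      TensorProduct.map (TensorProduct.map k m) LinearMap.id ∘ₗ
        TensorProduct.map (comul 𝓛) (LinearMap.id (R := K) (M := Sc 𝓛)) := by
      rw [← TensorProduct.map_comp]; rfl
    have a3 : TensorProduct.map (TensorProduct.map k k ∘ₗ comul 𝓛) m =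
      TensorProduct.map (TensorProduct.map k k) m ∘ₗ
        TensorProduct.map (comul 𝓛) (LinearMap.id (R := K) (M := Sc 𝓛)) := by
      rw [← TensorProduct.map_comp]; rfl
    have b1 : TensorProduct.map m (comul 𝓛) =
      TensorProduct.map m LinearMap.id ∘ₗ
        TensorProduct.map (LinearMap.id (R := K) (M := Sc 𝓛)) (comul 𝓛) := by
      rw [← TensorProduct.map_comp]; rfl
    have b2 : TensorProduct.map k (TensorProduct.map m LinearMap.id ∘ₗ comul 𝓛) =
      TensorProduct.map k (TensorProduct.map m LinearMap.id) ∘ₗ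
        TensorProduct.map (LinearMap.id (R := K) (M := Sc 𝓛)) (comul 𝓛) := by
      rw [← TensorProduct.map_comp]; rfl
    have b3 : TensorProduct.map k (TensorProduct.map k m ∘ₗ comul 𝓛) =
      TensorProduct.map k (TensorProduct.map k m) ∘ₗ
        TensorProduct.map (LinearMap.id (R := K) (M := Sc 𝓛)) (comul 𝓛) := by
      rw [← TensorProduct.map_comp]; rfl
    rw [a1, a2, a3, b1, b2, b3]
    simp only [LinearMap.comp_apply]
    rw [← hx]
    generalize TensorProduct.map (comul 𝓛) LinearMap.id (comul 𝓛 x) = t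
    have h1 : ∀ (f g h : Sc 𝓛 →ₗ[K] Sc 𝓛) (t : (Sc 𝓛 ⊗[K] Sc 𝓛) ⊗[K] Sc 𝓛),
        TensorProduct.assoc K _ _ _ (TensorProduct.map (TensorProduct.map f g) h t) =
          TensorProduct.map f (TensorProduct.map g h) (TensorProduct.assoc K _ _ _ t) := by
      intro f g h t
      exact (DFunLike.congr_fun (TensorProduct.map_map_comp_assoc_eq f g h) t).symm
    rw [map_add, map_add]
    simp only [LinearEquiv.coe_coe]
    rw [h1, h1, h1, TensorProduct.map_id, add_assoc]
  exact DFunLike.congr_fun this x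

/-- `S^c(L)` is a coassociative counital coalgebra. -/
instance : Coalgebra K (Sc 𝓛) where
  coassoc := LinearMap.ext coassoc_aux
  rTensor_counit_comp_comul := LinearMap.ext rTensor_counit_comul
  lTensor_counit_comp_comul := LinearMap.ext lTensor_counit_comul

section Proj

lemma proj_ι_mul (a : L) (x : Sc 𝓛) : proj 𝓛 (ι 𝓛 a * x) = counit 𝓛 x • a := by
  have h : LinearMap.fst K K L ∘ₗ LinearMap.applyₗ ((1, 0) : K × L) ∘ₗ
    (lift 𝓛 (projAct (K := K) (L := L)) (by
      intros; ext <;> simp [projAct])).toLinearMap = (counit 𝓛).toLinearMap := by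
    refine ext_cons (by simp) ?_
    intro i a ha x _
    simp [projAct]
  have h2 := DFunLike.congr_fun h x
  simp only [LinearMap.comp_apply, LinearMap.fst_apply, LinearMap.applyₗ_apply_apply,
    AlgHom.toLinearMap_apply] at h2
  rw [← h2]
  simp [proj, projAct]

@[simp] lemma proj_ι (a : L) : proj 𝓛 (ι 𝓛 a) = a := by
  have := proj_ι_mul (𝓛 := 𝓛) a 1
  simpa using this

lemma proj_mem {d : ℤ} {x : Sc 𝓛} (hx : x ∈ deg 𝓛 d) : proj 𝓛 x ∈ 𝓛 (d + 1) := by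
  refine Submodule.span_induction (p := fun x _ => proj 𝓛 x ∈ 𝓛 (d + 1)) ?_ (by simp) ?_ ?_ hx
  · rintro y ⟨n, hy⟩
    cases hy with
    | one => simp
    | cons ha hz =>
      rw [proj_ι_mul]
      cases hz with
      | one => simpa using ha
      | cons => simp
  · intro x y _ _ hx hy; rw [map_add]; exact Submodule.add_mem _ hx hy
  · intro c x _ hx; rw [map_smul]; exact Submodule.smul_mem _ _ hx

end Proj

section Cofree

/-- The linear endomorphism of `S^c(L)` with components `q`, given by
`γ₁ ∧ … ∧ γₙ ↦ ∑ ± q(γ_{σ(1)} ∧ … ∧ γ_{σ(k)}) ∧ γ_{σ(k+1)} ∧ … ∧ γ_{σ(n)}`, the sum being over all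
unshuffles: the composition of the coproduct with `q ⊗ id` and the multiplication. -/
def conv (q : Sc 𝓛 →ₗ[K] L) : Sc 𝓛 →ₗ[K] Sc 𝓛 :=
  LinearMap.mul' K (Sc 𝓛) ∘ₗ TensorProduct.map (ι 𝓛 ∘ₗ q) LinearMap.id ∘ₗ comul 𝓛

@[simp] lemma conv_one (q : Sc 𝓛 →ₗ[K] L) : conv q 1 = ι 𝓛 (q 1) := by simp [conv]

lemma conv_ι_mul {q : Sc 𝓛 →ₗ[K] L} {d : ℤ} (hq : Homog q d) {i : ℤ} {a : L} (ha : a ∈ 𝓛 i)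
    (x : Sc 𝓛) : conv q (ι 𝓛 a * x) = conv (q ∘ₗ LinearMap.mulLeft K (ι 𝓛 a)) x +
      sgn K (d * (i - 1)) • (ι 𝓛 a * conv q x) := by
  simp only [conv, LinearMap.comp_apply]
  rw [map_comul_ι_mul _ _ ha, map_add]
  congr 1
  have e : LinearMap.mul' K (Sc 𝓛) ∘ₗ
      TensorProduct.map ((ι 𝓛 ∘ₗ q) ∘ₗ (koszul 𝓛 (i - 1)).toLinearMap)
        (LinearMap.id ∘ₗ LinearMap.mulLeft K (ι 𝓛 a)) =
      sgn K (d * (i - 1)) • (LinearMap.mulLeft K (ι 𝓛 a) ∘ₗ LinearMap.mul' K (Sc 𝓛) ∘ₗ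
        TensorProduct.map (ι 𝓛 ∘ₗ q) LinearMap.id) := by
    refine TensorProduct.ext (ext_words ?_)
    intro n e y hy
    ext z
    simp only [LinearMap.compr₂ₛₗ_apply, TensorProduct.mk_apply, LinearMap.comp_apply,
      TensorProduct.map_tmul, LinearMap.mul'_apply, LinearMap.smul_apply, AlgHom.toLinearMap_apply,
      koszul_word _ hy, map_smul, LinearMap.id_apply, LinearMap.mulLeft_apply]
    rw [smul_mul_assoc, ← mul_assoc, ← mul_assoc, ι_mul_ι 𝓛 (hq e y hy.mem_deg) ha,
      smul_mul_assoc, smul_smul, ← sgn_add]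
    congr 1
    apply sgn_congr
    exact ⟨(i - 1) * e, by ring⟩
  exact DFunLike.congr_fun e (comul 𝓛 x)

lemma koszul_conv {q : Sc 𝓛 →ₗ[K] L} {d : ℤ} (hq : Homog q d) (j : ℤ) (x : Sc 𝓛) :
    koszul 𝓛 j (conv q x) = sgn K (j * d) • conv q (koszul 𝓛 j x) := by
  have : (koszul 𝓛 j).toLinearMap ∘ₗ conv q =
      sgn K (j * d) • (conv q ∘ₗ (koszul 𝓛 j).toLinearMap) := by
    refine ext_words ?_
    intro n e x hx
    induction hx generalizing q d with
    | one => simp [koszul_ι j (hq 0 1 IsWord.one.mem_deg)]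
    | @cons n i e a x ha hx ih =>
      have h1 := ih (hq.comp_mulLeft ha)
      have h2 := ih hq
      simp only [LinearMap.comp_apply, AlgHom.toLinearMap_apply, LinearMap.smul_apply] at h1 h2 ⊢
      rw [conv_ι_mul hq ha, map_add, map_smul, map_mul, h1, h2, map_mul, koszul_ι j ha]
      simp only [smul_mul_assoc, map_smul]
      rw [conv_ι_mul hq ha]
      simp only [smul_add, smul_smul, mul_smul_comm, ← sgn_add]
      congr 2 <;> ring_nf
  exact DFunLike.congr_fun this x

/-- The map `conv q` is a coderivation. -/
lemma comul_conv {q : Sc 𝓛 →ₗ[K] L} {d : ℤ} (hq : Homog q d) :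
    comul 𝓛 ∘ₗ conv q = (TensorProduct.map (conv q) LinearMap.id +
      TensorProduct.map (koszul 𝓛 d).toLinearMap (conv q)) ∘ₗ comul 𝓛 := by
  refine ext_words ?_
  intro n e x hx
  induction hx generalizing q d with
  | one =>
    have := comul_ι_mul (𝓛 := 𝓛) (hq 0 1 IsWord.one.mem_deg) 1
    rw [mul_one] at this
    simp [this]
  | @cons n i e a x ha hx ih =>
    have h1 := ih (hq.comp_mulLeft ha)
    have h2 := ih hq
    simp only [LinearMap.comp_apply, LinearMap.add_apply] at h1 h2 ⊢
    rw [conv_ι_mul hq ha, map_add, map_smul, comul_ι_mul ha, h1, h2, map_comul_ι_mul _ _ ha,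
      map_comul_ι_mul _ _ ha]
    simp only [map_add, TensorProduct.map_map]
    set m := LinearMap.mulLeft K (ι 𝓛 a) with hm
    have e1 : conv q ∘ₗ m = conv (q ∘ₗ m) + sgn K (d * (i - 1)) • (m ∘ₗ conv q) := by
      ext y; simp [hm, conv_ι_mul hq ha]
    have e2 : (koszul 𝓛 d).toLinearMap ∘ₗ m =
        sgn K (d * (i - 1)) • (m ∘ₗ (koszul 𝓛 d).toLinearMap) := by
      ext y; simp [hm, koszul_ι _ ha]
    have e3 : (koszul 𝓛 (i - 1)).toLinearMap ∘ₗ conv q =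
        sgn K (d * (i - 1)) • (conv q ∘ₗ (koszul 𝓛 (i - 1)).toLinearMap) := by
      ext y; simp [koszul_conv hq, mul_comm]
    have e4 : (koszul 𝓛 d).toLinearMap ∘ₗ (koszul 𝓛 (i - 1)).toLinearMap =
        (koszul 𝓛 (d + (i - 1))).toLinearMap := by
      ext y; simp
    have e5 : (koszul 𝓛 (i - 1)).toLinearMap ∘ₗ (koszul 𝓛 d).toLinearMap =
        (koszul 𝓛 (d + (i - 1))).toLinearMap := by
      ext y; simp [add_comm]
    rw [e1, e2, e3, e4, e5]
    simp only [TensorProduct.map_add_left, TensorProduct.map_add_right, TensorProduct.map_smul_left,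
      TensorProduct.map_smul_right, LinearMap.add_apply, LinearMap.smul_apply, LinearMap.id_comp,
      LinearMap.comp_id, smul_add, smul_smul, sgn_mul_self, one_smul]
    abel

lemma conv_deg {q : Sc 𝓛 →ₗ[K] L} {d : ℤ} (hq : Homog q d) {n : ℤ} {x : Sc 𝓛}
    (hx : x ∈ deg 𝓛 n) : conv q x ∈ deg 𝓛 (n + d) := by
  refine Submodule.span_induction (p := fun x _ => conv q x ∈ deg 𝓛 (n + d)) ?_ (by simp) ?_ ?_ hx
  · rintro y ⟨m, hy⟩
    clear hx
    induction hy generalizing q d with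
    | one =>
      rw [conv_one]
      have := (isWord_ι (hq 0 1 IsWord.one.mem_deg)).mem_deg
      simpa using this
    | @cons n i e a x ha hx ih =>
      rw [conv_ι_mul hq ha]
      have h1 := ih (hq.comp_mulLeft ha)
      have h2 := Submodule.smul_mem _ (sgn K (d * (i - 1))) (ι_mul_mem_deg ha (ih hq))
      have e1 : e + (d + (i - 1)) = i - 1 + e + d := by ring
      have e2 : i - 1 + (e + d) = i - 1 + e + d := by ring
      rw [e1] at h1
      rw [e2] at h2
      exact Submodule.add_mem _ h1 h2
  · intro x y _ _ hx hy; rw [map_add]; exact Submodule.add_mem _ hx hy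
  · intro c x _ hx; rw [map_smul]; exact Submodule.smul_mem _ _ hx

/-- The components of `conv q` are given by `q`. -/
lemma proj_conv (q : Sc 𝓛 →ₗ[K] L) (x : Sc 𝓛) : proj 𝓛 (conv q x) = q x := by
  have e : proj 𝓛 ∘ₗ LinearMap.mul' K (Sc 𝓛) ∘ₗ TensorProduct.map (ι 𝓛 ∘ₗ q) LinearMap.id =
      (TensorProduct.rid K L).toLinearMap ∘ₗ TensorProduct.map q LinearMap.id ∘ₗ
        (counit 𝓛).toLinearMap.lTensor (Sc 𝓛) := by
    refine TensorProduct.ext' fun y z => ?_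
    simp [proj_ι_mul]
  have := DFunLike.congr_fun e (comul 𝓛 x)
  simp only [LinearMap.comp_apply] at this
  rw [lTensor_counit_comul] at this
  simpa [conv] using this

lemma scale_koszul (c : K) (i : ℤ) (x : Sc 𝓛) :
    scale c (koszul 𝓛 i x) = koszul 𝓛 i (scale c x) := by
  have : (scale c).comp (koszul 𝓛 i) = (koszul 𝓛 i).comp (scale c) :=
    algHom_ext_ι (fun j a ha => by
      simp only [AlgHom.comp_apply, koszul_ι _ ha, scale_ι, map_smul]; rw [smul_comm])
  exact DFunLike.congr_fun this x

lemma comul_scale (c : K) : comul 𝓛 ∘ₗ (scale c).toLinearMap =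
    TensorProduct.map (scale c).toLinearMap (scale c).toLinearMap ∘ₗ comul 𝓛 := by
  refine ext_cons (by simp) ?_
  intro j a ha x hx
  simp only [LinearMap.comp_apply, AlgHom.toLinearMap_apply] at hx ⊢
  rw [map_comul_ι_mul _ _ ha, map_mul, scale_ι, smul_mul_assoc, map_smul, comul_ι_mul ha, hx]
  simp only [TensorProduct.map_map]
  have e1 : (scale c).toLinearMap ∘ₗ LinearMap.mulLeft K (ι 𝓛 a) =
      c • (LinearMap.mulLeft K (ι 𝓛 a) ∘ₗ (scale c).toLinearMap) := by
    ext y; simp [scale_ι]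
  have e2 : (scale c).toLinearMap ∘ₗ (koszul 𝓛 (j - 1)).toLinearMap =
      (koszul 𝓛 (j - 1)).toLinearMap ∘ₗ (scale c).toLinearMap := by
    ext y; simp [scale_koszul]
  rw [e1, e2]
  simp [TensorProduct.map_smul_left, TensorProduct.map_smul_right]

lemma mul_comul (x : Sc 𝓛) : LinearMap.mul' K (Sc 𝓛) (comul 𝓛 x) = scale 2 x := by
  have : LinearMap.mul' K (Sc 𝓛) ∘ₗ comul 𝓛 = (scale 2).toLinearMap := by
    refine ext_cons (by simp) ?_
    intro j a ha x hx
    simp only [LinearMap.comp_apply, AlgHom.toLinearMap_apply] at hx ⊢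
    have e1 : LinearMap.mul' K (Sc 𝓛) ∘ₗ
        TensorProduct.map (LinearMap.mulLeft K (ι 𝓛 a)) LinearMap.id =
        LinearMap.mulLeft K (ι 𝓛 a) ∘ₗ LinearMap.mul' K (Sc 𝓛) := by
      refine TensorProduct.ext' fun y z => ?_
      simp [mul_assoc]
    have e2 : LinearMap.mul' K (Sc 𝓛) ∘ₗ TensorProduct.map (koszul 𝓛 (j - 1)).toLinearMap
        (LinearMap.mulLeft K (ι 𝓛 a)) = LinearMap.mulLeft K (ι 𝓛 a) ∘ₗ LinearMap.mul' K (Sc 𝓛) := by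
      refine TensorProduct.ext' fun y z => ?_
      simp [← mul_assoc, koszul_mul_ι ha]
    rw [comul_ι_mul ha, map_add, map_mul, scale_ι, ← hx]
    have h1 := DFunLike.congr_fun e1 (comul 𝓛 x)
    have h2 := DFunLike.congr_fun e2 (comul 𝓛 x)
    simp only [LinearMap.comp_apply, LinearMap.mulLeft_apply] at h1 h2
    rw [h1, h2, smul_mul_assoc, two_smul]
  exact DFunLike.congr_fun this x

/-- In characteristic `0` the primitive elements are exactly the cogenerators. -/
lemma eq_ι_proj_of_primitive [CharZero K] {x : Sc 𝓛} (hx : comul 𝓛 x = x ⊗ₜ 1 + 1 ⊗ₜ x) :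
    x = ι 𝓛 (proj 𝓛 x) := by
  set s : Module.End K (Sc 𝓛) := (scale 2).toLinearMap with hs
  have h2 : s x = (2 : K) • x := by
    have := mul_comul x
    rw [hx] at this
    simp only [map_add, LinearMap.mul'_apply, mul_one, one_mul] at this
    rw [two_smul, this]; rfl
  have hι : ∀ a, s (ι 𝓛 a) = (2 : K) • ι 𝓛 a := fun a => scale_ι 2 a
  have key : ∀ y : Sc 𝓛, ∃ P : Polynomial K, P.eval 2 ≠ 0 ∧
      Polynomial.aeval s P (y - ι 𝓛 (proj 𝓛 y)) = 0 := by
    intro y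
    have hy : y ∈ Submodule.span K {x : Sc 𝓛 | ∃ n d, IsWord 𝓛 n d x} := by
      rw [span_words]; trivial
    refine Submodule.span_induction (p := fun y _ => ∃ P : Polynomial K, P.eval 2 ≠ 0 ∧
      Polynomial.aeval s P (y - ι 𝓛 (proj 𝓛 y)) = 0) ?_ ⟨1, by simp⟩ ?_ ?_ hy
    · rintro y ⟨n, d, hy⟩
      by_cases hn : n = 1
      · subst hn
        refine ⟨1, by simp, ?_⟩
        cases hy with
        | cons ha hz => cases hz; simp
      · refine ⟨Polynomial.X - Polynomial.C (2 ^ n), ?_, ?_⟩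
        · simp only [Polynomial.eval_sub, Polynomial.eval_X, Polynomial.eval_C]
          rw [sub_ne_zero]
          intro h
          have : (2 : ℕ) ^ 1 = 2 ^ n := by exact_mod_cast (by simpa using h : (2 : K) ^ 1 = 2 ^ n)
          exact hn (Nat.pow_right_injective le_rfl this).symm
        · have hp : proj 𝓛 y = 0 := by
            cases hy with
            | one => simp
            | cons ha hz =>
              cases hz with
              | one => exact absurd rfl hn
              | cons => simp [proj_ι_mul]
          have := scale_word 2 hy
          rw [hp, map_zero, sub_zero, map_sub, Polynomial.aeval_X, Polynomial.aeval_C,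
            LinearMap.sub_apply, Module.algebraMap_end_apply, sub_eq_zero]
          exact this
    · rintro y z _ _ ⟨P, hP, hPy⟩ ⟨R, hR, hRz⟩
      refine ⟨P * R, by simp [hP, hR], ?_⟩
      rw [map_add, map_add, add_sub_add_comm, map_add]
      nth_rewrite 1 [mul_comm]
      rw [map_mul, map_mul, Module.End.mul_apply, Module.End.mul_apply, hPy, hRz]
      simp
    · rintro c y _ ⟨P, hP, hPy⟩
      refine ⟨P, hP, ?_⟩
      rw [map_smul, map_smul, ← smul_sub, map_smul, hPy, smul_zero]
  obtain ⟨P, hP, h0⟩ := key x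
  have hxs : s (x - ι 𝓛 (proj 𝓛 x)) = (2 : K) • (x - ι 𝓛 (proj 𝓛 x)) := by
    rw [map_sub, h2, hι, smul_sub]
  by_contra hne
  have hv : Module.End.HasEigenvector s 2 (x - ι 𝓛 (proj 𝓛 x)) :=
    ⟨Module.End.mem_eigenspace_iff.2 hxs, sub_ne_zero.2 hne⟩
  rw [Module.End.aeval_apply_of_hasEigenvector hv] at h0
  exact (smul_ne_zero hP (sub_ne_zero.2 hne)) h0

lemma map_comul_word_left {M N : Type*} [AddCommGroup M] [Module K M] [AddCommGroup N] [Module K N]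
    (g : Sc 𝓛 →ₗ[K] N) {n : ℕ} {d : ℤ} {x : Sc 𝓛} (hx : IsWord 𝓛 n d x) (D : Sc 𝓛 →ₗ[K] M)
    (hD : ∀ m e y, m < n → IsWord 𝓛 m e y → D y = 0) :
    TensorProduct.map D g (comul 𝓛 x) = D x ⊗ₜ g 1 := by
  induction hx generalizing D g with
  | one => simp
  | @cons n i e a x ha hx ih =>
    have hk : ∀ m e y, m < n + 1 → IsWord 𝓛 m e y →
        (D ∘ₗ (koszul 𝓛 (i - 1)).toLinearMap) y = 0 := by
      intro m e y hm hy
      simp [koszul_word _ hy, hD m e y hm hy]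
    rw [map_comul_ι_mul _ _ ha, ih g, ih (g ∘ₗ LinearMap.mulLeft K (ι 𝓛 a)),
      hk n e x (Nat.lt_succ_self n) hx]
    · simp
    · intro m e y hm hy
      exact hk m e y (by omega) hy
    · intro m e y hm hy
      exact hD _ _ _ (by omega) (IsWord.cons ha hy)

lemma map_comul_word_right {M N : Type*} [AddCommGroup M] [Module K M] [AddCommGroup N]
    [Module K N] (g : Sc 𝓛 →ₗ[K] N) {n : ℕ} {d : ℤ} {x : Sc 𝓛} (hx : IsWord 𝓛 n d x)
    (D : Sc 𝓛 →ₗ[K] M) (hD : ∀ m e y, m < n → IsWord 𝓛 m e y → D y = 0) :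
    TensorProduct.map g D (comul 𝓛 x) = g 1 ⊗ₜ D x := by
  induction hx generalizing D g with
  | one => simp
  | @cons n i e a x ha hx ih =>
    rw [map_comul_ι_mul _ _ ha, ih _ D, ih _ (D ∘ₗ LinearMap.mulLeft K (ι 𝓛 a)),
      hD n e x (Nat.lt_succ_self n) hx]
    · simp
    · intro m e y hm hy
      exact hD _ _ _ (by omega) (IsWord.cons ha hy)
    · intro m e y hm hy
      exact hD m e y (by omega) hy

/-- A (twisted) coderivation whose components vanish is zero. -/
lemma coderivation_eq_zero [CharZero K] (D g₁ g₂ : Sc 𝓛 →ₗ[K] Sc 𝓛) (h₁ : g₁ 1 = 1) (h₂ : g₂ 1 = 1)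
    (hD : comul 𝓛 ∘ₗ D = (TensorProduct.map D g₁ + TensorProduct.map g₂ D) ∘ₗ comul 𝓛)
    (hp : ∀ x, proj 𝓛 (D x) = 0) : D = 0 := by
  have key : ∀ n : ℕ, ∀ d x, IsWord 𝓛 n d x → D x = 0 := by
    intro n
    induction n using Nat.strong_induction_on with
    | _ n ih =>
      intro d x hx
      have h := DFunLike.congr_fun hD x
      simp only [LinearMap.comp_apply, LinearMap.add_apply] at h
      rw [map_comul_word_left _ hx _ (fun m e y hm hy => ih m hm e y hy),
        map_comul_word_right _ hx _ (fun m e y hm hy => ih m hm e y hy), h₁, h₂] at h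
      rw [eq_ι_proj_of_primitive h, hp, map_zero]
  exact ext_words (fun n d x hx => by rw [key n d x hx]; rfl)

end Cofree

variable (𝓛) in
/-- An `L_∞`-structure on the graded vector space `L = ⨁ 𝓛 i`: a coderivation `Q` of degree `+1` of
`S^c(L)` with `Q² = 0`. The structure may be curved. -/
structure LInftyStructure where
  /-- The codifferential. -/
  Q : Sc 𝓛 →ₗ[K] Sc 𝓛
  degree_one : ∀ n : ℤ, ∀ x ∈ deg 𝓛 n, Q x ∈ deg 𝓛 (n + 1)
  /-- `Δ ∘ Q = (Q ⊗ id + id ⊗ Q) ∘ Δ`, where `(id ⊗ Q)(x ⊗ y) = (-1)^{|x|} x ⊗ Q y`. -/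
  coderivation : comul 𝓛 ∘ₗ Q = (TensorProduct.map Q LinearMap.id +
    TensorProduct.map (koszul 𝓛 1).toLinearMap Q) ∘ₗ comul 𝓛
  sq_zero : Q ∘ₗ Q = 0

variable (𝓛) in
/-- The projection onto the homogeneous component of degree `i`. -/
def comp (i : ℤ) : L →ₗ[K] L :=
  (𝓛 i).subtype ∘ₗ DirectSum.component K ℤ (fun i => 𝓛 i) i ∘ₗ
    (DirectSum.decomposeLinearEquiv 𝓛).toLinearMap

lemma comp_apply (i : ℤ) (a : L) : comp 𝓛 i a = (DirectSum.decompose 𝓛 a i : L) := rfl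

lemma comp_mem (i : ℤ) (a : L) : comp 𝓛 i a ∈ 𝓛 i := (DirectSum.decompose 𝓛 a i).2

lemma comp_same {i : ℤ} {a : L} (ha : a ∈ 𝓛 i) : comp 𝓛 i a = a := by
  rw [comp_apply, DirectSum.decompose_of_mem_same 𝓛 ha]

lemma comp_ne {i j : ℤ} {a : L} (ha : a ∈ 𝓛 i) (h : i ≠ j) : comp 𝓛 j a = 0 := by
  rw [comp_apply, DirectSum.decompose_of_mem_ne 𝓛 ha h]

variable (𝓛) in
/-- The sign operator `a ↦ (-1)^{|a|} a` on `L[1]`. -/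
def sgnOp : L →ₗ[K] L := gradedLift 𝓛 fun i => sgn K (i - 1) • (𝓛 i).subtype

lemma sgnOp_apply {i : ℤ} {a : L} (ha : a ∈ 𝓛 i) : sgnOp 𝓛 a = sgn K (i - 1) • a := by
  simp [sgnOp, gradedLift_apply 𝓛 _ ha]

lemma sgnOp_sgnOp (a : L) : sgnOp 𝓛 (sgnOp 𝓛 a) = a := by
  refine homog_induction (𝓛 := 𝓛) (p := fun a => sgnOp 𝓛 (sgnOp 𝓛 a) = a) (by simp) ?_ ?_ a
  · intro a b ha hb; rw [map_add, map_add, ha, hb]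
  · intro i a ha; rw [sgnOp_apply ha, map_smul, sgnOp_apply ha, smul_smul, sgn_mul_self, one_smul]

/-- The value of `conv q` on a product of three elements on which `q` vanishes. -/
lemma conv_three {q : Sc 𝓛 →ₗ[K] L} (hq : Homog q 1) {i j k : ℤ} {a b c : L} (ha : a ∈ 𝓛 i)
    (hb : b ∈ 𝓛 j) (hc : c ∈ 𝓛 k) (h0 : q 1 = 0) (h1a : q (ι 𝓛 a) = 0) (h1b : q (ι 𝓛 b) = 0)
    (h1c : q (ι 𝓛 c) = 0) :
    conv q (ι 𝓛 a * (ι 𝓛 b * ι 𝓛 c)) = ι 𝓛 (q (ι 𝓛 a * (ι 𝓛 b * ι 𝓛 c))) +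
      sgn K ((1 + (i - 1) + (j - 1)) * (k - 1)) • (ι 𝓛 c * ι 𝓛 (q (ι 𝓛 a * ι 𝓛 b))) +
      sgn K ((1 + (i - 1)) * (j - 1)) • (ι 𝓛 b * ι 𝓛 (q (ι 𝓛 a * ι 𝓛 c))) +
      sgn K (i - 1) • (ι 𝓛 a * ι 𝓛 (q (ι 𝓛 b * ι 𝓛 c))) := by
  have hqa := hq.comp_mulLeft ha
  have hqab := hqa.comp_mulLeft hb
  have hqb := hq.comp_mulLeft hb
  have c1 : ∀ {p : Sc 𝓛 →ₗ[K] L} {e : ℤ}, Homog p e → conv p (ι 𝓛 c) =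
      ι 𝓛 (p (ι 𝓛 c)) + sgn K (e * (k - 1)) • (ι 𝓛 c * ι 𝓛 (p 1)) := by
    intro p e hp
    have := conv_ι_mul hp hc 1
    simpa using this
  rw [conv_ι_mul hq ha, conv_ι_mul hqa hb, conv_ι_mul hq hb, c1 hqab, c1 hqa, c1 hqb, c1 hq]
  simp [h0, h1a, h1b, h1c, add_assoc]

namespace LInftyStructure

variable (S : LInftyStructure 𝓛)

/-- All the Taylor coefficients `Q_n : S^n(L[1]) → L[2]` together: `proj ∘ Q`. -/
def coeff : Sc 𝓛 →ₗ[K] L := proj 𝓛 ∘ₗ S.Q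

/-- The structure is flat if `Q_0 = 0`. -/
def IsFlat : Prop := S.coeff 1 = 0

/-- The first Taylor coefficient `Q_1 : L → L`, which is the differential of a flat structure. -/
def d : L →ₗ[K] L := S.coeff ∘ₗ ι 𝓛

/-- The second Taylor coefficient `Q_2(a ∧ b)`. -/
def br : L →ₗ[K] L →ₗ[K] L :=
  LinearMap.mk₂ K (fun a b => S.coeff (ι 𝓛 a * ι 𝓛 b)) (by intros; simp [add_mul])
    (by intros; simp) (by intros; simp [mul_add]) (by intros; simp)

lemma d_apply (a : L) : S.d a = S.coeff (ι 𝓛 a) := rfl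

lemma br_apply (a b : L) : S.br a b = S.coeff (ι 𝓛 a * ι 𝓛 b) := rfl

lemma homog_coeff : Homog S.coeff 1 := fun n x hx => proj_mem (S.degree_one n x hx)

lemma Q_eq_conv [CharZero K] : S.Q = conv S.coeff := by
  rw [← sub_eq_zero]
  refine coderivation_eq_zero _ LinearMap.id (koszul 𝓛 1).toLinearMap rfl
    (map_one (koszul 𝓛 1)) ?_ ?_
  · rw [LinearMap.comp_sub, S.coderivation, comul_conv S.homog_coeff]
    rw [← LinearMap.sub_comp]
    congr 1
    refine TensorProduct.ext' fun x y => ?_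
    simp only [LinearMap.sub_apply, LinearMap.add_apply, TensorProduct.map_tmul,
      TensorProduct.sub_tmul, TensorProduct.tmul_sub]
    abel
  · intro x
    rw [LinearMap.sub_apply, map_sub, proj_conv]
    exact sub_self _

lemma coeff_Q (x : Sc 𝓛) : S.coeff (S.Q x) = 0 := by
  have := DFunLike.congr_fun S.sq_zero x
  simp only [LinearMap.comp_apply, LinearMap.zero_apply] at this
  simp [coeff, this]

lemma d_mem {i : ℤ} {a : L} (ha : a ∈ 𝓛 i) : S.d a ∈ 𝓛 (i + 1) := by
  have := S.homog_coeff _ _ (isWord_ι ha).mem_deg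
  have e : i - 1 + 1 + 1 = i + 1 := by ring
  rwa [e] at this

lemma br_mem {i j : ℤ} {a b : L} (ha : a ∈ 𝓛 i) (hb : b ∈ 𝓛 j) : S.br a b ∈ 𝓛 (i + j) := by
  have := S.homog_coeff _ _ (ι_mul_mem_deg ha (isWord_ι hb).mem_deg)
  have e : i - 1 + (j - 1) + 1 + 1 = i + j := by ring
  rwa [e] at this

lemma br_symm {i j : ℤ} {a b : L} (ha : a ∈ 𝓛 i) (hb : b ∈ 𝓛 j) :
    S.br a b = sgn K ((i - 1) * (j - 1)) • S.br b a := by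
  rw [br_apply, br_apply, ι_mul_ι 𝓛 ha hb, map_smul]

lemma d_comp (i : ℤ) (a : L) : S.d (comp 𝓛 i a) = comp 𝓛 (i + 1) (S.d a) := by
  refine homog_induction (𝓛 := 𝓛) (p := fun a => S.d (comp 𝓛 i a) = comp 𝓛 (i + 1) (S.d a))
    (by simp) ?_ ?_ a
  · intro a b ha hb; simp only [map_add, ha, hb]
  · intro j a ha
    by_cases h : j = i
    · subst h; rw [comp_same ha, comp_same (S.d_mem ha)]
    · rw [comp_ne ha h, comp_ne (S.d_mem ha) (by omega), map_zero]

lemma d_sgnOp (a : L) : S.d (sgnOp 𝓛 a) = - sgnOp 𝓛 (S.d a) := by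
  refine homog_induction (𝓛 := 𝓛) (p := fun a => S.d (sgnOp 𝓛 a) = - sgnOp 𝓛 (S.d a))
    (by simp) ?_ ?_ a
  · intro a b ha hb; simp only [map_add, ha, hb, neg_add]
  · intro j a ha
    rw [sgnOp_apply ha, sgnOp_apply (S.d_mem ha), map_smul, add_sub_right_comm, sgn_add]
    simp

variable {S}

lemma IsFlat.Q_ι [CharZero K] (h : S.IsFlat) {i : ℤ} {a : L} (ha : a ∈ 𝓛 i) :
    S.Q (ι 𝓛 a) = ι 𝓛 (S.d a) := by
  have := conv_ι_mul S.homog_coeff ha 1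
  rw [S.Q_eq_conv]
  have h0 : S.coeff 1 = 0 := h
  simpa [h0, d_apply] using this

lemma IsFlat.d_d [CharZero K] (h : S.IsFlat) (a : L) : S.d (S.d a) = 0 := by
  refine homog_induction (𝓛 := 𝓛) (p := fun a => S.d (S.d a) = 0) (by simp) ?_ ?_ a
  · intro a b ha hb; simp only [map_add, ha, hb, add_zero]
  · intro i a ha
    rw [d_apply, ← h.Q_ι ha, coeff_Q]

lemma IsFlat.d_br_homog [CharZero K] (h : S.IsFlat) {i j : ℤ} {a b : L} (ha : a ∈ 𝓛 i)
    (hb : b ∈ 𝓛 j) : S.d (S.br a b) + S.br (S.d a) b + S.br (sgnOp 𝓛 a) (S.d b) = 0 := by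
  have h0 : S.coeff 1 = 0 := h
  have e := conv_ι_mul S.homog_coeff ha (ι 𝓛 b)
  have e2 := conv_ι_mul (S.homog_coeff.comp_mulLeft ha) hb 1
  rw [mul_one] at e2
  rw [e2, ← S.Q_eq_conv, h.Q_ι hb] at e
  have e3 := S.coeff_Q (ι 𝓛 a * ι 𝓛 b)
  rw [e] at e3
  simp only [conv_one, LinearMap.comp_apply, LinearMap.mulLeft_apply, mul_one, map_add, map_smul,
    ← d_apply, ← br_apply, one_mul] at e3
  rw [S.br_symm (S.d_mem ha) hb, sgnOp_apply ha, map_smul, LinearMap.smul_apply, ← e3]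
  congr 4
  ring

lemma IsFlat.d_br [CharZero K] (h : S.IsFlat) (a b : L) :
    S.d (S.br a b) + S.br (S.d a) b + S.br (sgnOp 𝓛 a) (S.d b) = 0 := by
  refine homog_induction (𝓛 := 𝓛)
    (p := fun a => S.d (S.br a b) + S.br (S.d a) b + S.br (sgnOp 𝓛 a) (S.d b) = 0) (by simp) ?_ ?_ a
  · intro a a' ha ha'
    simp only [map_add, LinearMap.add_apply]
    rw [← add_zero (0 : L)]
    nth_rewrite 1 [← ha]
    rw [← ha']; abel
  · intro i a ha
    refine homog_induction (𝓛 := 𝓛)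
      (p := fun b => S.d (S.br a b) + S.br (S.d a) b + S.br (sgnOp 𝓛 a) (S.d b) = 0) (by simp) ?_ ?_ b
    · intro b b' hb hb'
      simp only [map_add]
      rw [← add_zero (0 : L)]
      nth_rewrite 1 [← hb]
      rw [← hb']; abel
    · intro j b hb
      exact h.d_br_homog ha hb

/-- The Jacobi identity up to exact terms on homogeneous cocycles. -/
lemma IsFlat.jacobi [CharZero K] (h : S.IsFlat) {i j k : ℤ} {a b c : L} (ha : a ∈ 𝓛 i)
    (hb : b ∈ 𝓛 j) (hc : c ∈ 𝓛 k) (da : S.d a = 0) (db : S.d b = 0) (dc : S.d c = 0) :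
    sgn K ((1 + (i - 1) + (j - 1)) * (k - 1)) • S.br c (S.br a b) +
      sgn K ((1 + (i - 1)) * (j - 1)) • S.br b (S.br a c) +
      sgn K (i - 1) • S.br a (S.br b c) =
    S.d (- S.coeff (ι 𝓛 a * (ι 𝓛 b * ι 𝓛 c))) := by
  have e := S.coeff_Q (ι 𝓛 a * (ι 𝓛 b * ι 𝓛 c))
  rw [S.Q_eq_conv, conv_three S.homog_coeff ha hb hc h da db dc] at e
  simp only [map_add, map_smul, ← d_apply, ← br_apply] at e
  rw [map_neg, eq_neg_iff_add_eq_zero, ← e]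
  abel

variable (S)

/-- The cocycles: the kernel of `Q_1`. -/
def cocycles : Submodule K L := LinearMap.ker S.d

/-- The cohomology `H(L) = ker Q_1 / im Q_1`. -/
def Cohomology : Type v := S.cocycles ⧸ (LinearMap.range S.d).submoduleOf S.cocycles

instance : AddCommGroup S.Cohomology :=
  inferInstanceAs (AddCommGroup (S.cocycles ⧸ (LinearMap.range S.d).submoduleOf S.cocycles))

instance : Module K S.Cohomology :=
  inferInstanceAs (Module K (S.cocycles ⧸ (LinearMap.range S.d).submoduleOf S.cocycles))

/-- The class of a cocycle. -/
def cls : S.cocycles →ₗ[K] S.Cohomology := Submodule.mkQ _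

lemma cls_surjective : Function.Surjective S.cls := Submodule.mkQ_surjective _

lemma cls_eq_zero_iff (z : S.cocycles) : S.cls z = 0 ↔ ∃ y, S.d y = z := by
  change Submodule.Quotient.mk z = 0 ↔ _
  rw [Submodule.Quotient.mk_eq_zero]; rfl

/-- A linear map on cocycles which vanishes on coboundaries descends to cohomology. -/
def cohLift {M : Type w} [AddCommGroup M] [Module K M] (f : S.cocycles →ₗ[K] M)
    (hf : ∀ z : S.cocycles, (∃ y, S.d y = z) → f z = 0) : S.Cohomology →ₗ[K] M :=
  Submodule.liftQ _ f (by
    intro z hz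
    exact hf z hz)

@[simp] lemma cohLift_cls {M : Type w} [AddCommGroup M] [Module K M] (f : S.cocycles →ₗ[K] M)
    (hf : ∀ z : S.cocycles, (∃ y, S.d y = z) → f z = 0) (z : S.cocycles) :
    S.cohLift f hf (S.cls z) = f z := Submodule.liftQ_apply _ _ _

/-- The part of degree `i` of the cohomology: the classes of the cocycles of degree `i`. -/
def cohGrading (i : ℤ) : Submodule K S.Cohomology := ((𝓛 i).submoduleOf S.cocycles).map S.cls

lemma cls_mem {i : ℤ} {z : S.cocycles} (hz : (z : L) ∈ 𝓛 i) : S.cls z ∈ S.cohGrading i :=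
  ⟨z, hz, rfl⟩

lemma mem_cohGrading {i : ℤ} {x : S.Cohomology} (hx : x ∈ S.cohGrading i) :
    ∃ z : S.cocycles, (z : L) ∈ 𝓛 i ∧ S.cls z = x := by
  obtain ⟨z, hz, rfl⟩ := hx
  exact ⟨z, hz, rfl⟩

/-- The homogeneous components of a cocycle are cocycles. -/
def cocycleComp (i : ℤ) : S.cocycles →ₗ[K] S.cocycles :=
  (comp 𝓛 i).restrict (p := S.cocycles) (q := S.cocycles) (by
    intro z hz
    have hz' : S.d z = 0 := hz
    change S.d _ = 0
    rw [d_comp, hz', map_zero])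

lemma coe_cocycleComp (i : ℤ) (z : S.cocycles) : (S.cocycleComp i z : L) = comp 𝓛 i z := rfl

/-- The projection of the cohomology onto its part of degree `i`. -/
def cohComp (i : ℤ) : S.Cohomology →ₗ[K] S.Cohomology :=
  S.cohLift (S.cls ∘ₗ S.cocycleComp i) (by
    rintro z ⟨y, hy⟩
    rw [LinearMap.comp_apply, cls_eq_zero_iff]
    refine ⟨comp 𝓛 (i - 1) y, ?_⟩
    rw [d_comp, hy, sub_add_cancel]; rfl)

lemma cohComp_same {i : ℤ} {x : S.Cohomology} (hx : x ∈ S.cohGrading i) : S.cohComp i x = x := by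
  obtain ⟨z, hz, rfl⟩ := S.mem_cohGrading hx
  have : S.cocycleComp i z = z := Subtype.ext (comp_same hz)
  simp [cohComp, this]

lemma cohComp_ne {i j : ℤ} {x : S.Cohomology} (hx : x ∈ S.cohGrading i) (h : i ≠ j) :
    S.cohComp j x = 0 := by
  obtain ⟨z, hz, rfl⟩ := S.mem_cohGrading hx
  have : S.cocycleComp j z = 0 := Subtype.ext (comp_ne hz h)
  simp [cohComp, this]

lemma isInternal_cohGrading : DirectSum.IsInternal S.cohGrading := by
  classical
  constructor
  · rw [injective_iff_map_eq_zero]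
    have key : ∀ x i, S.cohComp i (DirectSum.coeAddMonoidHom S.cohGrading x) = x i := by
      intro x i
      induction x using DirectSum.induction_on with
      | zero => simp
      | of j y =>
        rw [DirectSum.coeAddMonoidHom_of]
        by_cases h : j = i
        · subst h; rw [S.cohComp_same y.2, DirectSum.of_eq_same]
        · rw [S.cohComp_ne y.2 h, DirectSum.of_eq_of_ne _ _ _ (Ne.symm h)]; rfl
      | add x y hx hy =>
        rw [map_add, map_add, hx, hy]; rfl
    intro x hx
    ext i
    rw [← key x i, hx]; simp
  · intro x
    obtain ⟨z, rfl⟩ := S.cls_surjective x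
    have hz : z = ∑ i ∈ (DirectSum.decompose 𝓛 (z : L)).support, S.cocycleComp i z := by
      apply Subtype.ext
      rw [AddSubmonoidClass.coe_finsetSum]
      exact (DirectSum.sum_support_decompose 𝓛 (z : L)).symm
    refine ⟨∑ i ∈ (DirectSum.decompose 𝓛 (z : L)).support,
      DirectSum.of (fun i => S.cohGrading i) i
        ⟨S.cls (S.cocycleComp i z), S.cls_mem (comp_mem i _)⟩, ?_⟩
    rw [map_sum]
    conv_rhs => rw [hz, map_sum]
    exact Finset.sum_congr rfl fun i _ => DirectSum.coeAddMonoidHom_of _ _ _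

/-- The cohomology is a graded vector space. -/
instance : DirectSum.Decomposition S.cohGrading := S.isInternal_cohGrading.chooseDecomposition

end LInftyStructure

namespace LInftyStructure

variable {S : LInftyStructure 𝓛} [CharZero K]

lemma br_mem_cocycles (h : S.IsFlat) (a b : S.cocycles) : S.br a b ∈ S.cocycles := by
  have ha : S.d a = 0 := a.2
  have hb : S.d b = 0 := b.2
  have := h.d_br a b
  rw [ha, hb] at this
  change S.d _ = 0
  simpa using this

/-- The bracket `(a, b) ↦ [Q_2(a ∧ b)]` on cocycles. -/
def brCocycles (h : S.IsFlat) : S.cocycles →ₗ[K] S.cocycles →ₗ[K] S.Cohomology :=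
  LinearMap.mk₂ K (fun a b => S.cls ⟨S.br a b, br_mem_cocycles h a b⟩)
    (by intro a a' b; rw [← map_add]; congr 1; apply Subtype.ext; simp)
    (by intro c a b; rw [← map_smul]; congr 1; apply Subtype.ext; simp)
    (by intro a b b'; rw [← map_add]; congr 1; apply Subtype.ext; simp)
    (by intro c a b; rw [← map_smul]; congr 1; apply Subtype.ext; simp)

lemma brCocycles_apply (h : S.IsFlat) (a b : S.cocycles) :
    brCocycles h a b = S.cls ⟨S.br a b, br_mem_cocycles h a b⟩ := rfl

lemma brCocycles_right (h : S.IsFlat) (a b : S.cocycles) (hb : ∃ y, S.d y = b) :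
    brCocycles h a b = 0 := by
  obtain ⟨y, hy⟩ := hb
  rw [brCocycles_apply, cls_eq_zero_iff]
  have ha : S.d a = 0 := a.2
  have := h.d_br (sgnOp 𝓛 a) y
  rw [sgnOp_sgnOp, d_sgnOp, ha, hy] at this
  refine ⟨- S.br (sgnOp 𝓛 a) y, ?_⟩
  rw [map_neg, neg_eq_iff_add_eq_zero]
  simpa using this

lemma brCocycles_left (h : S.IsFlat) (a b : S.cocycles) (ha : ∃ y, S.d y = a) :
    brCocycles h a b = 0 := by
  obtain ⟨y, hy⟩ := ha
  rw [brCocycles_apply, cls_eq_zero_iff]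
  have hb : S.d b = 0 := b.2
  have := h.d_br y b
  rw [hb, hy] at this
  refine ⟨- S.br y b, ?_⟩
  rw [map_neg, neg_eq_iff_add_eq_zero]
  simpa using this

/-- The bracket on cohomology induced by `Q_2`. -/
def cohBr (h : S.IsFlat) : S.Cohomology →ₗ[K] S.Cohomology →ₗ[K] S.Cohomology :=
  S.cohLift
    { toFun := fun a => S.cohLift (brCocycles h a) (brCocycles_right h a)
      map_add' := by
        intro a a'; ext x
        obtain ⟨z, rfl⟩ := S.cls_surjective x
        simp
      map_smul' := by
        intro c a; ext x
        obtain ⟨z, rfl⟩ := S.cls_surjective x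
        simp }
    (by
      intro a ha; ext x
      obtain ⟨z, rfl⟩ := S.cls_surjective x
      simpa using brCocycles_left h a z ha)

@[simp] lemma cohBr_cls (h : S.IsFlat) (a b : S.cocycles) :
    cohBr h (S.cls a) (S.cls b) = S.cls ⟨S.br a b, br_mem_cocycles h a b⟩ := by
  simp [cohBr, brCocycles_apply]

lemma cohBr_mem (h : S.IsFlat) {i j : ℤ} {x y : S.Cohomology} (hx : x ∈ S.cohGrading i)
    (hy : y ∈ S.cohGrading j) : cohBr h x y ∈ S.cohGrading (i + j) := by
  obtain ⟨a, ha, rfl⟩ := S.mem_cohGrading hx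
  obtain ⟨b, hb, rfl⟩ := S.mem_cohGrading hy
  rw [cohBr_cls]
  exact S.cls_mem (S.br_mem ha hb)

lemma cohBr_symm (h : S.IsFlat) {i j : ℤ} {x y : S.Cohomology} (hx : x ∈ S.cohGrading i)
    (hy : y ∈ S.cohGrading j) : cohBr h x y = sgn K ((i - 1) * (j - 1)) • cohBr h y x := by
  obtain ⟨a, ha, rfl⟩ := S.mem_cohGrading hx
  obtain ⟨b, hb, rfl⟩ := S.mem_cohGrading hy
  rw [cohBr_cls, cohBr_cls, ← map_smul]
  congr 1
  exact Subtype.ext (S.br_symm ha hb)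

lemma cohBr_jacobi (h : S.IsFlat) {i j k : ℤ} {x y z : S.Cohomology} (hx : x ∈ S.cohGrading i)
    (hy : y ∈ S.cohGrading j) (hz : z ∈ S.cohGrading k) :
    sgn K ((1 + (i - 1) + (j - 1)) * (k - 1)) • cohBr h z (cohBr h x y) +
      sgn K ((1 + (i - 1)) * (j - 1)) • cohBr h y (cohBr h x z) +
      sgn K (i - 1) • cohBr h x (cohBr h y z) = 0 := by
  obtain ⟨a, ha, rfl⟩ := S.mem_cohGrading hx
  obtain ⟨b, hb, rfl⟩ := S.mem_cohGrading hy
  obtain ⟨c, hc, rfl⟩ := S.mem_cohGrading hz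
  simp only [cohBr_cls]
  rw [← map_smul, ← map_smul, ← map_smul, ← map_add, ← map_add, cls_eq_zero_iff]
  exact ⟨_, (h.jacobi ha hb hc a.2 b.2 c.2).symm⟩

/-- The components of the induced structure on cohomology: `Q_n = 0` for `n ≠ 2`, and
`Q_2([a] ∧ [b]) = [Q_2(a ∧ b)]`; see `cohCoeff_one`, `cohCoeff_ι_mul` and the lemmas after them. The
weight two part of `x` is one half of the product of the two factors of `(proj ⊗ proj)(Δ x)`. -/
def cohCoeff (h : S.IsFlat) : Sc S.cohGrading →ₗ[K] S.Cohomology :=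
  (2⁻¹ : K) • (TensorProduct.lift (cohBr h) ∘ₗ
    TensorProduct.map (proj S.cohGrading) (proj S.cohGrading) ∘ₗ comul S.cohGrading)

@[simp] lemma cohCoeff_one (h : S.IsFlat) : cohCoeff h 1 = 0 := by simp [cohCoeff]

lemma cohCoeff_ι_mul (h : S.IsFlat) (x : S.Cohomology) (y : Sc S.cohGrading) :
    cohCoeff h (ι S.cohGrading x * y) = cohBr h x (proj S.cohGrading y) := by
  refine homog_induction (𝓛 := S.cohGrading)
    (p := fun x => cohCoeff h (ι S.cohGrading x * y) = cohBr h x (proj S.cohGrading y))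
    (by simp) ?_ ?_ x
  · intro x x' hx hx'
    simp only [map_add, add_mul, LinearMap.add_apply, hx, hx']
  · intro i x hx
    have e : cohCoeff h ∘ₗ LinearMap.mulLeft K (ι S.cohGrading x) =
        cohBr h x ∘ₗ proj S.cohGrading := by
      refine ext_words ?_
      intro n d y hy
      simp only [cohCoeff, LinearMap.comp_apply, LinearMap.smul_apply, LinearMap.mulLeft_apply]
      rw [map_comul_ι_mul _ _ hx]
      have e1 : proj S.cohGrading ∘ₗ LinearMap.mulLeft K (ι S.cohGrading x) =
          LinearMap.toSpanSingleton K _ x ∘ₗ (counit S.cohGrading).toLinearMap := by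
        ext z; simp [proj_ι_mul]
      have hl : TensorProduct.map (counit S.cohGrading).toLinearMap LinearMap.id
          (comul S.cohGrading y) = 1 ⊗ₜ y := rTensor_counit_comul y
      have hr : TensorProduct.map LinearMap.id (counit S.cohGrading).toLinearMap
          (comul S.cohGrading y) = y ⊗ₜ 1 := lTensor_counit_comul y
      have f1 : TensorProduct.map (LinearMap.toSpanSingleton K _ x ∘ₗ
          (counit S.cohGrading).toLinearMap) (proj S.cohGrading) (comul S.cohGrading y) =
          x ⊗ₜ proj S.cohGrading y := by
        have := TensorProduct.map_map (LinearMap.toSpanSingleton K _ x) (proj S.cohGrading)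
          (counit S.cohGrading).toLinearMap LinearMap.id (comul S.cohGrading y)
        rw [hl] at this
        simpa using this.symm
      have f2 : TensorProduct.map (proj S.cohGrading ∘ₗ (koszul S.cohGrading (i - 1)).toLinearMap)
          (LinearMap.toSpanSingleton K _ x ∘ₗ (counit S.cohGrading).toLinearMap)
          (comul S.cohGrading y) = proj S.cohGrading (koszul S.cohGrading (i - 1) y) ⊗ₜ x := by
        have := TensorProduct.map_map
          (proj S.cohGrading ∘ₗ (koszul S.cohGrading (i - 1)).toLinearMap)
          (LinearMap.toSpanSingleton K _ x)
          LinearMap.id (counit S.cohGrading).toLinearMap (comul S.cohGrading y)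
        rw [hr] at this
        simpa using this.symm
      rw [e1, f1, f2, koszul_word _ hy, map_smul, map_add, TensorProduct.lift.tmul,
        TensorProduct.lift.tmul, map_smul, LinearMap.smul_apply,
        cohBr_symm h (proj_mem hy.mem_deg) hx, smul_smul, ← sgn_add, sgn_even, one_smul,
        ← two_smul K, smul_smul, inv_mul_cancel₀ two_ne_zero, one_smul]
      exact ⟨(i - 1) * d, by ring⟩
    exact DFunLike.congr_fun e y

/-- `Q_1 = 0` on cohomology. -/
lemma cohCoeff_ι (h : S.IsFlat) (x : S.Cohomology) : cohCoeff h (ι S.cohGrading x) = 0 := by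
  have := cohCoeff_ι_mul h x 1
  simpa using this

/-- `Q_2` on cohomology is induced by `Q_2`. -/
lemma cohCoeff_two (h : S.IsFlat) (a b : S.cocycles) :
    cohCoeff h (ι S.cohGrading (S.cls a) * ι S.cohGrading (S.cls b)) =
      S.cls ⟨S.br a b, br_mem_cocycles h a b⟩ := by
  rw [cohCoeff_ι_mul, proj_ι, cohBr_cls]

/-- `Q_n = 0` on cohomology for `n ≥ 3`. -/
lemma cohCoeff_three (h : S.IsFlat) (x y z : S.Cohomology) (w : Sc S.cohGrading) :
    cohCoeff h (ι S.cohGrading x * (ι S.cohGrading y * (ι S.cohGrading z * w))) = 0 := by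
  rw [cohCoeff_ι_mul, proj_ι_mul]; simp

lemma homog_cohCoeff (h : S.IsFlat) : Homog (cohCoeff h) 1 := by
  intro n x hx
  refine Submodule.span_induction (p := fun x _ => cohCoeff h x ∈ S.cohGrading (n + 1 + 1))
    ?_ (by simp) ?_ ?_ hx
  · rintro y ⟨m, hy⟩
    cases hy with
    | one => simp
    | @cons m i e a x ha hz =>
      rw [cohCoeff_ι_mul]
      have := cohBr_mem h ha (proj_mem hz.mem_deg)
      have e : i + (e + 1) = i - 1 + e + 1 + 1 := by ring
      rwa [e] at this
  · intro x y _ _ hx hy; rw [map_add]; exact Submodule.add_mem _ hx hy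
  · intro c x _ hx; rw [map_smul]; exact Submodule.smul_mem _ _ hx

lemma cohCoeff_scale (h : S.IsFlat) (x : Sc S.cohGrading) :
    cohCoeff h (scale 2 x) = (4 : K) • cohCoeff h x := by
  have : cohCoeff h ∘ₗ (scale 2).toLinearMap = (4 : K) • cohCoeff h := by
    refine ext_words ?_
    intro n d x hx
    simp only [LinearMap.comp_apply, AlgHom.toLinearMap_apply, LinearMap.smul_apply]
    rw [scale_word 2 hx, map_smul]
    cases hx with
    | one => simp
    | cons ha hx =>
      rw [cohCoeff_ι_mul]
      cases hx with
      | one => simp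
      | cons hb hx =>
        rw [proj_ι_mul]
        cases hx with
        | one => norm_num
        | cons hc hx => simp
  exact DFunLike.congr_fun this x

lemma conv_cohCoeff_scale (h : S.IsFlat) (x : Sc S.cohGrading) :
    conv (cohCoeff h) (scale 2 x) = (2 : K) • scale 2 (conv (cohCoeff h) x) := by
  have e1 := DFunLike.congr_fun (comul_scale (𝓛 := S.cohGrading) 2) x
  simp only [LinearMap.comp_apply, AlgHom.toLinearMap_apply] at e1
  simp only [conv, LinearMap.comp_apply]
  rw [e1]
  have e : LinearMap.mul' K (Sc S.cohGrading) ∘ₗ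
      TensorProduct.map (ι S.cohGrading ∘ₗ cohCoeff h) LinearMap.id ∘ₗ
      TensorProduct.map (scale 2).toLinearMap (scale 2).toLinearMap =
      (2 : K) • ((scale 2).toLinearMap ∘ₗ LinearMap.mul' K (Sc S.cohGrading) ∘ₗ
      TensorProduct.map (ι S.cohGrading ∘ₗ cohCoeff h) LinearMap.id) := by
    refine TensorProduct.ext' fun y z => ?_
    simp only [LinearMap.comp_apply, TensorProduct.map_tmul, AlgHom.toLinearMap_apply,
      LinearMap.mul'_apply, LinearMap.smul_apply, map_mul, LinearMap.id_apply, cohCoeff_scale,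
      map_smul, scale_ι, smul_mul_assoc, smul_smul]
    norm_num
  exact DFunLike.congr_fun e (comul S.cohGrading x)

lemma cohCoeff_conv (h : S.IsFlat) (x : Sc S.cohGrading) :
    cohCoeff h (conv (cohCoeff h) x) = 0 := by
  have : cohCoeff h ∘ₗ conv (cohCoeff h) = 0 := by
    refine ext_words ?_
    intro n d x hx
    simp only [LinearMap.comp_apply, LinearMap.zero_apply]
    by_cases hn : n = 3
    · subst hn
      cases hx with
      | cons ha hx => cases hx with
        | cons hb hx => cases hx with
          | cons hc hx => cases hx with
            | one =>
              rw [mul_one, conv_three (homog_cohCoeff h) ha hb hc (cohCoeff_one h)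
                (cohCoeff_ι h _) (cohCoeff_ι h _) (cohCoeff_ι h _)]
              simp only [map_add, map_smul, cohCoeff_ι, cohCoeff_ι_mul, proj_ι, zero_add]
              exact cohBr_jacobi h ha hb hc
    · have e := congrArg (cohCoeff h) (conv_cohCoeff_scale h x)
      rw [scale_word 2 hx, map_smul, map_smul, map_smul, cohCoeff_scale, smul_smul, ← sub_eq_zero,
        ← sub_smul, smul_eq_zero] at e
      refine e.resolve_left ?_
      intro h8
      rw [sub_eq_zero] at h8
      have h8' : (2 : ℕ) ^ n = 2 ^ 3 := by
        have : (2 : K) ^ n = 2 ^ 3 := by rw [h8]; norm_num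
        exact_mod_cast this
      exact hn (Nat.pow_right_injective le_rfl h8')
  exact DFunLike.congr_fun this x

/-- The `L_∞`-structure canonically induced on the cohomology of a flat `L_∞`-algebra: the graded
Lie algebra structure given by `Q_2([a] ∧ [b]) = [Q_2(a ∧ b)]` and `Q_n = 0` for `n ≠ 2`. -/
def cohomology (S : LInftyStructure 𝓛) (h : S.IsFlat) : LInftyStructure S.cohGrading where
  Q := conv (cohCoeff h)
  degree_one _ _ hx := conv_deg (homog_cohCoeff h) hx
  coderivation := comul_conv (homog_cohCoeff h)
  sq_zero := by
    have hc := comul_conv (homog_cohCoeff h)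
    refine coderivation_eq_zero _ LinearMap.id LinearMap.id rfl rfl ?_ ?_
    · set D := conv (cohCoeff h) with hD
      set k := (koszul S.cohGrading 1).toLinearMap with hk
      have hkD : k ∘ₗ D = -(D ∘ₗ k) := by
        ext x; simp [hk, hD, koszul_conv (homog_cohCoeff h)]
      have hkk : k ∘ₗ k = LinearMap.id := by
        ext x
        simp only [hk, LinearMap.comp_apply, AlgHom.toLinearMap_apply, koszul_koszul,
          LinearMap.id_apply]
        rw [koszul_congr (j := 0) (by decide), koszul_zero]
      rw [← LinearMap.comp_assoc, hc, LinearMap.comp_assoc, hc, ← LinearMap.comp_assoc]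
      congr 1
      rw [LinearMap.add_comp, LinearMap.comp_add, LinearMap.comp_add, ← TensorProduct.map_comp,
        ← TensorProduct.map_comp, ← TensorProduct.map_comp, ← TensorProduct.map_comp, hkk, hkD,
        LinearMap.id_comp, LinearMap.id_comp, LinearMap.comp_id]
      refine TensorProduct.ext' fun x y => ?_
      simp [TensorProduct.neg_tmul]
    · intro x
      rw [LinearMap.comp_apply, proj_conv, cohCoeff_conv]

/-- The components of the structure on cohomology are `cohCoeff`. -/
lemma coeff_cohomology (S : LInftyStructure 𝓛) (h : S.IsFlat) :
    (S.cohomology h).coeff = cohCoeff h :=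
  LinearMap.ext fun x => proj_conv _ x

end LInftyStructure

section Filtration

/-- `IsFilWord F k x`: the element `x` is a product `γ₁ ∧ … ∧ γₙ` with `γ_j ∈ F k_j` and
`k₁ + … + kₙ = k`. -/
inductive IsFilWord (𝓛 : ℤ → Submodule K L) (F : ℕ → Submodule K L) : ℕ → Sc 𝓛 → Prop
  | one : IsFilWord 𝓛 F 0 1
  | cons {j k : ℕ} {a : L} {x : Sc 𝓛} (ha : a ∈ F j) (hx : IsFilWord 𝓛 F k x) :
      IsFilWord 𝓛 F (j + k) (ι 𝓛 a * x)

/-- The filtration of `S^c(L)` induced by a filtration `F` of `L`. -/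
def scFil (𝓛 : ℤ → Submodule K L) (F : ℕ → Submodule K L) (k : ℕ) : Submodule K (Sc 𝓛) :=
  Submodule.span K {x | ∃ m, k ≤ m ∧ IsFilWord 𝓛 F m x}

/-- A complete descending filtration of an `L_∞`-algebra by graded subspaces, respecting the
`L_∞`-structure. Completeness (separatedness and convergence of Cauchy sequences) is understood in
every degree. -/
structure CompleteFiltration (S : LInftyStructure 𝓛) where
  /-- The subspaces of the filtration. -/
  F : ℕ → Submodule K L
  zero : F 0 = ⊤
  antitone : Antitone F
  homogeneous : ∀ k i, ∀ a ∈ F k, comp 𝓛 i a ∈ F k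
  separated : ⨅ k, F k = ⊥
  complete : ∀ i : ℤ, ∀ u : ℕ → L, (∀ n, u n ∈ 𝓛 i) → (∀ n, u (n + 1) - u n ∈ F n) →
    ∃ x ∈ 𝓛 i, ∀ n, x - u n ∈ F n
  respects : ∀ k, ∀ x ∈ scFil 𝓛 F k, S.Q x ∈ scFil 𝓛 F k

end Filtration

section Morphisms

variable {M : Type w} [AddCommGroup M] [Module K M] {𝓜 : ℤ → Submodule K M}
  [DirectSum.Decomposition 𝓜]

/-- An `L_∞`-morphism: a morphism `S^c(L) → S^c(M)` of counital coalgebras, of degree `0`, commuting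
with the codifferentials. -/
@[ext]
structure LInftyHom (S : LInftyStructure 𝓛) (T : LInftyStructure 𝓜) where
  /-- The underlying morphism of coalgebras. -/
  toCoalgHom : Sc 𝓛 →ₗc[K] Sc 𝓜
  degree_zero : ∀ n : ℤ, ∀ x ∈ deg 𝓛 n, toCoalgHom x ∈ deg 𝓜 n
  comm : ∀ x, toCoalgHom (S.Q x) = T.Q (toCoalgHom x)

namespace LInftyHom

variable {S : LInftyStructure 𝓛} {T : LInftyStructure 𝓜}

/-- Composition of `L_∞`-morphisms. -/
def comp {N : Type*} [AddCommGroup N] [Module K N] {𝓝 : ℤ → Submodule K N}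
    [DirectSum.Decomposition 𝓝] {U : LInftyStructure 𝓝} (G : LInftyHom T U) (F : LInftyHom S T) :
    LInftyHom S U where
  toCoalgHom := G.toCoalgHom.comp F.toCoalgHom
  degree_zero n x hx := G.degree_zero n _ (F.degree_zero n x hx)
  comm x := by simp [F.comm, G.comm]

/-- The first Taylor coefficient `F_1 : L → M`. -/
def linearPart (F : LInftyHom S T) : L →ₗ[K] M :=
  proj 𝓜 ∘ₗ F.toCoalgHom.toLinearMap ∘ₗ ι 𝓛

/-- `F_1` restricts to a quasi-isomorphism from the subcomplex `(A, Q_1)` of `L` to the subcomplex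
`(B, Q_1)` of `M`, that is, it induces a bijection from the cohomology of `A` to the cohomology
of `B`: every cocycle of `B` is cohomologous in `B` to the image of a cocycle of `A` (surjectivity),
and a cocycle of `A` whose image is a coboundary in `B` is a coboundary in `A` (injectivity). -/
def IsQuasiIsoOn (F : LInftyHom S T) (A : Submodule K L) (B : Submodule K M) : Prop :=
  (∀ b ∈ B, T.d b = 0 → ∃ a ∈ A, S.d a = 0 ∧ ∃ c ∈ B, b - F.linearPart a = T.d c) ∧
  (∀ a ∈ A, S.d a = 0 → (∃ c ∈ B, F.linearPart a = T.d c) → ∃ e ∈ A, a = S.d e)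

/-- An `L_∞`-quasi-isomorphism (of flat `L_∞`-algebras): `F_1` is a quasi-isomorphism. -/
def IsQuasiIso (F : LInftyHom S T) : Prop := F.IsQuasiIsoOn ⊤ ⊤

/-- The morphism preserves the given filtrations. -/
def IsFiltered (F : LInftyHom S T) (Φ : CompleteFiltration S) (Ψ : CompleteFiltration T) : Prop :=
  ∀ k, ∀ x ∈ scFil 𝓛 Φ.F k, F.toCoalgHom x ∈ scFil 𝓜 Ψ.F k

/-- A filtered quasi-isomorphism: the restriction of `F_1` to each step of the filtrations is a
quasi-isomorphism. -/
def IsFilteredQuasiIso (F : LInftyHom S T) (Φ : CompleteFiltration S) (Ψ : CompleteFiltration T) :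
    Prop := F.IsFiltered Φ Ψ ∧ ∀ k, F.IsQuasiIsoOn (Φ.F k) (Ψ.F k)

end LInftyHom

end Morphisms

end Basics

end LInfty

end

open scoped TensorProduct

set_option linter.unusedSectionVars false

noncomputable section

/-! The whole theorem reduces to one statement: the quasi-isomorphism `il` has a strict left inverse
`r`, an L∞-morphism with `r ∘ il = id` on the nose. Then `ir ∘ f ∘ r` is the required extension, and
it is filtered when its three factors are. The inverse is produced by `LInftyHom.exists_retraction`,
for any filtered quasi-isomorphism `f : A → S` from a minimal algebra (`Q_0 = 0`, `Q_1 = 0`). The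
unfiltered assertion is the case of trivial filtrations.

Linear algebra comes first. Since `A` has zero differential, the linear part `i` of `f` is the
inclusion of a filtered deformation retraction, with a projection `r` and a homotopy `h` satisfying
`d h + h d = id - i r` (`LInftyHom.exists_isContraction`). Completeness enters here: it gives a
filtered projection onto the cocycles (`exists_filtered_projection`).

The retraction is then built weight by weight, starting from the coalgebra map `S(r)`. Suppose the
coalgebra map `s` commutes with the codifferentials and satisfies `s ∘ f = id` in weights at most
`n`. In weight `n + 1` both defects, `s Q - Q s` and `s f - id`, take values in cogenerators,
because the reduced coproduct only sees lower weights and primitive elements are cogenerators in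
characteristic `0`. Let `O` and `E` be their components. By `Q² = 0` and minimality, `O` vanishes on
the image of the coderivation extending `d` and on the image of `S(i)`.

A correction `δ` in weight `n + 1` has to satisfy `δ ∘ d = -O` and `δ ∘ S(i) = -E`. Extended to
coderivations, `d` and `h` have anticommutator `N`, which counts the factors of a product lying in
the kernel of `i r`. On the eigenspaces with nonzero eigenvalue `N` is inverted by a polynomial `M`
in `N`; on the zero eigenspace, which lies in the image of `S(i)`, `O` vanishes. Hence `O M N = O`,
and `δ = -E S(r) - O M h` solves both equations
(`IsPartialRetraction.exists_obstruction_primitive`). Being a polynomial in `N`, `M` respects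
filtrations, and so does `δ`.

Adding `δ` to `s` would destroy compatibility with the coproduct, so `s` is precomposed with the
exponential of the coderivation with components `i δ` (`IsPartialRetraction.exists_modification`).
Each correction leaves the lower weights unchanged, so the sequence stabilizes on every element and
has a limit. -/

namespace LInfty

universe u v w

/-! ### Weights: the number of factors of a product. -/

section Weight

variable {K : Type u} [Field K] {L : Type v} [AddCommGroup L] [Module K L]

/-- The span of the products of exactly `n` homogeneous elements. -/
def wt (𝓛 : ℤ → Submodule K L) (n : ℕ) : Submodule K (Sc 𝓛) :=
  Submodule.span K {x | ∃ d, IsWord 𝓛 n d x}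

/-- The span of the products of at most `n` homogeneous elements. -/
def wtLe (𝓛 : ℤ → Submodule K L) (n : ℕ) : Submodule K (Sc 𝓛) :=
  Submodule.span K {x | ∃ m ≤ n, ∃ d, IsWord 𝓛 m d x}

variable {𝓛 : ℤ → Submodule K L}

lemma IsWord.mem_wt {n : ℕ} {d : ℤ} {x : Sc 𝓛} (h : IsWord 𝓛 n d x) : x ∈ wt 𝓛 n :=
  Submodule.subset_span ⟨d, h⟩

lemma IsWord.mem_wtLe {m n : ℕ} {d : ℤ} {x : Sc 𝓛} (h : IsWord 𝓛 m d x) (hmn : m ≤ n) :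
    x ∈ wtLe 𝓛 n :=
  Submodule.subset_span ⟨m, hmn, d, h⟩

lemma wtLe_mono {m n : ℕ} (h : m ≤ n) : wtLe 𝓛 m ≤ wtLe 𝓛 n :=
  Submodule.span_mono fun _ ⟨k, hk, hx⟩ => ⟨k, hk.trans h, hx⟩

lemma wt_le_wtLe {m n : ℕ} (h : m ≤ n) : wt 𝓛 m ≤ wtLe 𝓛 n :=
  Submodule.span_le.2 fun _ ⟨_, hx⟩ => hx.mem_wtLe h

lemma one_mem_wtLe (n : ℕ) : (1 : Sc 𝓛) ∈ wtLe 𝓛 n := IsWord.one.mem_wtLe (Nat.zero_le n)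

lemma wt_induction {n : ℕ} {M : Type*} [AddCommGroup M] [Module K M] {f : Sc 𝓛 →ₗ[K] M}
    {P : Submodule K M} (h : ∀ d x, IsWord 𝓛 n d x → f x ∈ P) {x : Sc 𝓛} (hx : x ∈ wt 𝓛 n) :
    f x ∈ P := by
  have : wt 𝓛 n ≤ P.comap f := Submodule.span_le.2 fun x ⟨d, hx⟩ => h d x hx
  exact this hx

lemma wtLe_induction {n : ℕ} {M : Type*} [AddCommGroup M] [Module K M] {f : Sc 𝓛 →ₗ[K] M}
    {P : Submodule K M} (h : ∀ m ≤ n, ∀ d x, IsWord 𝓛 m d x → f x ∈ P) {x : Sc 𝓛}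
    (hx : x ∈ wtLe 𝓛 n) : f x ∈ P := by
  have : wtLe 𝓛 n ≤ P.comap f := Submodule.span_le.2 fun x ⟨m, hm, d, hx⟩ => h m hm d x hx
  exact this hx

lemma eq_zero_of_wtLe {n : ℕ} {M : Type*} [AddCommGroup M] [Module K M] {f : Sc 𝓛 →ₗ[K] M}
    (h : ∀ m ≤ n, ∀ d x, IsWord 𝓛 m d x → f x = 0) {x : Sc 𝓛} (hx : x ∈ wtLe 𝓛 n) : f x = 0 := by
  have := wtLe_induction (f := f) (P := ⊥) (fun m hm d x hx => by simpa using h m hm d x hx) hx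
  simpa using this

lemma wtLe_succ_le (n : ℕ) : wtLe 𝓛 (n + 1) ≤ wtLe 𝓛 n ⊔ wt 𝓛 (n + 1) := by
  refine Submodule.span_le.2 fun x ⟨m, hm, d, hx⟩ => ?_
  rcases Nat.lt_or_ge n m with h | h
  · obtain rfl : m = n + 1 := by omega
    exact Submodule.mem_sup_right hx.mem_wt
  · exact Submodule.mem_sup_left (hx.mem_wtLe h)

/-- A linear map vanishing on weights at most `n` and on weight `n + 1` vanishes on weights at
most `n + 1`. -/
lemma eq_zero_of_wtLe_succ {n : ℕ} {M : Type*} [AddCommGroup M] [Module K M] {f : Sc 𝓛 →ₗ[K] M}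
    (h : ∀ x ∈ wtLe 𝓛 n, f x = 0) (h' : ∀ x ∈ wt 𝓛 (n + 1), f x = 0) {x : Sc 𝓛}
    (hx : x ∈ wtLe 𝓛 (n + 1)) : f x = 0 := by
  have : wtLe 𝓛 n ⊔ wt 𝓛 (n + 1) ≤ LinearMap.ker f := sup_le h h'
  exact this (wtLe_succ_le n hx)

lemma wtLe_zero {x : Sc 𝓛} (hx : x ∈ wtLe 𝓛 0) : ∃ c : K, x = c • 1 := by
  have := wtLe_induction (f := LinearMap.id) (P := K ∙ (1 : Sc 𝓛)) (fun m hm d x hx => by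
    obtain rfl : m = 0 := by omega
    cases hx; exact Submodule.mem_span_singleton_self _) hx
  obtain ⟨c, hc⟩ := Submodule.mem_span_singleton.1 this
  exact ⟨c, hc.symm⟩

lemma IsWord.mul {m n : ℕ} {d e : ℤ} {x y : Sc 𝓛} (hx : IsWord 𝓛 m d x) (hy : IsWord 𝓛 n e y) :
    IsWord 𝓛 (m + n) (d + e) (x * y) := by
  induction hx with
  | one => simpa using hy
  | cons ha _ ih =>
    have := IsWord.cons ha ih
    rwa [← mul_assoc, ← add_assoc, add_right_comm] at this

lemma mul_mem_wtLe {m n : ℕ} {x y : Sc 𝓛} (hx : x ∈ wtLe 𝓛 m) (hy : y ∈ wtLe 𝓛 n) :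
    x * y ∈ wtLe 𝓛 (m + n) := by
  refine wtLe_induction (f := LinearMap.mulRight K y) (fun i hi d x hx => ?_) hx
  refine wtLe_induction (f := LinearMap.mulLeft K x) (fun j hj e y hy => ?_) hy
  exact (hx.mul hy).mem_wtLe (by omega)

variable [DirectSum.Decomposition 𝓛]

lemma exists_mem_wtLe (x : Sc 𝓛) : ∃ n, x ∈ wtLe 𝓛 n := by
  have hx : x ∈ Submodule.span K {x : Sc 𝓛 | ∃ n d, IsWord 𝓛 n d x} := by
    rw [span_words]; trivial
  induction hx using Submodule.span_induction with
  | mem x h => obtain ⟨n, d, h⟩ := h; exact ⟨n, h.mem_wtLe le_rfl⟩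
  | zero => exact ⟨0, Submodule.zero_mem _⟩
  | add x y _ _ hx hy =>
    obtain ⟨m, hm⟩ := hx
    obtain ⟨n, hn⟩ := hy
    exact ⟨max m n, Submodule.add_mem _ (wtLe_mono (le_max_left _ _) hm)
      (wtLe_mono (le_max_right _ _) hn)⟩
  | smul c x _ hx => obtain ⟨n, hn⟩ := hx; exact ⟨n, Submodule.smul_mem _ c hn⟩

lemma ι_mem_wt (a : L) : ι 𝓛 a ∈ wt 𝓛 1 := by
  refine homog_induction (𝓛 := 𝓛) (p := fun a => ι 𝓛 a ∈ wt 𝓛 1) (by simp) ?_ ?_ a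
  · intro a b ha hb; rw [map_add]; exact Submodule.add_mem _ ha hb
  · intro i a ha; exact (isWord_ι ha).mem_wt

lemma ι_mul_mem_wtLe (a : L) {n : ℕ} {x : Sc 𝓛} (hx : x ∈ wtLe 𝓛 n) :
    ι 𝓛 a * x ∈ wtLe 𝓛 (n + 1) := by
  rw [add_comm]; exact mul_mem_wtLe (wt_le_wtLe le_rfl (ι_mem_wt a)) hx

/-- Weight and the coproduct: the reduced coproduct of a product of `n` elements is a combination
of tensors with two nonempty factors of total weight `n`. -/
lemma comul_word {n : ℕ} {d : ℤ} {x : Sc 𝓛} (hx : IsWord 𝓛 (n + 1) d x) :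
    comul 𝓛 x - (x ⊗ₜ 1 + 1 ⊗ₜ x) ∈ Submodule.span K {t : Sc 𝓛 ⊗[K] Sc 𝓛 | ∃ i j d e u v,
      i + j + 1 = n ∧ IsWord 𝓛 (i + 1) d u ∧ IsWord 𝓛 (j + 1) e v ∧ t = u ⊗ₜ v} := by
  generalize hm : n + 1 = m at hx
  induction hx generalizing n with
  | one => omega
  | @cons m i e a x ha hx ih =>
    obtain rfl : n = m := by omega
    rw [comul_ι_mul ha]
    cases n with
    | zero => cases hx; simp
    | succ n =>
      set P := Submodule.span K {t : Sc 𝓛 ⊗[K] Sc 𝓛 | ∃ i j d e u v,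
        i + j + 1 = n + 1 ∧ IsWord 𝓛 (i + 1) d u ∧ IsWord 𝓛 (j + 1) e v ∧ t = u ⊗ₜ v} with hP
      have ih := ih rfl
      set f := TensorProduct.map (LinearMap.mulLeft K (ι 𝓛 a)) (LinearMap.id (M := Sc 𝓛))
      set g := TensorProduct.map (koszul 𝓛 (i - 1)).toLinearMap (LinearMap.mulLeft K (ι 𝓛 a))
      have hf : f (comul 𝓛 x - (x ⊗ₜ 1 + 1 ⊗ₜ x)) ∈ P := by
        refine (Submodule.span_le.2 ?_ : _ ≤ P.comap f) ih
        rintro _ ⟨k, l, d, e, u, v, hkl, hu, hv, rfl⟩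
        exact Submodule.subset_span ⟨k + 1, l, _, _, _, _, by omega, IsWord.cons ha hu, hv, rfl⟩
      have hg : g (comul 𝓛 x - (x ⊗ₜ 1 + 1 ⊗ₜ x)) ∈ P := by
        refine (Submodule.span_le.2 ?_ : _ ≤ P.comap g) ih
        rintro _ ⟨k, l, d, e, u, v, hkl, hu, hv, rfl⟩
        have h1 : g (u ⊗ₜ v) = sgn K ((i - 1) * d) • (u ⊗ₜ (ι 𝓛 a * v)) := by
          simp [g, koszul_word _ hu, TensorProduct.smul_tmul']
        change g (u ⊗ₜ v) ∈ P
        rw [h1]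
        exact P.smul_mem _ (Submodule.subset_span
          ⟨k, l + 1, _, _, _, _, by omega, hu, IsWord.cons ha hv, rfl⟩)
      have h1 : ι 𝓛 a ⊗ₜ[K] x ∈ P :=
        Submodule.subset_span ⟨0, n, _, _, _, _, by omega, isWord_ι ha, hx, rfl⟩
      have h2 : x ⊗ₜ[K] ι 𝓛 a ∈ P :=
        Submodule.subset_span ⟨n, 0, _, _, _, _, by omega, hx, isWord_ι ha, rfl⟩
      -- The product of `a ⊗ 1 + 1 ⊗ a` with `x ⊗ 1 + 1 ⊗ x` is the primitive part of `a ∧ x` plus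
      -- the mixed terms `a ⊗ x` and `± x ⊗ a`; the reduced coproduct of `x` supplies the rest.
      have h3 : f (comul 𝓛 x) + g (comul 𝓛 x) -
          ((ι 𝓛 a * x) ⊗ₜ[K] (1 : Sc 𝓛) + (1 : Sc 𝓛) ⊗ₜ[K] (ι 𝓛 a * x)) =
          f (comul 𝓛 x - (x ⊗ₜ 1 + 1 ⊗ₜ x)) + g (comul 𝓛 x - (x ⊗ₜ 1 + 1 ⊗ₜ x)) +
          ι 𝓛 a ⊗ₜ[K] x + sgn K ((i - 1) * e) • (x ⊗ₜ[K] ι 𝓛 a) := by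
        simp only [map_sub, map_add, f, g, TensorProduct.map_tmul, LinearMap.mulLeft_apply,
          LinearMap.id_apply, AlgHom.toLinearMap_apply, map_one, mul_one, koszul_word _ hx,
          TensorProduct.smul_tmul']
        abel
      rw [h3]
      exact P.add_mem (P.add_mem (P.add_mem hf hg) h1) (P.smul_mem _ h2)

lemma scale_mem_wtLe (c : K) {n : ℕ} {x : Sc 𝓛} (hx : x ∈ wtLe 𝓛 n) : scale c x ∈ wtLe 𝓛 n := by
  refine wtLe_induction (f := (scale c).toLinearMap) (fun m hm d x hx => ?_) hx
  rw [AlgHom.toLinearMap_apply, scale_word c hx]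
  exact Submodule.smul_mem _ _ (hx.mem_wtLe hm)

/-- `scale 2` multiplies weight `m` by `2 ^ m`, and `2 ^ m - 2` is invertible for `m ≥ 2`. A top
weight above `n + 1` would therefore survive in the difference, and such weights can be removed one
at a time. Directness of the weight decomposition is not needed. -/
lemma mem_wtLe_of_scale [CharZero K] {n : ℕ} {x : Sc 𝓛} (hx : scale 2 x - (2 : K) • x ∈ wtLe 𝓛 (n + 1)) :
    x ∈ wtLe 𝓛 (n + 1) := by
  suffices ∀ N, x ∈ wtLe 𝓛 (n + 1 + N) → x ∈ wtLe 𝓛 (n + 1) by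
    obtain ⟨N, hN⟩ := exists_mem_wtLe x
    exact this N (wtLe_mono (by omega) hN)
  intro N
  induction N with
  | zero => exact id
  | succ N ih =>
    intro h
    refine ih ?_
    obtain ⟨y, hy, z, hz, rfl⟩ := Submodule.mem_sup.1 (wtLe_succ_le _ h)
    have hsz : scale 2 z = (2 : K) ^ (n + 1 + N + 1) • z := by
      have := wt_induction (f := (scale 2).toLinearMap - (2 : K) ^ (n + 1 + N + 1) • LinearMap.id)
        (P := ⊥) (fun d x hx => by simp [scale_word 2 hx]) hz
      simpa [sub_eq_zero] using this
    have h1 : scale 2 (y + z) - (2 : K) • (y + z) - (scale 2 y - (2 : K) • y) =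
        ((2 : K) ^ (n + 1 + N + 1) - 2) • z := by
      rw [map_add, hsz, sub_smul, smul_add]; abel
    have hc : (2 : K) ^ (n + 1 + N + 1) - 2 ≠ 0 := by
      rw [sub_ne_zero]
      intro h
      have : (2 : ℕ) ^ (n + 1 + N + 1) = 2 ^ 1 := by
        have : (2 : K) ^ (n + 1 + N + 1) = 2 ^ 1 := by rw [h, pow_one]
        exact_mod_cast this
      have := Nat.pow_right_injective le_rfl this
      omega
    have hz' : z ∈ wtLe 𝓛 (n + 1 + N) := by
      rw [← Submodule.smul_mem_iff _ hc, ← h1]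
      exact Submodule.sub_mem _ (wtLe_mono (by omega) hx)
        (Submodule.sub_mem _ (scale_mem_wtLe 2 hy) (Submodule.smul_mem _ _ hy))
    exact Submodule.add_mem _ hy hz'

end Weight

/-! ### Coalgebra maps and their leading terms. -/

section CoalgebraMaps

variable {K : Type u} [Field K] {L : Type v} [AddCommGroup L] [Module K L]
  {𝓛 : ℤ → Submodule K L} [DirectSum.Decomposition 𝓛]
  {M : Type w} [AddCommGroup M] [Module K M] {𝓜 : ℤ → Submodule K M} [DirectSum.Decomposition 𝓜]

/-- A linear map compatible with coproducts, counits and units. -/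
structure IsCoalgMap (F : Sc 𝓛 →ₗ[K] Sc 𝓜) : Prop where
  one : F 1 = 1
  comul : comul 𝓜 ∘ₗ F = TensorProduct.map F F ∘ₗ comul 𝓛
  counit : ∀ x, counit 𝓜 (F x) = counit 𝓛 x

lemma IsCoalgMap.id : IsCoalgMap (LinearMap.id : Sc 𝓛 →ₗ[K] Sc 𝓛) :=
  ⟨rfl, by simp, fun _ => rfl⟩

lemma IsCoalgMap.comp {N : Type*} [AddCommGroup N] [Module K N] {𝓝 : ℤ → Submodule K N}
    [DirectSum.Decomposition 𝓝] {G : Sc 𝓜 →ₗ[K] Sc 𝓝} {F : Sc 𝓛 →ₗ[K] Sc 𝓜} (hG : IsCoalgMap G)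
    (hF : IsCoalgMap F) : IsCoalgMap (G ∘ₗ F) := by
  refine ⟨by simp [hF.one, hG.one], ?_, fun x => by simp [hF.counit, hG.counit]⟩
  rw [← LinearMap.comp_assoc, hG.comul, LinearMap.comp_assoc, hF.comul, ← LinearMap.comp_assoc,
    TensorProduct.map_comp]

/-- A group-like element of `S^c(L)` is equal to `1`. -/
lemma eq_one_of_groupLike {x : Sc 𝓛} (hx : comul 𝓛 x = x ⊗ₜ x) (h1 : counit 𝓛 x = 1) : x = 1 := by
  have key : ∀ n, x ∈ wtLe 𝓛 n → x ∈ wtLe 𝓛 0 := by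
    intro n
    induction n with
    | zero => exact id
    | succ n ih =>
      intro h
      refine ih ?_
      by_contra hn
      -- A functional `f` that sees only the top weight of `x` kills `1` and all lower weights, so
      -- `f ⊗ f` annihilates the coproduct of `x`. Since `x` is group-like, this value is `(f x)²`.
      obtain ⟨f, hf, hfn⟩ := Submodule.exists_le_ker_of_notMem hn
      have hz : TensorProduct.map f f (comul 𝓛 x) = 0 := by
        refine eq_zero_of_wtLe (f := TensorProduct.map f f ∘ₗ comul 𝓛) (fun m hm d x hx => ?_) h
        rw [LinearMap.comp_apply, map_comul_word_left f hx f]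
        · have : f 1 = 0 := hfn (one_mem_wtLe n)
          rw [this, TensorProduct.tmul_zero]
        · intro k e y hk hy
          exact hfn (hy.mem_wtLe (by omega))
      rw [hx, TensorProduct.map_tmul] at hz
      have := congrArg (LinearMap.mul' K K) hz
      simp only [LinearMap.mul'_apply, map_zero, mul_self_eq_zero] at this
      exact hf this
  obtain ⟨n, hn⟩ := exists_mem_wtLe x
  obtain ⟨c, rfl⟩ := wtLe_zero (key n hn)
  simp only [map_smul, map_one, smul_eq_mul, mul_one] at h1
  rw [h1, one_smul]

/-- Morphisms of counital coalgebras are not required to preserve `1`; they do because the image of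
`1` is group-like. -/
lemma LInftyHom.isCoalgMap {S : LInftyStructure 𝓛} {T : LInftyStructure 𝓜} (F : LInftyHom S T) :
    IsCoalgMap F.toCoalgHom.toLinearMap := by
  have hc : comul 𝓜 ∘ₗ F.toCoalgHom.toLinearMap =
      TensorProduct.map F.toCoalgHom.toLinearMap F.toCoalgHom.toLinearMap ∘ₗ comul 𝓛 :=
    F.toCoalgHom.map_comp_comul.symm
  have hu : ∀ x, counit 𝓜 (F.toCoalgHom.toLinearMap x) = counit 𝓛 x := fun x =>
    DFunLike.congr_fun F.toCoalgHom.counit_comp x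
  refine ⟨eq_one_of_groupLike ?_ ?_, hc, hu⟩
  · have := DFunLike.congr_fun hc 1
    simpa using this
  · rw [hu, map_one]

/-- A twisted coderivation takes the lowest weight on which it does not vanish to cogenerators. -/
lemma eq_ι_proj_of_twisted [CharZero K] {D g₁ g₂ : Sc 𝓛 →ₗ[K] Sc 𝓜} (h₁ : g₁ 1 = 1) (h₂ : g₂ 1 = 1)
    (hD : comul 𝓜 ∘ₗ D = (TensorProduct.map D g₁ + TensorProduct.map g₂ D) ∘ₗ comul 𝓛)
    {n : ℕ} (h0 : ∀ x ∈ wtLe 𝓛 n, D x = 0) {x : Sc 𝓛} (hx : x ∈ wt 𝓛 (n + 1)) :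
    D x = ι 𝓜 (proj 𝓜 (D x)) := by
  have := wt_induction (f := D - ι 𝓜 ∘ₗ proj 𝓜 ∘ₗ D) (P := ⊥) (fun d x hx => by
    -- On a product of `n + 1` elements every term of the coproduct with a nonempty complementary
    -- factor is killed by `D`. What is left says that `D x` is primitive.
    have h := DFunLike.congr_fun hD x
    simp only [LinearMap.comp_apply, LinearMap.add_apply] at h
    have h0' : ∀ m e y, m < n + 1 → IsWord 𝓛 m e y → D y = 0 := fun m e y hm hy =>
      h0 y (hy.mem_wtLe (by omega))
    rw [map_comul_word_left _ hx _ h0', map_comul_word_right _ hx _ h0', h₁, h₂] at h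
    simp [← eq_ι_proj_of_primitive h]) hx
  simpa [sub_eq_zero] using this

/-- This is `F ⊗ F - G ⊗ G = (F - G) ⊗ F + G ⊗ (F - G)`: the difference is a coderivation twisted by
`F` and `G`. -/
lemma IsCoalgMap.comul_sub {F G : Sc 𝓛 →ₗ[K] Sc 𝓜} (hF : IsCoalgMap F) (hG : IsCoalgMap G) :
    LInfty.comul 𝓜 ∘ₗ (F - G) =
      (TensorProduct.map (F - G) F + TensorProduct.map G (F - G)) ∘ₗ LInfty.comul 𝓛 := by
  rw [LinearMap.comp_sub, hF.comul, hG.comul, ← LinearMap.sub_comp]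
  congr 1
  refine TensorProduct.ext' fun x y => ?_
  simp [TensorProduct.sub_tmul, TensorProduct.tmul_sub]

/-- Coalgebra maps agreeing in weights at most `n` differ in weight `n + 1` by their
components. -/
lemma IsCoalgMap.sub_eq_ι [CharZero K] {F G : Sc 𝓛 →ₗ[K] Sc 𝓜} (hF : IsCoalgMap F)
    (hG : IsCoalgMap G) {n : ℕ} (h : ∀ x ∈ wtLe 𝓛 n, F x = G x) {x : Sc 𝓛}
    (hx : x ∈ wt 𝓛 (n + 1)) : F x - G x = ι 𝓜 (proj 𝓜 (F x - G x)) :=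
  eq_ι_proj_of_twisted (D := F - G) hF.one hG.one (hF.comul_sub hG)
    (fun x hx => by simp [h x hx]) hx

/-- A coalgebra map fixing the unit takes primitive elements to primitive elements. -/
lemma IsCoalgMap.apply_ι [CharZero K] {F : Sc 𝓛 →ₗ[K] Sc 𝓜} (hF : IsCoalgMap F) (a : L) :
    F (ι 𝓛 a) = ι 𝓜 (proj 𝓜 (F (ι 𝓛 a))) := by
  refine eq_ι_proj_of_primitive ?_
  have h : LInfty.comul 𝓛 (ι 𝓛 a) = ι 𝓛 a ⊗ₜ 1 + 1 ⊗ₜ ι 𝓛 a := by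
    refine homog_induction (𝓛 := 𝓛)
      (p := fun a => LInfty.comul 𝓛 (ι 𝓛 a) = ι 𝓛 a ⊗ₜ 1 + 1 ⊗ₜ ι 𝓛 a) (by simp) ?_ ?_ a
    · intro a b ha hb
      rw [map_add, map_add, ha, hb, TensorProduct.add_tmul, TensorProduct.tmul_add]; abel
    · intro i a ha
      have := comul_ι_mul (𝓛 := 𝓛) ha 1
      simpa using this
  have := DFunLike.congr_fun hF.comul (ι 𝓛 a)
  simpa [h, hF.one] using this

/-- The morphism of symmetric coalgebras induced by a linear map of degree `0`. -/
def mapSc (φ : L →ₗ[K] M) (hφ : ∀ i, ∀ a ∈ 𝓛 i, φ a ∈ 𝓜 i) : Sc 𝓛 →ₐ[K] Sc 𝓜 :=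
  lift 𝓛 (ι 𝓜 ∘ₗ φ) (fun i j a ha b hb => ι_mul_ι 𝓜 (hφ i a ha) (hφ j b hb))

section MapSc

variable {φ : L →ₗ[K] M} (hφ : ∀ i, ∀ a ∈ 𝓛 i, φ a ∈ 𝓜 i)

@[simp] lemma mapSc_ι (a : L) : mapSc φ hφ (ι 𝓛 a) = ι 𝓜 (φ a) := by simp [mapSc]

lemma mapSc_koszul (i : ℤ) (x : Sc 𝓛) :
    mapSc φ hφ (koszul 𝓛 i x) = koszul 𝓜 i (mapSc φ hφ x) := by
  have : (mapSc φ hφ).comp (koszul 𝓛 i) = (koszul 𝓜 i).comp (mapSc φ hφ) :=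
    algHom_ext_ι (fun j a ha => by simp [koszul_ι _ ha, koszul_ι _ (hφ j a ha)])
  exact DFunLike.congr_fun this x

lemma isCoalgMap_mapSc : IsCoalgMap (mapSc φ hφ).toLinearMap := by
  refine ⟨map_one (mapSc φ hφ), ?_, ?_⟩
  · refine ext_cons (by simp) ?_
    intro j a ha x hx
    simp only [LinearMap.comp_apply, AlgHom.toLinearMap_apply] at hx ⊢
    rw [map_comul_ι_mul _ _ ha, map_mul, mapSc_ι, comul_ι_mul (hφ j a ha), hx]
    simp only [TensorProduct.map_map]
    have e1 : (mapSc φ hφ).toLinearMap ∘ₗ LinearMap.mulLeft K (ι 𝓛 a) =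
        LinearMap.mulLeft K (ι 𝓜 (φ a)) ∘ₗ (mapSc φ hφ).toLinearMap := by
      ext y; simp
    have e2 : (mapSc φ hφ).toLinearMap ∘ₗ (koszul 𝓛 (j - 1)).toLinearMap =
        (koszul 𝓜 (j - 1)).toLinearMap ∘ₗ (mapSc φ hφ).toLinearMap := by
      ext y; simp [mapSc_koszul]
    rw [e1, e2, LinearMap.id_comp]
  · have : (counit 𝓜).comp (mapSc φ hφ) = counit 𝓛 := algHom_ext_ι (fun j a ha => by simp)
    exact fun x => DFunLike.congr_fun this x

lemma mapSc_word {n : ℕ} {d : ℤ} {x : Sc 𝓛} (hx : IsWord 𝓛 n d x) :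
    IsWord 𝓜 n d (mapSc φ hφ x) := by
  induction hx with
  | one => simpa using IsWord.one
  | cons ha _ ih => rw [map_mul, mapSc_ι]; exact IsWord.cons (hφ _ _ ha) ih

lemma mapSc_wt {n : ℕ} {x : Sc 𝓛} (hx : x ∈ wt 𝓛 n) : mapSc φ hφ x ∈ wt 𝓜 n :=
  wt_induction (f := (mapSc φ hφ).toLinearMap) (fun _ _ hx => (mapSc_word hφ hx).mem_wt) hx

lemma mapSc_deg {d : ℤ} {x : Sc 𝓛} (hx : x ∈ deg 𝓛 d) : mapSc φ hφ x ∈ deg 𝓜 d :=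
  (Submodule.span_le.2 fun _ ⟨_, hx⟩ => (mapSc_word hφ hx).mem_deg :
    deg 𝓛 d ≤ (deg 𝓜 d).comap (mapSc φ hφ).toLinearMap) hx

end MapSc

/-- A coalgebra map agrees with the map induced by its linear part up to lower weights. -/
lemma IsCoalgMap.sub_mapSc_mem [CharZero K] {F : Sc 𝓛 →ₗ[K] Sc 𝓜} (hF : IsCoalgMap F)
    {φ : L →ₗ[K] M} (hφ : ∀ i, ∀ a ∈ 𝓛 i, φ a ∈ 𝓜 i) (h : ∀ a, F (ι 𝓛 a) = ι 𝓜 (φ a)) (n : ℕ)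
    {x : Sc 𝓛} (hx : x ∈ wt 𝓛 (n + 1)) : F x - mapSc φ hφ x ∈ wtLe 𝓜 n := by
  suffices ∀ d x, IsWord 𝓛 (n + 1) d x → F x - mapSc φ hφ x ∈ wtLe 𝓜 n from
    wt_induction (f := F - (mapSc φ hφ).toLinearMap) this hx
  clear hx x
  set G := (mapSc φ hφ).toLinearMap with hG'
  have hG := isCoalgMap_mapSc hφ
  rw [← hG'] at hG
  induction n using Nat.strong_induction_on with
  | _ n ih =>
    intro d x hx
    change (F - G) x ∈ wtLe 𝓜 n
    cases n with
    | zero =>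
      cases hx with
      | cons ha hx => cases hx; simp [G, h]
    | succ n =>
      -- Multiplication after the coproduct is `scale 2`. Applied to `(F - G) x`, the primitive part
      -- of the coproduct of `x` contributes exactly `2 (F - G) x`, and the reduced part has lower
      -- weight by induction.
      refine mem_wtLe_of_scale ?_
      rw [← mul_comul, ← LinearMap.comp_apply (LInfty.comul 𝓜), hF.comul_sub hG]
      have hw := comul_word hx
      set E := TensorProduct.map (F - G) F + TensorProduct.map G (F - G) with hE
      have h1 : LinearMap.mul' K (Sc 𝓜) (E (x ⊗ₜ 1 + 1 ⊗ₜ x)) = (2 : K) • (F - G) x := by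
        simp [hE, hF.one, hG.one, two_smul]
      rw [LinearMap.comp_apply, ← h1, ← map_sub, ← map_sub]
      refine (Submodule.span_le.2 ?_ :
        _ ≤ (wtLe 𝓜 (n + 1)).comap (LinearMap.mul' K (Sc 𝓜) ∘ₗ E)) hw
      rintro _ ⟨i, j, d, e, u, v, hij, hu, hv, rfl⟩
      have hu' := ih i (by omega) _ _ hu
      have hv' := ih j (by omega) _ _ hv
      have hGu := (mapSc_word hφ hu).mem_wtLe (le_refl _)
      have hFv : F v ∈ wtLe 𝓜 (j + 1) := by
        rw [← sub_add_cancel (F v) (mapSc φ hφ v)]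
        exact Submodule.add_mem _ (wtLe_mono (by omega) hv')
          ((mapSc_word hφ hv).mem_wtLe (le_refl _))
      have e : (LinearMap.mul' K (Sc 𝓜) ∘ₗ E) (u ⊗ₜ v) =
          (F u - mapSc φ hφ u) * F v + mapSc φ hφ u * (F v - mapSc φ hφ v) := by
        simp [hE, G]
      change (LinearMap.mul' K (Sc 𝓜) ∘ₗ E) (u ⊗ₜ v) ∈ wtLe 𝓜 (n + 1)
      rw [e]
      refine Submodule.add_mem _ (wtLe_mono ?_ (mul_mem_wtLe hu' hFv))
        (wtLe_mono ?_ (mul_mem_wtLe hGu hv')) <;> omega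

lemma IsCoalgMap.mem_wtLe [CharZero K] {F : Sc 𝓛 →ₗ[K] Sc 𝓜} (hF : IsCoalgMap F)
    {φ : L →ₗ[K] M} (hφ : ∀ i, ∀ a ∈ 𝓛 i, φ a ∈ 𝓜 i) (h : ∀ a, F (ι 𝓛 a) = ι 𝓜 (φ a)) {n : ℕ}
    {x : Sc 𝓛} (hx : x ∈ wtLe 𝓛 n) : F x ∈ wtLe 𝓜 n := by
  refine wtLe_induction (fun m hm d x hx => ?_) hx
  cases m with
  | zero => cases hx; rw [hF.one]; exact one_mem_wtLe n
  | succ m =>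
    rw [← sub_add_cancel (F x) (mapSc φ hφ x)]
    exact Submodule.add_mem _ (wtLe_mono (by omega) (hF.sub_mapSc_mem hφ h m hx.mem_wt))
      ((mapSc_word hφ hx).mem_wtLe hm)

end CoalgebraMaps

/-! ### Exponentials of locally nilpotent endomorphisms. -/

section LocallyNilpotentExp

variable {K : Type u} [Field K] {V : Type v} [AddCommGroup V] [Module K V]

/-- The exponential of a locally nilpotent endomorphism. -/
def lexp (D : Module.End K V) (hD : ∀ x, ∃ n, (D ^ n) x = 0) : Module.End K V :=
  -- The support is always finite, so the default value of `finsum` never occurs.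
  have key : ∀ x n, (D ^ n) x = 0 →
      ∑ᶠ k : ℕ, ((k.factorial : K)⁻¹ • (D ^ k) x) =
        ∑ k ∈ Finset.range n, (k.factorial : K)⁻¹ • (D ^ k) x := by
    intro x n h
    refine finsum_eq_sum_of_support_subset _ fun k hk => ?_
    by_contra hkn
    simp only [Finset.coe_range, Set.mem_Iio, not_lt] at hkn
    refine hk ?_
    change (k.factorial : K)⁻¹ • (D ^ k) x = 0
    rw [← Nat.sub_add_cancel hkn, pow_add, Module.End.mul_apply, h, map_zero, smul_zero]
  { toFun x := ∑ᶠ k : ℕ, ((k.factorial : K)⁻¹ • (D ^ k) x)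
    map_add' x y := by
      obtain ⟨m, hm⟩ := hD x
      obtain ⟨n, hn⟩ := hD y
      have hx : (D ^ (n + m)) x = 0 := by rw [pow_add, Module.End.mul_apply, hm, map_zero]
      have hy : (D ^ (n + m)) y = 0 := by
        rw [add_comm, pow_add, Module.End.mul_apply, hn, map_zero]
      rw [key x _ hx, key y _ hy, key (x + y) (n + m) (by rw [map_add, hx, hy, add_zero]),
        ← Finset.sum_add_distrib]
      exact Finset.sum_congr rfl fun k _ => by rw [map_add, smul_add]
    map_smul' c x := by
      obtain ⟨m, hm⟩ := hD x
      rw [key x _ hm, key (c • x) m (by rw [map_smul, hm, smul_zero]), RingHom.id_apply,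
        Finset.smul_sum]
      exact Finset.sum_congr rfl fun k _ => by rw [map_smul, smul_comm] }

variable {D : Module.End K V} (hD : ∀ x, ∃ n, (D ^ n) x = 0)

lemma lexp_apply {x : V} {n : ℕ} (h : (D ^ n) x = 0) :
    lexp D hD x = ∑ k ∈ Finset.range n, (k.factorial : K)⁻¹ • (D ^ k) x := by
  refine finsum_eq_sum_of_support_subset _ fun k hk => ?_
  by_contra hkn
  simp only [Finset.coe_range, Set.mem_Iio, not_lt] at hkn
  refine hk ?_
  change (k.factorial : K)⁻¹ • (D ^ k) x = 0
  rw [← Nat.sub_add_cancel hkn, pow_add, Module.End.mul_apply, h, map_zero, smul_zero]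

lemma lexp_of_apply_eq_zero {x : V} (h : D x = 0) : lexp D hD x = x := by
  rw [lexp_apply hD (n := 1) (by simpa using h)]; simp

lemma lexp_of_sq_eq_zero {x : V} (h : D (D x) = 0) : lexp D hD x = x + D x := by
  rw [lexp_apply hD (n := 2) (by rw [pow_two]; simpa using h)]
  simp [Finset.sum_range_succ]

lemma lexp_mem {P : Submodule K V} (h : ∀ x ∈ P, D x ∈ P) {x : V} (hx : x ∈ P) :
    lexp D hD x ∈ P := by
  obtain ⟨n, hn⟩ := hD x
  rw [lexp_apply hD hn]
  refine P.sum_mem fun k hk => P.smul_mem _ ?_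
  clear hk
  induction k with
  | zero => simpa using hx
  | succ k ih => rw [pow_succ', Module.End.mul_apply]; exact h _ ih

variable [CharZero K]

/-- The exponential of the sum of `D ⊗ 1` and `1 ⊗ D` is the tensor square of the exponential. -/
lemma sum_tensor_eq_map_lexp (t : V ⊗[K] V) : ∃ n, ∀ N ≥ n,
    ∑ k ∈ Finset.range N, (k.factorial : K)⁻¹ •
      (((TensorProduct.map D LinearMap.id + TensorProduct.map LinearMap.id D :
        Module.End K (V ⊗[K] V)) ^ k) t) = TensorProduct.map (lexp D hD) (lexp D hD) t := by
  set A : Module.End K (V ⊗[K] V) := TensorProduct.map D LinearMap.id with hA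
  set B : Module.End K (V ⊗[K] V) := TensorProduct.map LinearMap.id D with hB
  have hpA : ∀ k u v, (A ^ k) (u ⊗ₜ v) = ((D ^ k) u) ⊗ₜ v := by
    intro k u v
    induction k with
    | zero => simp
    | succ k ih => rw [pow_succ', Module.End.mul_apply, ih, pow_succ']; simp [hA]
  have hpB : ∀ k u v, (B ^ k) (u ⊗ₜ v) = u ⊗ₜ ((D ^ k) v) := by
    intro k u v
    induction k with
    | zero => simp
    | succ k ih => rw [pow_succ', Module.End.mul_apply, ih, pow_succ']; simp [hB]
  have hAB : Commute A B := by
    refine TensorProduct.ext' fun u v => ?_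
    simp [hA, hB]
  induction t using TensorProduct.induction_on with
  | zero => exact ⟨0, fun N _ => by simp⟩
  | add x y hx hy =>
    obtain ⟨m, hm⟩ := hx
    obtain ⟨n, hn⟩ := hy
    refine ⟨max m n, fun N hN => ?_⟩
    rw [map_add, ← hm N (by omega), ← hn N (by omega), ← Finset.sum_add_distrib]
    exact Finset.sum_congr rfl fun k _ => by rw [map_add, smul_add]
  | tmul u v =>
    obtain ⟨a, ha⟩ := hD u
    obtain ⟨b, hb⟩ := hD v
    have ha' : ∀ i, a ≤ i → (D ^ i) u = 0 := fun i hi => by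
      rw [← Nat.sub_add_cancel hi, pow_add, Module.End.mul_apply, ha, map_zero]
    have hb' : ∀ i, b ≤ i → (D ^ i) v = 0 := fun i hi => by
      rw [← Nat.sub_add_cancel hi, pow_add, Module.End.mul_apply, hb, map_zero]
    refine ⟨a + b, fun N hN => ?_⟩
    set f : ℕ → ℕ → V ⊗[K] V := fun i j =>
      ((i.factorial : K)⁻¹ • (D ^ i) u) ⊗ₜ ((j.factorial : K)⁻¹ • (D ^ j) v) with hf
    -- The binomial theorem for the commuting endomorphisms `D ⊗ 1` and `1 ⊗ D`; the factor `1 / k!`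
    -- turns binomial coefficients into the coefficients of the two exponentials.
    have h1 : ∀ k, (k.factorial : K)⁻¹ • (((A + B) ^ k) (u ⊗ₜ v)) =
        ∑ i ∈ Finset.range (k + 1), f i (k - i) := by
      intro k
      rw [hAB.add_pow, LinearMap.sum_apply, Finset.smul_sum]
      refine Finset.sum_congr rfl fun i hi => ?_
      have hik : i ≤ k := by simpa [Nat.lt_succ_iff] using hi
      rw [← nsmul_eq_mul', LinearMap.smul_apply, Module.End.mul_apply, hpB, hpA, hf]
      simp only
      rw [← Nat.cast_smul_eq_nsmul K, smul_smul, TensorProduct.smul_tmul_smul]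
      congr 1
      rw [Nat.cast_choose K hik]
      have : (k.factorial : K) ≠ 0 := Nat.cast_ne_zero.2 (Nat.factorial_ne_zero k)
      field_simp
    rw [Finset.sum_congr rfl fun k _ => h1 k, Finset.sum_range_diag_flip, TensorProduct.map_tmul,
      lexp_apply hD ha, lexp_apply hD hb, TensorProduct.sum_tmul]
    -- The terms vanish outside the rectangle `i < a`, `j < b`, and `a + b ≤ N` puts this rectangle
    -- inside the triangle `i + j < N`.
    rw [← Finset.sum_subset (Finset.range_subset_range.2 (show a ≤ N by omega))]
    · refine Finset.sum_congr rfl fun i hi => ?_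
      rw [Finset.mem_range] at hi
      rw [TensorProduct.tmul_sum]
      refine (Finset.sum_subset (Finset.range_subset_range.2 (show b ≤ N - i by omega)) ?_).symm
      intro j _ hj
      rw [Finset.mem_range, not_lt] at hj
      simp [hf, hb' j hj]
    · intro i _ hi
      rw [Finset.mem_range, not_lt] at hi
      exact Finset.sum_eq_zero fun j _ => by simp [hf, ha' i hi]

end LocallyNilpotentExp

/-! ### Coderivations: exponentials, effect on weights, linear coderivations, filtrations. -/

section Conv

variable {K : Type u} [Field K] {L : Type v} [AddCommGroup L] [Module K L]
  {𝓛 : ℤ → Submodule K L} [DirectSum.Decomposition 𝓛]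

/-- The exponential of a locally nilpotent coderivation of degree `0` is a coalgebra map. -/
lemma isCoalgMap_lexp [CharZero K] {q : Sc 𝓛 →ₗ[K] L} (hq : Homog q 0)
    (hD : ∀ x, ∃ n, (conv q ^ n : Module.End K (Sc 𝓛)) x = 0) (h1 : q 1 = 0) :
    IsCoalgMap (lexp (conv q) hD) := by
  refine ⟨lexp_of_apply_eq_zero hD (by simp [h1]), LinearMap.ext fun x => ?_, fun x => ?_⟩
  · set B : Module.End K (Sc 𝓛 ⊗[K] Sc 𝓛) :=
      TensorProduct.map (conv q) LinearMap.id + TensorProduct.map LinearMap.id (conv q) with hB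
    -- In degree `0` the Koszul sign is trivial, so the coproduct intertwines the coderivation with
    -- `D ⊗ 1 + 1 ⊗ D`, and hence also their exponentials.
    have h : ∀ x, comul 𝓛 (conv q x) = B (comul 𝓛 x) := by
      intro x
      have := DFunLike.congr_fun (comul_conv hq) x
      have e : (koszul 𝓛 0).toLinearMap = LinearMap.id := by ext y; simp
      rw [e] at this
      exact this
    have hk : ∀ k x, comul 𝓛 ((conv q ^ k : Module.End K (Sc 𝓛)) x) = (B ^ k) (comul 𝓛 x) := by
      intro k x
      induction k with
      | zero => simp
      | succ k ih => rw [pow_succ', pow_succ', Module.End.mul_apply, Module.End.mul_apply, h, ih]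
    obtain ⟨n, hn⟩ := sum_tensor_eq_map_lexp hD (comul 𝓛 x)
    obtain ⟨m, hm⟩ := hD x
    have hm' : (conv q ^ (n + m) : Module.End K (Sc 𝓛)) x = 0 := by
      rw [pow_add, Module.End.mul_apply, hm, map_zero]
    rw [LinearMap.comp_apply, LinearMap.comp_apply, ← hn (n + m) (by omega), lexp_apply hD hm',
      map_sum]
    exact Finset.sum_congr rfl fun k _ => by rw [map_smul, hk]
  · have h : (counit 𝓛).toLinearMap ∘ₗ conv q = 0 := by
      have e : (counit 𝓛).toLinearMap ∘ₗ LinearMap.mul' K (Sc 𝓛) ∘ₗ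
          TensorProduct.map (ι 𝓛 ∘ₗ q) LinearMap.id = 0 :=
        TensorProduct.ext' fun y z => by simp
      rw [conv, ← LinearMap.comp_assoc, ← LinearMap.comp_assoc,
        LinearMap.comp_assoc _ _ (counit 𝓛).toLinearMap, e, LinearMap.zero_comp]
    -- Only the zeroth term of the series survives under the counit, because the coderivation takes
    -- values in the ideal generated by the cogenerators.
    have hy : lexp (conv q) hD x - x ∈ LinearMap.ker (counit 𝓛).toLinearMap := by
      obtain ⟨m, hm⟩ := hD x
      have hm' : (conv q ^ (m + 1) : Module.End K (Sc 𝓛)) x = 0 := by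
        rw [pow_succ', Module.End.mul_apply, hm, map_zero]
      rw [lexp_apply hD hm', Finset.sum_range_succ']
      simp only [pow_zero, Nat.factorial_zero, Nat.cast_one, inv_one, one_smul,
        Module.End.one_apply, add_sub_cancel_right]
      refine Submodule.sum_mem _ fun k _ => Submodule.smul_mem _ _ ?_
      rw [pow_succ', Module.End.mul_apply]
      exact DFunLike.congr_fun h _
    rw [LinearMap.mem_ker, map_sub, sub_eq_zero] at hy
    exact hy

/-- If `q` vanishes in weights at most `p`, then `conv q` lowers weights by `p`. -/
lemma conv_mem_wtLe {q : Sc 𝓛 →ₗ[K] L} {p : ℕ} (hq : ∀ x ∈ wtLe 𝓛 p, q x = 0) {n : ℕ} {x : Sc 𝓛}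
    (hx : x ∈ wtLe 𝓛 n) : conv q x ∈ wtLe 𝓛 (n - p) := by
  refine wtLe_induction (fun m hm d x hx => ?_) hx
  rcases Nat.lt_or_ge p m with hpm | hpm
  · obtain ⟨m, rfl⟩ : ∃ k, m = k + 1 := ⟨m - 1, by omega⟩
    set f := LinearMap.mul' K (Sc 𝓛) ∘ₗ TensorProduct.map (ι 𝓛 ∘ₗ q) LinearMap.id with hf
    -- Of the two primitive terms, `1 ⊗ x` contributes nothing as `q 1 = 0`, and `x ⊗ 1` contributes
    -- the cogenerator `q x`, whose weight one is allowed since `p < n`.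
    have e : conv q x = f (comul 𝓛 x - (x ⊗ₜ 1 + 1 ⊗ₜ x)) + ι 𝓛 (q x) := by
      have : q 1 = 0 := hq 1 (one_mem_wtLe p)
      rw [map_sub, map_add]
      simp [hf, conv, this]
    rw [e]
    refine Submodule.add_mem _ ?_ (wt_le_wtLe (by omega) (ι_mem_wt _))
    refine (Submodule.span_le.2 ?_ : _ ≤ (wtLe 𝓛 (n - p)).comap f) (comul_word hx)
    rintro _ ⟨i, j, d, e, u, v, hij, hu, hv, rfl⟩
    change f (u ⊗ₜ v) ∈ wtLe 𝓛 (n - p)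
    simp only [hf, LinearMap.comp_apply, TensorProduct.map_tmul, LinearMap.mul'_apply,
      LinearMap.id_apply]
    -- Either `q` absorbs at least `p + 1` factors and replaces them by one, which costs at least
    -- `p` in weight, or it vanishes on `u`.
    rcases Nat.lt_or_ge p (i + 1) with h | h
    · exact wtLe_mono (by omega) (ι_mul_mem_wtLe _ (hv.mem_wtLe le_rfl))
    · rw [hq u (hu.mem_wtLe h), map_zero, zero_mul]; exact Submodule.zero_mem _
  · have : conv q x = 0 := by
      rw [conv, LinearMap.comp_apply, LinearMap.comp_apply,
        map_comul_word_left LinearMap.id hx (ι 𝓛 ∘ₗ q)]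
      · simp [hq x (hx.mem_wtLe hpm)]
      · intro k e y hk hy
        simp [hq y (hy.mem_wtLe (by omega))]
    rw [this]; exact Submodule.zero_mem _

/-- The coderivation with components `q` in the lowest weight on which `q` does not vanish. -/
lemma conv_eq_ι {q : Sc 𝓛 →ₗ[K] L} {n : ℕ} (hq : ∀ x ∈ wtLe 𝓛 n, q x = 0) {x : Sc 𝓛}
    (hx : x ∈ wt 𝓛 (n + 1)) : conv q x = ι 𝓛 (q x) := by
  have := wt_induction (f := conv q - ι 𝓛 ∘ₗ q) (P := ⊥) (fun d x hx => by
    have : conv q x = ι 𝓛 (q x) := by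
      rw [conv, LinearMap.comp_apply, LinearMap.comp_apply,
        map_comul_word_left LinearMap.id hx (ι 𝓛 ∘ₗ q)]
      · simp
      · intro k e y hk hy
        simp [hq y (hy.mem_wtLe (by omega))]
    simp [this]) hx
  simpa [sub_eq_zero] using this

lemma conv_eq_zero {q : Sc 𝓛 →ₗ[K] L} {n : ℕ} (hq : ∀ x ∈ wtLe 𝓛 n, q x = 0) {x : Sc 𝓛}
    (hx : x ∈ wtLe 𝓛 n) : conv q x = 0 := by
  refine eq_zero_of_wtLe (f := conv q) (fun m hm d x hx => ?_) hx
  rw [conv, LinearMap.comp_apply, LinearMap.comp_apply,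
    map_comul_word_left LinearMap.id hx (ι 𝓛 ∘ₗ q)]
  · simp [hq x (hx.mem_wtLe hm)]
  · intro k e y hk hy
    simp [hq y (hy.mem_wtLe (by omega))]

/-- A coderivation without components in weights `0` and `1` is locally nilpotent. -/
lemma conv_locallyNilpotent {q : Sc 𝓛 →ₗ[K] L} (hq : ∀ x ∈ wtLe 𝓛 1, q x = 0) (x : Sc 𝓛) :
    ∃ n, (conv q ^ n : Module.End K (Sc 𝓛)) x = 0 := by
  suffices ∀ n, ∀ x ∈ wtLe 𝓛 n, (conv q ^ (n + 1) : Module.End K (Sc 𝓛)) x = 0 by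
    obtain ⟨n, hn⟩ := exists_mem_wtLe x
    exact ⟨_, this n x hn⟩
  intro n
  induction n with
  | zero =>
    intro x hx
    rw [zero_add, pow_one]
    exact conv_eq_zero hq (wtLe_mono (Nat.zero_le 1) hx)
  | succ n ih =>
    intro x hx
    rw [pow_succ, Module.End.mul_apply]
    have h := conv_mem_wtLe hq hx
    rw [Nat.add_sub_cancel] at h
    exact ih (conv q x) h

/-! ### Extensions of linear maps to coderivations -/

/-- The coderivation extending a linear map of `L`. -/
def lin (φ : L →ₗ[K] L) : Sc 𝓛 →ₗ[K] Sc 𝓛 := conv (φ ∘ₗ proj 𝓛)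

/-- `φ` is homogeneous of degree `e`. -/
def HasDeg (𝓛 : ℤ → Submodule K L) (φ : L →ₗ[K] L) (e : ℤ) : Prop :=
  ∀ i, ∀ a ∈ 𝓛 i, φ a ∈ 𝓛 (i + e)

variable {φ ψ : L →ₗ[K] L} {e e' : ℤ}

lemma HasDeg.homog (hφ : HasDeg 𝓛 φ e) : Homog (φ ∘ₗ proj 𝓛) e := by
  intro n x hx
  have := hφ _ _ (proj_mem hx)
  rwa [add_right_comm] at this

@[simp] lemma lin_one : lin (𝓛 := 𝓛) φ 1 = 0 := by simp [lin]

/-- `φ ∘ proj` sees a product starting with `a` only when the remaining factor is a scalar. By the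
counit law the corresponding term of the coproduct gives `φ a ∧ x`, the first half of the graded
Leibniz rule. -/
lemma lin_ι_mul (hφ : HasDeg 𝓛 φ e) {i : ℤ} {a : L} (ha : a ∈ 𝓛 i) (x : Sc 𝓛) :
    lin φ (ι 𝓛 a * x) = ι 𝓛 (φ a) * x + sgn K (e * (i - 1)) • (ι 𝓛 a * lin φ x) := by
  rw [lin, conv_ι_mul hφ.homog ha]
  congr 1
  have h1 : (ι 𝓛 ∘ₗ (φ ∘ₗ proj 𝓛) ∘ₗ LinearMap.mulLeft K (ι 𝓛 a)) =
      LinearMap.toSpanSingleton K _ (ι 𝓛 (φ a)) ∘ₗ (counit 𝓛).toLinearMap := by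
    ext y; simp [proj_ι_mul]
  have h2 := TensorProduct.map_map (LinearMap.toSpanSingleton K _ (ι 𝓛 (φ a))) LinearMap.id
    (counit 𝓛).toLinearMap LinearMap.id (comul 𝓛 x)
  have h3 : TensorProduct.map (counit 𝓛).toLinearMap LinearMap.id (comul 𝓛 x) = 1 ⊗ₜ x :=
    rTensor_counit_comul x
  rw [h3] at h2
  rw [conv, LinearMap.comp_apply, LinearMap.comp_apply, h1]
  simp only [LinearMap.comp_id] at h2
  rw [← h2]
  simp

lemma sgn_add_one (n : ℤ) : sgn K (n + 1) = - sgn K n := by simp [sgn_add]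

lemma sgn_odd_mul (he : Odd e) (m : ℤ) : sgn K (e * m) = sgn K m := by
  refine sgn_congr ?_
  obtain ⟨k, rfl⟩ := he
  exact ⟨k * m, by ring⟩

/-- The anticommutator of the coderivations extending two linear maps of odd degrees. -/
lemma lin_anticomm (hφ : HasDeg 𝓛 φ e) (hψ : HasDeg 𝓛 ψ e') (he : Odd e) (he' : Odd e')
    (x : Sc 𝓛) : lin φ (lin ψ x) + lin ψ (lin φ x) = lin (φ ∘ₗ ψ + ψ ∘ₗ φ) x := by
  have hχ : HasDeg 𝓛 (φ ∘ₗ ψ + ψ ∘ₗ φ) (e + e') := by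
    intro i a ha
    refine Submodule.add_mem _ ?_ ?_
    · have := hφ _ _ (hψ _ _ ha)
      rwa [add_assoc, add_comm e'] at this
    · have := hψ _ _ (hφ _ _ ha)
      rwa [add_assoc] at this
  have : lin φ ∘ₗ lin ψ + lin ψ ∘ₗ lin φ = lin (𝓛 := 𝓛) (φ ∘ₗ ψ + ψ ∘ₗ φ) := by
    refine ext_cons (by simp) ?_
    intro i a ha x hx
    simp only [LinearMap.add_apply, LinearMap.comp_apply] at hx ⊢
    rw [lin_ι_mul hχ ha, ← hx, lin_ι_mul hψ ha, lin_ι_mul hφ ha, map_add, map_add,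
      lin_ι_mul hφ (hψ i a ha), lin_ι_mul hψ (hφ i a ha), map_smul, map_smul, lin_ι_mul hφ ha,
      lin_ι_mul hψ ha]
    simp only [sgn_odd_mul he, sgn_odd_mul he']
    have s1 : sgn K (i + e' - 1) = - sgn K (i - 1) := by
      rw [← sgn_add_one]
      refine sgn_congr ?_
      obtain ⟨k, rfl⟩ := he'
      exact ⟨k, by ring⟩
    have s2 : sgn K (i + e - 1) = - sgn K (i - 1) := by
      rw [← sgn_add_one]
      refine sgn_congr ?_
      obtain ⟨k, rfl⟩ := he
      exact ⟨k, by ring⟩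
    have s3 : sgn K ((e + e') * (i - 1)) = 1 := sgn_even ((he.add_odd he').mul_right _)
    rw [s1, s2, s3, one_smul, smul_add, smul_add, smul_smul, smul_smul, sgn_mul_self, one_smul,
      one_smul, mul_add, LinearMap.add_apply, map_add, add_mul]
    simp only [neg_smul, LinearMap.comp_apply]
    abel
  exact DFunLike.congr_fun this x

lemma lin_zero : lin (𝓛 := 𝓛) (0 : L →ₗ[K] L) = 0 := by simp [lin, conv]

/-- The anticommutator of an odd operator with itself is twice its square, and `2` is invertible. -/
lemma lin_lin_eq_zero [CharZero K] (hφ : HasDeg 𝓛 φ e) (he : Odd e) (h : φ ∘ₗ φ = 0) (x : Sc 𝓛) :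
    lin φ (lin φ x) = 0 := by
  have := lin_anticomm hφ hφ he he x
  rw [h, add_zero, lin_zero, LinearMap.zero_apply, ← two_smul K, smul_eq_zero] at this
  exact this.resolve_left two_ne_zero

lemma lin_mem_wt (hφ : HasDeg 𝓛 φ e) {n : ℕ} {x : Sc 𝓛} (hx : x ∈ wt 𝓛 n) : lin φ x ∈ wt 𝓛 n := by
  refine wt_induction (fun d x hx => ?_) hx
  clear * - hx hφ
  induction hx with
  | one => simp
  | @cons n i d a x ha hx ih =>
    rw [lin_ι_mul hφ ha]
    refine Submodule.add_mem _ (IsWord.cons (hφ i a ha) hx).mem_wt (Submodule.smul_mem _ _ ?_)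
    refine wt_induction (f := LinearMap.mulLeft K (ι 𝓛 a)) (fun d x hx => ?_)
      ih
    exact (IsWord.cons ha hx).mem_wt

/-- Applied to the differential and the retraction of a contraction; together with `lin_mapSc`,
applied to the homotopy and the inclusion, it decouples the two equations that a correction has to
satisfy. -/
lemma mapSc_lin {H : Type w} [AddCommGroup H] [Module K H] {𝓗 : ℤ → Submodule K H}
    [DirectSum.Decomposition 𝓗] (hφ : HasDeg 𝓛 φ e) {ρ : L →ₗ[K] H}
    (hρ : ∀ i, ∀ a ∈ 𝓛 i, ρ a ∈ 𝓗 i) (h : ∀ a, ρ (φ a) = 0) (x : Sc 𝓛) :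
    mapSc ρ hρ (lin φ x) = 0 := by
  have : (mapSc ρ hρ).toLinearMap ∘ₗ lin φ = 0 := by
    refine ext_cons (by simp) ?_
    intro i a ha x hx
    simp only [LinearMap.comp_apply, AlgHom.toLinearMap_apply, LinearMap.zero_apply] at hx ⊢
    rw [lin_ι_mul hφ ha, map_add, map_mul, mapSc_ι, h, map_smul, map_mul, hx]
    simp
  exact DFunLike.congr_fun this x

lemma lin_mapSc {H : Type w} [AddCommGroup H] [Module K H] {𝓗 : ℤ → Submodule K H}
    [DirectSum.Decomposition 𝓗] (hφ : HasDeg 𝓛 φ e) {σ : H →ₗ[K] L}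
    (hσ : ∀ i, ∀ a ∈ 𝓗 i, σ a ∈ 𝓛 i) (h : ∀ a, φ (σ a) = 0) (x : Sc 𝓗) :
    lin φ (mapSc σ hσ x) = 0 := by
  have : lin φ ∘ₗ (mapSc σ hσ).toLinearMap = 0 := by
    refine ext_cons (by simp) ?_
    intro i a ha x hx
    simp only [LinearMap.comp_apply, AlgHom.toLinearMap_apply, LinearMap.zero_apply] at hx ⊢
    rw [map_mul, mapSc_ι, lin_ι_mul hφ (hσ i a ha), hx, h]
    simp
  exact DFunLike.congr_fun this x

/-! ### Filtrations -/

variable {F : ℕ → Submodule K L}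

/-- Products of elements which are homogeneous and lie in steps of the filtration. -/
inductive IsHomogFilWord (𝓛 : ℤ → Submodule K L) (F : ℕ → Submodule K L) : ℕ → Sc 𝓛 → Prop
  | one : IsHomogFilWord 𝓛 F 0 1
  | cons {i : ℤ} {j k : ℕ} {a : L} {x : Sc 𝓛} (ha : a ∈ 𝓛 i) (haF : a ∈ F j)
      (hx : IsHomogFilWord 𝓛 F k x) : IsHomogFilWord 𝓛 F (j + k) (ι 𝓛 a * x)

/-- The induced filtration is spanned by products of homogeneous elements. -/
lemma scFil_induction (hF : ∀ k i, ∀ a ∈ F k, comp 𝓛 i a ∈ F k) {M : Type*} [AddCommGroup M]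
    [Module K M] {f : Sc 𝓛 →ₗ[K] M} {P : Submodule K M} {k : ℕ}
    (h : ∀ m ≥ k, ∀ x, IsHomogFilWord 𝓛 F m x → f x ∈ P) {x : Sc 𝓛} (hx : x ∈ scFil 𝓛 F k) :
    f x ∈ P := by
  classical
  have key : ∀ m x, IsFilWord 𝓛 F m x → x ∈ Submodule.span K {x | IsHomogFilWord 𝓛 F m x} := by
    intro m x hx
    induction hx with
    | one => exact Submodule.subset_span IsHomogFilWord.one
    | @cons j k a x ha hx ih =>
      have h1 : ι 𝓛 a = ∑ i ∈ (DirectSum.decompose 𝓛 a).support, ι 𝓛 (comp 𝓛 i a) := by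
        rw [← map_sum]
        exact congrArg _ (DirectSum.sum_support_decompose 𝓛 a).symm
      rw [h1, Finset.sum_mul]
      refine Submodule.sum_mem _ fun i _ => ?_
      refine (Submodule.span_le.2 ?_ : _ ≤ (Submodule.span K
        {x | IsHomogFilWord 𝓛 F (j + k) x}).comap (LinearMap.mulLeft K (ι 𝓛 (comp 𝓛 i a)))) ih
      intro y hy
      exact Submodule.subset_span (IsHomogFilWord.cons (comp_mem i a) (hF j i a ha) hy)
  have : scFil 𝓛 F k ≤ P.comap f := by
    refine Submodule.span_le.2 ?_
    rintro y ⟨m, hm, hy⟩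
    refine (Submodule.span_le.2 ?_ : _ ≤ P.comap f) (key m y hy)
    intro z hz
    exact h m hm z hz
  exact this hx

lemma IsFilWord.mem_scFil {k m : ℕ} {x : Sc 𝓛} (h : IsFilWord 𝓛 F m x) (hk : k ≤ m) :
    x ∈ scFil 𝓛 F k :=
  Submodule.subset_span ⟨m, hk, h⟩

lemma ι_mul_mem_scFil {j k : ℕ} {a : L} (ha : a ∈ F j) {x : Sc 𝓛} (hx : x ∈ scFil 𝓛 F k) :
    ι 𝓛 a * x ∈ scFil 𝓛 F (j + k) := by
  refine (Submodule.span_le.2 ?_ :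
    _ ≤ (scFil 𝓛 F (j + k)).comap (LinearMap.mulLeft K (ι 𝓛 a))) hx
  rintro y ⟨m, hm, hy⟩
  exact (IsFilWord.cons ha hy).mem_scFil (by omega)

lemma ι_mem_scFil {j : ℕ} {a : L} (ha : a ∈ F j) : ι 𝓛 a ∈ scFil 𝓛 F j := by
  have := ι_mul_mem_scFil (𝓛 := 𝓛) ha (IsFilWord.one.mem_scFil le_rfl)
  simpa using this

lemma counit_fil {m : ℕ} {x : Sc 𝓛} (hx : IsFilWord 𝓛 F m x) : m = 0 ∨ counit 𝓛 x = 0 := by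
  cases hx with
  | one => simp
  | cons => simp

/-- The projection is nonzero only on products with a single factor, and that factor carries the
whole filtration index. -/
lemma proj_mem_fil (hF : Antitone F) {k : ℕ} {x : Sc 𝓛} (hx : x ∈ scFil 𝓛 F k) :
    proj 𝓛 x ∈ F k := by
  refine (Submodule.span_le.2 ?_ : _ ≤ (F k).comap (proj 𝓛)) hx
  rintro y ⟨m, hm, hy⟩
  change proj 𝓛 y ∈ F k
  cases hy with
  | one => simp
  | cons ha hx =>
    rw [proj_ι_mul]
    rcases counit_fil hx with rfl | h
    · exact Submodule.smul_mem _ _ (hF hm ha)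
    · simp [h]

lemma conv_mem_scFil (hF : ∀ k i, ∀ a ∈ F k, comp 𝓛 i a ∈ F k) {q : Sc 𝓛 →ₗ[K] L} {d : ℤ}
    (hq : Homog q d) (hqF : ∀ k, ∀ x ∈ scFil 𝓛 F k, q x ∈ F k) {k : ℕ} {x : Sc 𝓛}
    (hx : x ∈ scFil 𝓛 F k) : conv q x ∈ scFil 𝓛 F k := by
  -- The shift `c` is what makes the induction run: absorbing a factor from `F j` turns `q` into a
  -- map that raises the filtration by `j` more.
  have key : ∀ m x, IsHomogFilWord 𝓛 F m x → ∀ (q : Sc 𝓛 →ₗ[K] L) (d : ℤ) (c : ℕ), Homog q d →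
      (∀ k, ∀ x ∈ scFil 𝓛 F k, q x ∈ F (k + c)) → conv q x ∈ scFil 𝓛 F (m + c) := by
    intro m x hx
    induction hx with
    | one =>
      intro q d c _ h
      rw [conv_one]
      exact ι_mem_scFil (h 0 1 (IsFilWord.one.mem_scFil le_rfl))
    | @cons i j k a x ha haF hx ih =>
      intro q d c hq h
      rw [conv_ι_mul hq ha]
      refine Submodule.add_mem _ ?_ (Submodule.smul_mem _ _ ?_)
      · have := ih _ _ (c + j) (hq.comp_mulLeft ha) (fun l y hy => by
          have := h _ _ (ι_mul_mem_scFil haF hy)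
          rw [show j + l + c = l + (c + j) by omega] at this
          exact this)
        rwa [show k + (c + j) = j + k + c by omega] at this
      · have := ι_mul_mem_scFil (𝓛 := 𝓛) haF (ih q d c hq h)
        rwa [← add_assoc] at this
  refine scFil_induction hF (fun m hm x hx => ?_) hx
  have := key m x hx q d 0 hq hqF
  exact (Submodule.span_mono fun y ⟨l, hl, hy⟩ => ⟨l, hm.trans hl, hy⟩ :
    scFil 𝓛 F (m + 0) ≤ scFil 𝓛 F k) this

lemma lin_mem_scFil (hF : ∀ k i, ∀ a ∈ F k, comp 𝓛 i a ∈ F k) (hF' : Antitone F)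
    (hφ : HasDeg 𝓛 φ e) (hφF : ∀ k, ∀ a ∈ F k, φ a ∈ F k) {k : ℕ} {x : Sc 𝓛}
    (hx : x ∈ scFil 𝓛 F k) : lin φ x ∈ scFil 𝓛 F k :=
  conv_mem_scFil hF hφ.homog (fun k _ hx => hφF k _ (proj_mem_fil hF' hx)) hx

lemma mapSc_mem_scFil {H : Type w} [AddCommGroup H] [Module K H] {𝓗 : ℤ → Submodule K H}
    [DirectSum.Decomposition 𝓗] {G : ℕ → Submodule K H} {ρ : L →ₗ[K] H} (hρ : ∀ i, ∀ a ∈ 𝓛 i, ρ a ∈ 𝓗 i)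
    (hρF : ∀ k, ∀ a ∈ F k, ρ a ∈ G k) {k : ℕ} {x : Sc 𝓛} (hx : x ∈ scFil 𝓛 F k) :
    mapSc ρ hρ x ∈ scFil 𝓗 G k := by
  have key : ∀ m x, IsFilWord 𝓛 F m x → IsFilWord 𝓗 G m (mapSc ρ hρ x) := by
    intro m x hx
    induction hx with
    | one => rw [map_one]; exact IsFilWord.one
    | cons ha _ ih => rw [map_mul, mapSc_ι]; exact IsFilWord.cons (hρF _ _ ha) ih
  refine (Submodule.span_le.2 ?_ :
    _ ≤ (scFil 𝓗 G k).comap (mapSc ρ hρ).toLinearMap) hx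
  rintro y ⟨m, hm, hy⟩
  exact (key m y hy).mem_scFil hm

end Conv

/-! ### Filtered projections in complete filtered vector spaces. -/

section FilteredLinearAlgebra

variable {K : Type u} [Field K] {V : Type v} [AddCommGroup V] [Module K V]

/-- A closed subspace of a complete filtered vector space has a filtered projection onto it. -/
lemma exists_filtered_projection (F : ℕ → Submodule K V) (hF : Antitone F) (h0 : F 0 = ⊤)
    (hsep : ⨅ k, F k = ⊥)
    (hcomp : ∀ u : ℕ → V, (∀ n, u (n + 1) - u n ∈ F n) → ∃ x, ∀ n, x - u n ∈ F n)
    (Z : Submodule K V) (hZ : ∀ x, (∀ n, ∃ z ∈ Z, x - z ∈ F n) → x ∈ Z) :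
    ∃ π : V →ₗ[K] V, (∀ v, π v ∈ Z) ∧ (∀ z ∈ Z, π z = z) ∧ ∀ k, ∀ v ∈ F k, π v ∈ F k := by
  -- An approximate projection at level `n`: split the map from `Z` onto its image in the quotient
  -- by `F n`, and extend the splitting to the whole quotient. It kills `F n` and is the identity on
  -- `Z` modulo `F n`, but need not respect the other steps.
  have hρ : ∀ n, ∃ ρ : V →ₗ[K] V, (∀ v, ρ v ∈ Z) ∧ (∀ z ∈ Z, ρ z - z ∈ F n) ∧
      ∀ v ∈ F n, ρ v = 0 := by
    intro n
    set g := (F n).mkQ ∘ₗ Z.subtype with hg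
    obtain ⟨σ₀, hσ₀⟩ := LinearMap.exists_rightInverse_of_surjective g.rangeRestrict
      g.range_rangeRestrict
    obtain ⟨σ, hσ⟩ := LinearMap.exists_extend σ₀
    refine ⟨Z.subtype ∘ₗ σ ∘ₗ (F n).mkQ, fun v => (σ _).2, fun z hz => ?_, fun v hv => ?_⟩
    · have h1 : σ (g ⟨z, hz⟩) = σ₀ (g.rangeRestrict ⟨z, hz⟩) :=
        DFunLike.congr_fun hσ (g.rangeRestrict ⟨z, hz⟩)
      have h2 : g.rangeRestrict (σ₀ (g.rangeRestrict ⟨z, hz⟩)) = g.rangeRestrict ⟨z, hz⟩ :=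
        DFunLike.congr_fun hσ₀ _
      have h3 := congrArg Subtype.val h2
      rw [← h1] at h3
      exact (Submodule.Quotient.eq _).1 h3
    · have : (F n).mkQ v = 0 := by simpa using hv
      simp [this]
  choose ρ hρZ hρz hρF using hρ
  -- Each step adds what `π n` misses of the next approximation. As `π n` is the identity on `Z`
  -- modulo `F n` and `ρ (n + 1)` lands in `Z`, the correction lies in `F n`, so the sequence is
  -- Cauchy. The start `0` is admissible because `F 0` is everything.
  let π : ℕ → V →ₗ[K] V := fun n =>
    Nat.rec 0 (fun n p => p + (LinearMap.id - p) ∘ₗ ρ (n + 1)) n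
  have hπ : ∀ n, π (n + 1) = π n + (LinearMap.id - π n) ∘ₗ ρ (n + 1) := fun _ => rfl
  have key : ∀ n, (∀ v, π n v ∈ Z) ∧ (∀ z ∈ Z, π n z - z ∈ F n) ∧ ∀ k, ∀ v ∈ F k, π n v ∈ F k := by
    intro n
    induction n with
    | zero => exact ⟨fun v => Z.zero_mem, fun z _ => by simp [h0], fun k v _ => (F k).zero_mem⟩
    | succ n ih =>
      obtain ⟨h1, h2, h3⟩ := ih
      refine ⟨fun v => ?_, fun z hz => ?_, fun k v hv => ?_⟩
      · rw [hπ]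
        exact Z.add_mem (h1 v) (Z.sub_mem (hρZ _ v) (h1 _))
      · have e : π (n + 1) z - z = (ρ (n + 1) z - z) - π n (ρ (n + 1) z - z) := by
          rw [hπ, map_sub]; simp; abel
        rw [e]
        exact (F _).sub_mem (hρz _ z hz) (h3 _ _ (hρz _ z hz))
      · rw [hπ]
        refine (F k).add_mem (h3 k v hv) ?_
        -- For `k > n` the correction vanishes on `F k`, since `ρ (n + 1)` kills `F (n + 1)`. For `k
        -- ≤ n` it lies in `F n`, hence in `F k`.
        rcases Nat.lt_or_ge n k with h | h
        · have : ρ (n + 1) v = 0 := hρF _ v (hF h hv)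
          simp [this]
        · refine hF h ?_
          rw [← neg_mem_iff]
          have := h2 _ (hρZ (n + 1) v)
          simpa using this
  have hcauchy : ∀ v n, π (n + 1) v - π n v ∈ F n := by
    intro v n
    rw [hπ, ← neg_mem_iff]
    have := (key n).2.1 _ (hρZ (n + 1) v)
    simpa using this
  choose p hp using fun v => hcomp (fun n => π n v) (hcauchy v)
  -- Separatedness makes the limit unique, which gives linearity of the limit and that it is the
  -- identity on `Z`.
  have huniq : ∀ v x, (∀ n, x - π n v ∈ F n) → x = p v := by
    intro v x hx
    rw [← sub_eq_zero, ← Submodule.mem_bot (R := K), ← hsep, Submodule.mem_iInf]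
    intro n
    have := (F n).sub_mem (hx n) (hp v n)
    simpa using this
  refine ⟨{ toFun := p, map_add' := ?_, map_smul' := ?_ }, fun v => ?_, fun z hz => ?_,
    fun k v hv => ?_⟩
  · intro v v'
    refine (huniq _ _ fun n => ?_).symm
    have := (F n).add_mem (hp v n) (hp v' n)
    rw [map_add]
    convert this using 1
    abel
  · intro c v
    refine (huniq _ _ fun n => ?_).symm
    have := (F n).smul_mem c (hp v n)
    rwa [smul_sub, ← map_smul] at this
  · exact hZ _ fun n => ⟨π n v, (key n).1 v, hp v n⟩
  · refine (huniq _ _ fun n => ?_).symm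
    have := (key n).2.1 z hz
    rwa [← neg_mem_iff, neg_sub] at this
  · have := (F k).add_mem (hp v k) ((key k).2.2 k v hv)
    simpa using this

end FilteredLinearAlgebra

/-! ### A filtered quasi-isomorphism from a minimal algebra as a deformation retraction. -/

section Contraction

variable {K : Type u} [Field K] {L : Type v} [AddCommGroup L] [Module K L]
  {𝓛 : ℤ → Submodule K L} [DirectSum.Decomposition 𝓛]
  {H : Type w} [AddCommGroup H] [Module K H] {𝓗 : ℤ → Submodule K H} [DirectSum.Decomposition 𝓗]

lemma comp_map {φ : L →ₗ[K] H} {e : ℤ} (hφ : ∀ i, ∀ a ∈ 𝓛 i, φ a ∈ 𝓗 (i + e)) (i : ℤ) (a : L) :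
    φ (comp 𝓛 i a) = comp 𝓗 (i + e) (φ a) := by
  refine homog_induction (𝓛 := 𝓛) (p := fun a => φ (comp 𝓛 i a) = comp 𝓗 (i + e) (φ a))
    (by simp) ?_ ?_ a
  · intro a b ha hb; simp only [map_add, ha, hb]
  · intro j a ha
    by_cases h : j = i
    · subst h; rw [comp_same ha, comp_same (hφ _ _ ha)]
    · rw [comp_ne ha h, comp_ne (hφ _ _ ha) (by omega), map_zero]

lemma sum_comp_mem {P : Submodule K L} {a : L} (h : ∀ i, comp 𝓛 i a ∈ P) : a ∈ P := by
  classical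
  rw [← DirectSum.sum_support_decompose 𝓛 a]
  exact P.sum_mem fun i _ => h i

lemma ext_comp {a b : L} (h : ∀ i, comp 𝓛 i a = comp 𝓛 i b) : a = b := by
  rw [← sub_eq_zero, ← Submodule.mem_bot (R := K)]
  exact sum_comp_mem (𝓛 := 𝓛) fun i => by simp [h i]

/-- A filtered projection of degree `0` onto the cocycles. -/
lemma CompleteFiltration.exists_projection {S : LInftyStructure 𝓛}
    (Φ : CompleteFiltration S) (hd : ∀ k, ∀ a ∈ Φ.F k, S.d a ∈ Φ.F k) :
    ∃ π : L →ₗ[K] L, (∀ i, ∀ a ∈ 𝓛 i, π a ∈ 𝓛 i) ∧ (∀ a, S.d (π a) = 0) ∧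
      (∀ a, S.d a = 0 → π a = a) ∧ ∀ k, ∀ a ∈ Φ.F k, π a ∈ Φ.F k := by
  have sep : ∀ a, (∀ k, a ∈ Φ.F k) → a = 0 := by
    intro a ha
    rw [← Submodule.mem_bot (R := K), ← Φ.separated, Submodule.mem_iInf]
    exact ha
  -- Completeness is available only degree by degree, so the projection is built in each degree and
  -- then assembled.
  have h : ∀ i, ∃ π : 𝓛 i →ₗ[K] 𝓛 i, (∀ a, S.d (π a) = 0) ∧ (∀ a : 𝓛 i, S.d a = 0 → π a = a) ∧
      ∀ k, ∀ a : 𝓛 i, (a : L) ∈ Φ.F k → (π a : L) ∈ Φ.F k := by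
    intro i
    refine exists_filtered_projection (fun k => (Φ.F k).comap (𝓛 i).subtype)
      (fun m n hmn => Submodule.comap_mono (Φ.antitone hmn)) (by simp [Φ.zero]) ?_ ?_
      ((LinearMap.ker S.d).comap (𝓛 i).subtype) ?_
    · rw [← Submodule.comap_iInf, Φ.separated, eq_bot_iff]
      intro a ha
      simpa using ha
    · intro u hu
      obtain ⟨x, hx, hxu⟩ := Φ.complete i (fun n => u n) (fun n => (u n).2) hu
      exact ⟨⟨x, hx⟩, hxu⟩
    · intro x hx
      -- The cocycles are closed: `d` preserves the filtration, so `d` of a limit of cocycles lies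
      -- in every step.
      refine sep _ fun k => ?_
      obtain ⟨z, hz, hxz⟩ := hx k
      have hz' : S.d z = 0 := hz
      have := hd k _ hxz
      simpa [hz'] using this
  choose π h1 h2 h3 using h
  have hπ : ∀ i, ∀ a, ∀ ha : a ∈ 𝓛 i, gradedLift 𝓛 (fun i => (𝓛 i).subtype ∘ₗ π i) a =
      π i ⟨a, ha⟩ := fun i a ha => gradedLift_apply 𝓛 _ ha
  set p := gradedLift 𝓛 (fun i => (𝓛 i).subtype ∘ₗ π i) with hp
  have hdeg : ∀ i, ∀ a ∈ 𝓛 i, p a ∈ 𝓛 (i + 0) := fun i a ha => by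
    rw [hπ i a ha, add_zero]; exact (π i _).2
  have hc : ∀ i a, comp 𝓛 i (p a) = π i ⟨comp 𝓛 i a, comp_mem i a⟩ := by
    intro i a
    have := comp_map hdeg i a
    rw [add_zero] at this
    rw [← this, hπ i _ (comp_mem i a)]
  refine ⟨p, fun i a ha => by simpa using hdeg i a ha, fun a => ?_, fun a ha => ?_,
    fun k a ha => ?_⟩
  · refine homog_induction (𝓛 := 𝓛) (p := fun a => S.d (p a) = 0) (by simp) ?_ ?_ a
    · intro a b ha hb; simp [ha, hb]
    · intro i a ha; rw [hπ i a ha]; exact h1 i _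
  · refine ext_comp (𝓛 := 𝓛) fun i => ?_
    rw [hc]
    refine congrArg Subtype.val (h2 i ⟨comp 𝓛 i a, comp_mem i a⟩ ?_)
    rw [S.d_comp, ha, map_zero]
  · refine sum_comp_mem (𝓛 := 𝓛) fun i => ?_
    rw [hc]
    exact h3 i k _ (Φ.homogeneous k i a ha)

/-- A filtered deformation retraction of a complex `(L, d)` onto a graded vector space `H` with zero
differential. -/
structure IsContraction (𝓛 : ℤ → Submodule K L) (𝓗 : ℤ → Submodule K H) (F : ℕ → Submodule K L)
    (G : ℕ → Submodule K H) (d : L →ₗ[K] L) (i : H →ₗ[K] L) (r : L →ₗ[K] H) (h : L →ₗ[K] L) :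
    Prop where
  i_deg : ∀ j, ∀ a ∈ 𝓗 j, i a ∈ 𝓛 j
  r_deg : ∀ j, ∀ a ∈ 𝓛 j, r a ∈ 𝓗 j
  h_deg : HasDeg 𝓛 h (-1)
  d_deg : HasDeg 𝓛 d 1
  i_fil : ∀ k, ∀ a ∈ G k, i a ∈ F k
  r_fil : ∀ k, ∀ a ∈ F k, r a ∈ G k
  h_fil : ∀ k, ∀ a ∈ F k, h a ∈ F k
  d_fil : ∀ k, ∀ a ∈ F k, d a ∈ F k
  d_d : d ∘ₗ d = 0
  r_i : ∀ a, r (i a) = a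
  r_d : ∀ a, r (d a) = 0
  d_i : ∀ a, d (i a) = 0
  h_i : ∀ a, h (i a) = 0
  homotopy : ∀ a, d (h a) + h (d a) = a - i (r a)

lemma CompleteFiltration.d_mem [CharZero K] {S : LInftyStructure 𝓛} (Φ : CompleteFiltration S) {k : ℕ}
    {a : L} (ha : a ∈ Φ.F k) : S.d a ∈ Φ.F k :=
  proj_mem_fil Φ.antitone (Φ.respects k _ (ι_mem_scFil ha))

lemma LInftyHom.apply_ι [CharZero K] {A : LInftyStructure 𝓗} {S : LInftyStructure 𝓛}
    (F : LInftyHom A S) (a : H) : F.toCoalgHom (ι 𝓗 a) = ι 𝓛 (F.linearPart a) :=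
  F.isCoalgMap.apply_ι a

lemma LInftyHom.linearPart_mem {A : LInftyStructure 𝓗} {S : LInftyStructure 𝓛}
    (F : LInftyHom A S) {j : ℤ} {a : H} (ha : a ∈ 𝓗 j) : F.linearPart a ∈ 𝓛 j := by
  have := proj_mem (F.degree_zero _ _ (isWord_ι ha).mem_deg)
  rwa [sub_add_cancel] at this

lemma LInftyHom.linearPart_d [CharZero K] {A : LInftyStructure 𝓗} {S : LInftyStructure 𝓛}
    (hA : A.IsFlat) (hS : S.IsFlat) (F : LInftyHom A S) (a : H) :
    F.linearPart (A.d a) = S.d (F.linearPart a) := by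
  refine homog_induction (𝓛 := 𝓗) (p := fun a => F.linearPart (A.d a) = S.d (F.linearPart a))
    (by simp) ?_ ?_ a
  · intro a b ha hb; simp only [map_add, ha, hb]
  · intro j a ha
    have := F.comm (ι 𝓗 a)
    rw [hA.Q_ι ha, F.apply_ι, F.apply_ι, hS.Q_ι (F.linearPart_mem ha)] at this
    simpa using congrArg (proj 𝓛) this

/-- A filtered quasi-isomorphism from a minimal algebra is the inclusion of a contraction. -/
lemma LInftyHom.exists_isContraction [CharZero K] {A : LInftyStructure 𝓗} {S : LInftyStructure 𝓛}
    (hA : A.IsFlat) (hAd : A.d = 0) (hS : S.IsFlat) (f : LInftyHom A S) {ΦA : CompleteFiltration A}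
    {Φ : CompleteFiltration S} (hf : f.IsFilteredQuasiIso ΦA Φ) :
    ∃ r h, IsContraction 𝓛 𝓗 Φ.F ΦA.F S.d f.linearPart r h := by
  obtain ⟨hf, hqi⟩ := hf
  set i := f.linearPart with hi
  have i_deg : ∀ j, ∀ a ∈ 𝓗 j, i a ∈ 𝓛 j := fun j a ha => f.linearPart_mem ha
  have hdi : ∀ a, S.d (i a) = 0 := fun a => by
    rw [hi, ← f.linearPart_d hA hS, hAd, LinearMap.zero_apply, map_zero]
  obtain ⟨π, π_deg, hdπ, hπ, π_fil⟩ := Φ.exists_projection (fun k a ha => Φ.d_mem ha)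
  have hmem0 : ∀ x, x ∈ Φ.F 0 := fun x => by rw [Φ.zero]; trivial
  have hmem0' : ∀ x, x ∈ ΦA.F 0 := fun x => by rw [ΦA.zero]; trivial
  -- With zero differential on the source, injectivity in cohomology means that only `0` has an
  -- exact image.
  have hinj : ∀ a c, i a = S.d c → a = 0 := by
    intro a c hac
    obtain ⟨e, -, he⟩ := (hqi 0).2 a (hmem0' a) (by simp [hAd]) ⟨c, hmem0 c, hac⟩
    rw [he, hAd, LinearMap.zero_apply]
  have hex : ∀ k x, x ∈ Φ.F k → ∃ a ∈ ΦA.F k, ∃ c ∈ Φ.F k, π x - i a = S.d c := by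
    intro k x hx
    obtain ⟨a, ha, -, c, hc, h⟩ := (hqi k).1 (π x) (π_fil k x hx) (hdπ x)
    exact ⟨a, ha, c, hc, h⟩
  -- The witnesses of `π x - i a = d c` define the retraction `x ↦ a` and the homotopy `x ↦ c - π
  -- c`. Both turn out not to depend on the choice, so linearity, degree and filtration can each be
  -- checked on witnesses convenient for that property.
  choose r₀ hr₀ c₀ hc₀ hrc using fun x => hex 0 x (hmem0 x)
  have hr_uniq : ∀ x a c, π x - i a = S.d c → r₀ x = a := by
    intro x a c h
    rw [← sub_eq_zero]
    refine hinj _ (c - c₀ x) ?_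
    rw [map_sub, map_sub, ← h, ← hrc x]; abel
  -- Two primitives `c` differ by a cocycle, which `π` fixes; subtracting `π c` removes the
  -- ambiguity.
  have hh_uniq : ∀ x a c, π x - i a = S.d c → c₀ x - π (c₀ x) = c - π c := by
    intro x a c h
    have h1 := hr_uniq x a c h
    have h2 : S.d (c₀ x - c) = 0 := by rw [map_sub, ← h, ← hrc x, h1, sub_self]
    have h3 := hπ _ h2
    rw [map_sub, sub_eq_sub_iff_add_eq_add] at h3
    rw [sub_eq_sub_iff_add_eq_add, add_comm, add_comm c, add_comm (π c), h3, add_comm]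
  let r : L →ₗ[K] H :=
    { toFun := r₀
      map_add' := fun x y => hr_uniq _ _ (c₀ x + c₀ y) (by
        rw [map_add, map_add, map_add, ← hrc, ← hrc]; abel)
      map_smul' := fun c x => hr_uniq _ _ (c • c₀ x) (by
        simp only [map_smul, RingHom.id_apply, ← hrc, smul_sub]) }
  let h : L →ₗ[K] L :=
    { toFun := fun x => c₀ x - π (c₀ x)
      map_add' := fun x y => by
        rw [hh_uniq (x + y) (r₀ x + r₀ y) (c₀ x + c₀ y) (by
          rw [map_add, map_add, map_add, ← hrc, ← hrc]; abel), map_add]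
        abel
      map_smul' := fun c x => by
        rw [hh_uniq (c • x) (c • r₀ x) (c • c₀ x) (by
          simp only [map_smul, ← hrc, smul_sub]), map_smul, RingHom.id_apply, smul_sub] }
  have hr : ∀ x a c, π x - i a = S.d c → r x = a := hr_uniq
  have hh : ∀ x a c, π x - i a = S.d c → h x = c - π c := hh_uniq
  -- Homogeneous components of the chosen witnesses are again witnesses, which gives the degrees of
  -- `r` and `h`.
  have hcomp : ∀ j, ∀ x ∈ 𝓛 j, π x - i (LInfty.comp 𝓗 j (r₀ x)) = S.d (LInfty.comp 𝓛 (j - 1) (c₀ x)) := by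
    intro j x hx
    have e1 := comp_map (φ := i) (e := 0) (fun j a ha => by simpa using i_deg j a ha) j (r₀ x)
    rw [add_zero] at e1
    rw [e1, S.d_comp, sub_add_cancel, ← hrc, map_sub, comp_same (π_deg j x hx)]
  refine ⟨r, h, i_deg, fun j a ha => ?_, fun j a ha => ?_, fun j a ha => S.d_mem ha,
    fun k a ha => ?_, fun k a ha => ?_, fun k a ha => ?_, fun k a ha => Φ.d_mem ha,
    LinearMap.ext hS.d_d, fun a => ?_, fun a => ?_, hdi, fun a => ?_, fun a => ?_⟩
  · rw [hr a _ _ (hcomp j a ha)]; exact comp_mem _ _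
  · rw [hh a _ _ (hcomp j a ha), ← sub_eq_add_neg]
    exact Submodule.sub_mem _ (comp_mem _ _) (π_deg _ _ (comp_mem _ _))
  · have := proj_mem_fil Φ.antitone (hf k _ (ι_mem_scFil ha))
    exact this
  · obtain ⟨b, hb, c, hc, e⟩ := hex k a ha
    rw [hr a b c e]; exact hb
  · obtain ⟨b, hb, c, hc, e⟩ := hex k a ha
    rw [hh a b c e]; exact Submodule.sub_mem _ hc (π_fil k c hc)
  · exact hr _ _ 0 (by rw [hπ _ (hdi a), sub_self, map_zero])
  · exact hr _ _ a (by rw [hπ _ (hS.d_d a), map_zero, sub_zero])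
  · rw [hh _ a 0 (by rw [hπ _ (hdi a), sub_self, map_zero]), map_zero, sub_zero]
  -- For the exact element `d a` the witnesses `0` and `a` give `h (d a) = a - π a`, while `d (h a)
  -- = π a - i (r a)`; the sum is the homotopy identity.
  · rw [hh (S.d a) 0 a (by rw [hπ _ (hS.d_d a), map_zero, sub_zero])]
    change S.d (c₀ a - π (c₀ a)) + _ = a - i (r₀ a)
    rw [map_sub, hdπ, sub_zero, ← hrc]
    abel

end Contraction

/-! ### Eigenvalues of the operator counting factors in the kernel of an idempotent. -/

section Eigen

variable {K : Type u} [Field K] {L : Type v} [AddCommGroup L] [Module K L]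
  {𝓛 : ℤ → Submodule K L} [DirectSum.Decomposition 𝓛]
  {H : Type w} [AddCommGroup H] [Module K H] {𝓗 : ℤ → Submodule K H} [DirectSum.Decomposition 𝓗]

/-- The partial inverse of the counting operator is a polynomial in that operator so that it
inherits, through this lemma, compatibility with weights, degrees and filtrations. -/
lemma aeval_mem {V : Type*} [AddCommGroup V] [Module K V] {N : Module.End K V} {P : Submodule K V}
    (h : ∀ x ∈ P, N x ∈ P) (p : Polynomial K) {x : V} (hx : x ∈ P) :
    Polynomial.aeval N p x ∈ P := by
  have hpow : ∀ k, (N ^ k) x ∈ P := by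
    intro k
    induction k with
    | zero => simpa using hx
    | succ k ih => rw [pow_succ', Module.End.mul_apply]; exact h _ ih
  induction p using Polynomial.induction_on' with
  | add p q hp hq => rw [map_add]; exact P.add_mem hp hq
  | monomial n a =>
    rw [Polynomial.aeval_monomial, Module.End.mul_apply, Module.algebraMap_end_apply]
    exact P.smul_mem _ (hpow n)

lemma aeval_comm {V : Type*} [AddCommGroup V] [Module K V] {N : Module.End K V}
    {T : V →ₗ[K] V} (h : ∀ x, T (N x) = N (T x)) (p : Polynomial K) (x : V) :
    Polynomial.aeval N p (T x) = T (Polynomial.aeval N p x) := by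
  have hpow : ∀ k, (N ^ k) (T x) = T ((N ^ k) x) := by
    intro k
    induction k with
    | zero => simp
    | succ k ih => rw [pow_succ', Module.End.mul_apply, Module.End.mul_apply, ih, h]
  induction p using Polynomial.induction_on' with
  | add p q hp hq => rw [map_add, LinearMap.add_apply, LinearMap.add_apply, hp, hq, map_add]
  | monomial n a =>
    simp only [Polynomial.aeval_monomial, Module.End.mul_apply, Module.algebraMap_end_apply,
      hpow, map_smul]

lemma aeval_of_apply_eq_smul {V : Type*} [AddCommGroup V] [Module K V] {N : Module.End K V}
    {c : K} {x : V} (h : N x = c • x) (p : Polynomial K) :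
    Polynomial.aeval N p x = p.eval c • x := by
  by_cases hx : x = 0
  · simp [hx]
  · exact Module.End.aeval_apply_of_hasEigenvector ⟨Module.End.mem_eigenspace_iff.2 h, hx⟩

/-- Lagrange interpolation of `v ↦ 1 / v` at the nodes `1, …, n`, which are distinct and nonzero in
characteristic `0`. -/
lemma exists_polynomial_inv [CharZero K] (n : ℕ) :
    ∃ p : Polynomial K, ∀ v : ℕ, 1 ≤ v → v ≤ n → p.eval (v : K) * v = 1 := by
  refine ⟨Lagrange.interpolate (Finset.Icc 1 n) (fun v : ℕ => (v : K)) (fun v => (v : K)⁻¹), ?_⟩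
  intro v h1 hn
  rw [Lagrange.eval_interpolate_at_node _ (Nat.cast_injective.injOn) (Finset.mem_Icc.2 ⟨h1, hn⟩)]
  exact inv_mul_cancel₀ (Nat.cast_ne_zero.2 (by omega))

/-- Products of `n` homogeneous elements of which `n - v` are fixed and `v` are killed by the linear
map `e`. -/
inductive IsEigenWord (𝓛 : ℤ → Submodule K L) (e : L →ₗ[K] L) : ℕ → ℕ → Sc 𝓛 → Prop
  | one : IsEigenWord 𝓛 e 0 0 1
  | fix {i : ℤ} {n v : ℕ} {a : L} {x : Sc 𝓛} (ha : a ∈ 𝓛 i) (hea : e a = a)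
      (hx : IsEigenWord 𝓛 e n v x) : IsEigenWord 𝓛 e (n + 1) v (ι 𝓛 a * x)
  | ker {i : ℤ} {n v : ℕ} {a : L} {x : Sc 𝓛} (ha : a ∈ 𝓛 i) (hea : e a = 0)
      (hx : IsEigenWord 𝓛 e n v x) : IsEigenWord 𝓛 e (n + 1) (v + 1) (ι 𝓛 a * x)

lemma IsEigenWord.le {e : L →ₗ[K] L} {n v : ℕ} {x : Sc 𝓛} (h : IsEigenWord 𝓛 e n v x) : v ≤ n := by
  induction h with
  | one => exact le_rfl
  | fix => omega
  | ker => omega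

lemma IsEigenWord.mem_wt {e : L →ₗ[K] L} {n v : ℕ} {x : Sc 𝓛} (h : IsEigenWord 𝓛 e n v x) :
    x ∈ wt 𝓛 n := by
  have : ∃ d, IsWord 𝓛 n d x := by
    induction h with
    | one => exact ⟨0, IsWord.one⟩
    | fix ha _ _ ih => obtain ⟨d, hd⟩ := ih; exact ⟨_, IsWord.cons ha hd⟩
    | ker ha _ _ ih => obtain ⟨d, hd⟩ := ih; exact ⟨_, IsWord.cons ha hd⟩
  obtain ⟨d, hd⟩ := this
  exact hd.mem_wt

/-- Each factor splits as `e a + (a - e a)`, a fixed element plus one in the kernel. -/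
lemma wt_le_span_eigenWords {e : L →ₗ[K] L} (he : HasDeg 𝓛 e 0) (hee : ∀ a, e (e a) = e a) (n : ℕ) :
    wt 𝓛 n ≤ Submodule.span K {x | ∃ v, IsEigenWord 𝓛 e n v x} := by
  refine Submodule.span_le.2 ?_
  rintro x ⟨d, hx⟩
  induction hx with
  | one => exact Submodule.subset_span ⟨0, IsEigenWord.one⟩
  | @cons n i d a x ha _ ih =>
    have hea : e a ∈ 𝓛 i := by simpa using he i a ha
    have h : ι 𝓛 a * x = ι 𝓛 (e a) * x + ι 𝓛 (a - e a) * x := by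
      rw [← add_mul, ← map_add, add_sub_cancel]
    rw [h]
    refine Submodule.add_mem _ ?_ ?_
    · refine (Submodule.span_le.2 ?_ : _ ≤ (Submodule.span K
        {x | ∃ v, IsEigenWord 𝓛 e (n + 1) v x}).comap (LinearMap.mulLeft K (ι 𝓛 (e a)))) ih
      rintro y ⟨v, hy⟩
      exact Submodule.subset_span ⟨v, IsEigenWord.fix hea (hee a) hy⟩
    · refine (Submodule.span_le.2 ?_ : _ ≤ (Submodule.span K
        {x | ∃ v, IsEigenWord 𝓛 e (n + 1) v x}).comap (LinearMap.mulLeft K (ι 𝓛 (a - e a)))) ih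
      rintro y ⟨v, hy⟩
      exact Submodule.subset_span ⟨v + 1, IsEigenWord.ker (Submodule.sub_mem _ ha hea)
        (by rw [map_sub, hee, sub_self]) hy⟩

/-- A derivation that annihilates fixed factors and reproduces those in the kernel counts the
latter. -/
lemma lin_eigenWord {e : L →ₗ[K] L} (he : HasDeg 𝓛 e 0) {n v : ℕ} {x : Sc 𝓛}
    (h : IsEigenWord 𝓛 e n v x) : lin (LinearMap.id - e) x = (v : K) • x := by
  have hN : HasDeg 𝓛 (LinearMap.id - e) 0 := fun i a ha => by
    rw [add_zero]
    exact Submodule.sub_mem _ ha (by simpa using he i a ha)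
  induction h with
  | one => simp
  | fix ha hea _ ih =>
    rw [lin_ι_mul hN ha, ih]
    simp [hea]
  | ker ha hea _ ih =>
    rw [lin_ι_mul hN ha, ih]
    simp [hea, add_smul, add_comm]

/-- Eigenvalue `0` means that every factor is fixed by `i r`; these products therefore come from the
image of `S(i)`. -/
lemma mapSc_mapSc_eigenWord {i : H →ₗ[K] L} {r : L →ₗ[K] H} (hi : ∀ j, ∀ a ∈ 𝓗 j, i a ∈ 𝓛 j)
    (hr : ∀ j, ∀ a ∈ 𝓛 j, r a ∈ 𝓗 j) {n : ℕ} {x : Sc 𝓛} (h : IsEigenWord 𝓛 (i ∘ₗ r) n 0 x) :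
    mapSc i hi (mapSc r hr x) = x := by
  generalize hv : 0 = v at h
  induction h with
  | one => simp
  | fix ha hea _ ih =>
    rw [map_mul, map_mul, ih hv, mapSc_ι, mapSc_ι]
    rw [LinearMap.comp_apply] at hea
    rw [hea]
  | ker => omega

end Eigen

/-! ### Obstruction theory: extending a retraction by one weight. -/

section Step

variable {K : Type u} [Field K] {L : Type v} [AddCommGroup L] [Module K L]
  {𝓛 : ℤ → Submodule K L} [DirectSum.Decomposition 𝓛]
  {H : Type w} [AddCommGroup H] [Module K H] {𝓗 : ℤ → Submodule K H} [DirectSum.Decomposition 𝓗]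

lemma eq_zero_of_wtLe_one {M : Type*} [AddCommGroup M] [Module K M] {q : Sc 𝓛 →ₗ[K] M}
    (h0 : q 1 = 0) (h1 : ∀ a, q (ι 𝓛 a) = 0) : ∀ x ∈ wtLe 𝓛 1, q x = 0 := by
  intro x hx
  refine eq_zero_of_wtLe (f := q) (fun m hm d x hx => ?_) hx
  cases hx with
  | one => exact h0
  | cons ha hx =>
    cases hx with
    | one => rw [mul_one]; exact h1 _
    | cons => omega

lemma eq_zero_of_wtLe_zero {M : Type*} [AddCommGroup M] [Module K M] {q : Sc 𝓛 →ₗ[K] M}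
    (h0 : q 1 = 0) : ∀ x ∈ wtLe 𝓛 0, q x = 0 := by
  intro x hx
  obtain ⟨c, rfl⟩ := wtLe_zero hx
  rw [map_smul, h0, smul_zero]

lemma conv_sub (p q : Sc 𝓛 →ₗ[K] L) : conv (p - q) = conv p - conv q := by
  have : TensorProduct.map (ι 𝓛 ∘ₗ (p - q)) (LinearMap.id (M := Sc 𝓛)) =
      TensorProduct.map (ι 𝓛 ∘ₗ p) LinearMap.id - TensorProduct.map (ι 𝓛 ∘ₗ q) LinearMap.id :=
    TensorProduct.ext' fun x y => by simp [TensorProduct.sub_tmul]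
  rw [conv, this, LinearMap.sub_comp, LinearMap.comp_sub, conv, conv]

lemma conv_mem_wtLe_of_succ {q : Sc 𝓛 →ₗ[K] L} (hq : ∀ x ∈ wtLe 𝓛 1, q x = 0) {n : ℕ} {x : Sc 𝓛}
    (hx : x ∈ wtLe 𝓛 (n + 1)) : conv q x ∈ wtLe 𝓛 n := by
  have h := conv_mem_wtLe hq hx
  rwa [Nat.add_sub_cancel] at h

lemma lin_mem_wtLe {φ : L →ₗ[K] L} {n : ℕ} {x : Sc 𝓛} (hx : x ∈ wtLe 𝓛 n) :
    lin φ x ∈ wtLe 𝓛 n :=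
  conv_mem_wtLe (p := 0) (eq_zero_of_wtLe_zero (by simp)) hx

lemma mapSc_wtLe {φ : L →ₗ[K] H} (hφ : ∀ i, ∀ a ∈ 𝓛 i, φ a ∈ 𝓗 i) {n : ℕ} {x : Sc 𝓛}
    (hx : x ∈ wtLe 𝓛 n) : mapSc φ hφ x ∈ wtLe 𝓗 n :=
  wtLe_induction (f := (mapSc φ hφ).toLinearMap)
    (fun _ hm _ _ hx => (mapSc_word hφ hx).mem_wtLe hm) hx

variable [CharZero K]

lemma LInftyStructure.IsFlat.Q_mem_wtLe {S : LInftyStructure 𝓛} (hS : S.IsFlat) {n : ℕ} {x : Sc 𝓛}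
    (hx : x ∈ wtLe 𝓛 n) : S.Q x ∈ wtLe 𝓛 n := by
  rw [S.Q_eq_conv]
  exact conv_mem_wtLe (p := 0) (eq_zero_of_wtLe_zero hS) hx

/-- The difference is the coderivation whose components are those of `Q` in weights at least two, so
it lowers weight by one. -/
lemma LInftyStructure.IsFlat.Q_sub_lin_mem {S : LInftyStructure 𝓛} (hS : S.IsFlat) {n : ℕ}
    {x : Sc 𝓛} (hx : x ∈ wtLe 𝓛 (n + 1)) : S.Q x - lin S.d x ∈ wtLe 𝓛 n := by
  rw [S.Q_eq_conv, lin, ← LinearMap.sub_apply, ← conv_sub]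
  have hS' : S.coeff 1 = 0 := hS
  exact conv_mem_wtLe_of_succ (eq_zero_of_wtLe_one (by simp [hS'])
    (by simp [LInftyStructure.d_apply])) hx

/-- A minimal `L_∞`-algebra: `Q_0 = 0` and `Q_1 = 0`. -/
structure LInftyStructure.IsMinimal (A : LInftyStructure 𝓗) : Prop where
  flat : A.IsFlat
  d_eq_zero : A.d = 0

lemma LInftyStructure.IsMinimal.coeff {A : LInftyStructure 𝓗} (hA : A.IsMinimal) :
    ∀ x ∈ wtLe 𝓗 1, A.coeff x = 0 :=
  eq_zero_of_wtLe_one hA.flat fun a => DFunLike.congr_fun hA.d_eq_zero a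

/-- Without `Q_0` and `Q_1` every component replaces at least two factors by one. This drop in
weight lets information in weights at most `n` be used in weight `n + 1`. -/
lemma LInftyStructure.IsMinimal.Q_mem_wtLe {A : LInftyStructure 𝓗} (hA : A.IsMinimal) {n : ℕ}
    {x : Sc 𝓗} (hx : x ∈ wtLe 𝓗 (n + 1)) : A.Q x ∈ wtLe 𝓗 n := by
  rw [A.Q_eq_conv]
  exact conv_mem_wtLe_of_succ hA.coeff hx

lemma LInftyStructure.IsMinimal.Q_of_wtLe_one {A : LInftyStructure 𝓗} (hA : A.IsMinimal)
    {x : Sc 𝓗} (hx : x ∈ wtLe 𝓗 1) : A.Q x = 0 := by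
  rw [A.Q_eq_conv]
  exact conv_eq_zero hA.coeff hx

lemma LInftyStructure.IsMinimal.Q_ι {A : LInftyStructure 𝓗} (hA : A.IsMinimal)
    (a : H) : A.Q (ι 𝓗 a) = 0 :=
  hA.Q_of_wtLe_one (wt_le_wtLe le_rfl (ι_mem_wt a))

/-- The failure of a coalgebra map to commute with the codifferentials is a twisted
coderivation. -/
lemma IsCoalgMap.comul_comm_sub {S : LInftyStructure 𝓛} {A : LInftyStructure 𝓗}
    {s : Sc 𝓛 →ₗ[K] Sc 𝓗} (hs : IsCoalgMap s) (hdeg : ∀ d, ∀ x ∈ deg 𝓛 d, s x ∈ deg 𝓗 d) :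
    LInfty.comul 𝓗 ∘ₗ (s ∘ₗ S.Q - A.Q ∘ₗ s) =
      (TensorProduct.map (s ∘ₗ S.Q - A.Q ∘ₗ s) s +
        TensorProduct.map (s ∘ₗ (koszul 𝓛 1).toLinearMap) (s ∘ₗ S.Q - A.Q ∘ₗ s)) ∘ₗ
      LInfty.comul 𝓛 := by
  have hk : s ∘ₗ (koszul 𝓛 1).toLinearMap = (koszul 𝓗 1).toLinearMap ∘ₗ s := by
    refine ext_words fun n d x hx => ?_
    simp only [LinearMap.comp_apply, AlgHom.toLinearMap_apply]
    rw [koszul_word 1 hx, koszul_deg 1 (hdeg d x hx.mem_deg), map_smul]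
  have h1 : LInfty.comul 𝓗 ∘ₗ s ∘ₗ S.Q = (TensorProduct.map (s ∘ₗ S.Q) s +
      TensorProduct.map (s ∘ₗ (koszul 𝓛 1).toLinearMap) (s ∘ₗ S.Q)) ∘ₗ LInfty.comul 𝓛 := by
    rw [← LinearMap.comp_assoc, hs.comul, LinearMap.comp_assoc, S.coderivation,
      ← LinearMap.comp_assoc, LinearMap.comp_add, ← TensorProduct.map_comp,
      ← TensorProduct.map_comp, LinearMap.comp_id]
  have h2 : LInfty.comul 𝓗 ∘ₗ A.Q ∘ₗ s = (TensorProduct.map (A.Q ∘ₗ s) s +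
      TensorProduct.map (s ∘ₗ (koszul 𝓛 1).toLinearMap) (A.Q ∘ₗ s)) ∘ₗ LInfty.comul 𝓛 := by
    rw [← LinearMap.comp_assoc, A.coderivation, LinearMap.comp_assoc, hs.comul,
      ← LinearMap.comp_assoc, LinearMap.add_comp, ← TensorProduct.map_comp,
      ← TensorProduct.map_comp, LinearMap.id_comp, hk]
  rw [LinearMap.comp_sub, h1, h2, ← LinearMap.sub_comp]
  congr 1
  refine TensorProduct.ext' fun x y => ?_
  simp only [LinearMap.sub_apply, LinearMap.add_apply, TensorProduct.map_tmul,
    TensorProduct.sub_tmul, TensorProduct.tmul_sub]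
  abel

/-- A filtered coalgebra map of degree `0` which in weights at most `n` commutes with the
codifferentials and is a left inverse of `f`. -/
structure IsPartialRetraction {A : LInftyStructure 𝓗} {S : LInftyStructure 𝓛} (f : LInftyHom A S)
    (F : ℕ → Submodule K L) (G : ℕ → Submodule K H) (r : L →ₗ[K] H) (n : ℕ)
    (s : Sc 𝓛 →ₗ[K] Sc 𝓗) : Prop where
  coalg : IsCoalgMap s
  deg : ∀ d, ∀ x ∈ deg 𝓛 d, s x ∈ deg 𝓗 d
  fil : ∀ k, ∀ x ∈ scFil 𝓛 F k, s x ∈ scFil 𝓗 G k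
  lin : ∀ a, s (ι 𝓛 a) = ι 𝓗 (r a)
  retr : ∀ y ∈ wtLe 𝓗 n, s (f.toCoalgHom y) = y
  comm : ∀ x ∈ wtLe 𝓛 n, s (S.Q x) = A.Q (s x)

variable {A : LInftyStructure 𝓗} {S : LInftyStructure 𝓛} {f : LInftyHom A S}
  {ΦA : CompleteFiltration A} {Φ : CompleteFiltration S} {r : L →ₗ[K] H} {h : L →ₗ[K] L}

/-- The start of the induction: in weight one the conditions are `r d = 0`, which is commutation
since the target has no differential, and `r i = id`. -/
lemma IsContraction.isPartialRetraction (hA : A.IsMinimal) (hS : S.IsFlat)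
    (C : IsContraction 𝓛 𝓗 Φ.F ΦA.F S.d f.linearPart r h) :
    IsPartialRetraction f Φ.F ΦA.F r 1 (mapSc r C.r_deg).toLinearMap := by
  have hQ : ∀ x ∈ wtLe 𝓛 1, ((mapSc r C.r_deg).toLinearMap ∘ₗ S.Q -
      A.Q ∘ₗ (mapSc r C.r_deg).toLinearMap) x = 0 := by
    refine eq_zero_of_wtLe_one ?_ fun a => ?_
    · have h1 : S.Q 1 = 0 := by
        have hS' : S.coeff 1 = 0 := hS
        rw [S.Q_eq_conv, conv_one, hS', map_zero]
      simp [h1, hA.Q_of_wtLe_one (one_mem_wtLe 1)]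
    · have h1 : mapSc r C.r_deg (S.Q (ι 𝓛 a)) = 0 := by
        refine homog_induction (𝓛 := 𝓛) (p := fun a => mapSc r C.r_deg (S.Q (ι 𝓛 a)) = 0)
          (by simp) ?_ ?_ a
        · intro a b ha hb; simp only [map_add, ha, hb, add_zero]
        · intro i a ha; rw [hS.Q_ι ha, mapSc_ι, C.r_d, map_zero]
      simp [h1, hA.Q_ι]
  refine ⟨isCoalgMap_mapSc _, fun d x hx => mapSc_deg _ hx,
    fun k x hx => mapSc_mem_scFil _ C.r_fil hx, fun a => by simp, fun y hy => ?_, fun x hx => ?_⟩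
  · have := eq_zero_of_wtLe_one (q := (mapSc r C.r_deg).toLinearMap ∘ₗ
      f.toCoalgHom.toLinearMap - LinearMap.id)
      (by
        have := f.isCoalgMap.one
        simp only [LinearMap.sub_apply, LinearMap.comp_apply, this]
        simp)
      (fun a => by
        have := f.apply_ι a
        simp only [LinearMap.sub_apply, LinearMap.comp_apply]
        rw [show f.toCoalgHom.toLinearMap (ι 𝓗 a) = _ from this]
        simp [C.r_i]) y hy
    exact sub_eq_zero.1 this
  · exact sub_eq_zero.1 (hQ x hx)

/-- Modification of a coalgebra map in weight `n + 1`. -/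
lemma IsPartialRetraction.exists_modification {n : ℕ} (hn : 1 ≤ n) {s : Sc 𝓛 →ₗ[K] Sc 𝓗}
    (C : IsContraction 𝓛 𝓗 Φ.F ΦA.F S.d f.linearPart r h)
    (hs : IsPartialRetraction f Φ.F ΦA.F r n s) {δ : Sc 𝓛 →ₗ[K] H}
    (hδ0 : ∀ x ∈ wtLe 𝓛 n, δ x = 0) (hδd : ∀ d, ∀ x ∈ LInfty.deg 𝓛 d, δ x ∈ 𝓗 (d + 1))
    (hδF : ∀ k, ∀ x ∈ scFil 𝓛 Φ.F k, δ x ∈ ΦA.F k) :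
    ∃ s' : Sc 𝓛 →ₗ[K] Sc 𝓗, IsCoalgMap s' ∧ (∀ d, ∀ x ∈ LInfty.deg 𝓛 d, s' x ∈ LInfty.deg 𝓗 d) ∧
      (∀ k, ∀ x ∈ scFil 𝓛 Φ.F k, s' x ∈ scFil 𝓗 ΦA.F k) ∧ (∀ x ∈ wtLe 𝓛 n, s' x = s x) ∧
      ∀ x ∈ wt 𝓛 (n + 1), s' x = s x + ι 𝓗 (δ x) := by
  -- Precomposing with the exponential of a coderivation keeps the coalgebra property. The values of
  -- `δ` are lifted along `i` because `s` acts on cogenerators by `r`, and `r i = id` returns `δ`.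
  set q := f.linearPart ∘ₗ δ with hq
  have hq0 : ∀ x ∈ wtLe 𝓛 n, q x = 0 := fun x hx => by simp [hq, hδ0 x hx]
  have hqd : Homog q 0 := fun d x hx => by
    rw [add_zero]; exact C.i_deg _ _ (hδd d x hx)
  have hqF : ∀ k, ∀ x ∈ scFil 𝓛 Φ.F k, q x ∈ Φ.F k := fun k x hx => C.i_fil k _ (hδF k x hx)
  have hD := conv_locallyNilpotent fun x hx => hq0 x (wtLe_mono hn hx)
  refine ⟨s ∘ₗ lexp (conv q) hD,
    hs.coalg.comp (isCoalgMap_lexp hqd hD (hq0 1 (one_mem_wtLe n))), fun d x hx => ?_,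
    fun k x hx => ?_, fun x hx => ?_, fun x hx => ?_⟩
  · refine hs.deg d _ (lexp_mem hD (fun y hy => ?_) hx)
    simpa using conv_deg hqd hy
  · exact hs.fil k _ (lexp_mem hD (fun y hy => conv_mem_scFil Φ.homogeneous hqd hqF hy) hx)
  · rw [LinearMap.comp_apply, lexp_of_apply_eq_zero hD (conv_eq_zero hq0 hx)]
  · have h1 := conv_eq_ι hq0 hx
    -- Here `n ≥ 1` matters: the first application already lands in weight one, where the
    -- coderivation vanishes, so only the linear term of the exponential remains.
    have h2 : conv q (conv q x) = 0 := by
      rw [h1]; exact conv_eq_zero hq0 (wt_le_wtLe hn (ι_mem_wt _))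
    rw [LinearMap.comp_apply, lexp_of_sq_eq_zero hD h2, h1, map_add, hs.lin]
    simp [hq, C.r_i]

/-- The obstruction to extending a partial retraction vanishes. -/
lemma IsPartialRetraction.exists_obstruction_primitive (hA : A.IsMinimal) (hS : S.IsFlat) {n : ℕ}
    {s : Sc 𝓛 →ₗ[K] Sc 𝓗} (C : IsContraction 𝓛 𝓗 Φ.F ΦA.F S.d f.linearPart r h)
    (hf : f.IsFiltered ΦA Φ) (hs : IsPartialRetraction f Φ.F ΦA.F r n s) :
    ∃ δ : Sc 𝓛 →ₗ[K] H, (∀ x ∈ wtLe 𝓛 n, δ x = 0) ∧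
      (∀ d, ∀ x ∈ LInfty.deg 𝓛 d, δ x ∈ 𝓗 (d + 1)) ∧
      (∀ k, ∀ x ∈ scFil 𝓛 Φ.F k, δ x ∈ ΦA.F k) ∧
      (∀ x ∈ wt 𝓛 (n + 1), ι 𝓗 (δ (LInfty.lin S.d x)) = A.Q (s x) - s (S.Q x)) ∧
      (∀ y ∈ wt 𝓗 (n + 1), δ (mapSc f.linearPart C.i_deg y) = proj 𝓗 (y - s (f.toCoalgHom y))) := by
  set T := s ∘ₗ S.Q - A.Q ∘ₗ s with hT
  set O := proj 𝓗 ∘ₗ T with hO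
  set E := proj 𝓗 ∘ₗ (s ∘ₗ f.toCoalgHom.toLinearMap - LinearMap.id) with hE
  set N : Module.End K (Sc 𝓛) := LInfty.lin (LinearMap.id - f.linearPart ∘ₗ r) with hN
  have he : HasDeg 𝓛 (f.linearPart ∘ₗ r) 0 := fun j a ha => by
    rw [add_zero]; exact C.i_deg j _ (C.r_deg j a ha)
  have hNdeg : HasDeg 𝓛 (LinearMap.id - f.linearPart ∘ₗ r) 0 := fun j a ha =>
    Submodule.sub_mem _ (by simpa using ha) (he j a ha)
  -- In weight `n + 1` the eigenvalues of `N` are among `0, …, n + 1`, so these nodes suffice.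
  obtain ⟨p, hp⟩ := exists_polynomial_inv (K := K) (n + 1)
  set M := Polynomial.aeval N p with hM
  -- the obstruction in weights at most `n + 1`
  have hT0 : ∀ x ∈ wtLe 𝓛 n, T x = 0 := fun x hx => by simp [hT, hs.comm x hx]
  have hTι : ∀ x ∈ wt 𝓛 (n + 1), T x = ι 𝓗 (O x) := fun x hx =>
    eq_ι_proj_of_twisted (g₁ := s) (g₂ := s ∘ₗ (koszul 𝓛 1).toLinearMap) hs.coalg.one
      (by simp [hs.coalg.one]) (hs.coalg.comul_comm_sub hs.deg) hT0 hx
  -- `T (Q x) = -Q (s (Q x)) = -Q (T x)`, which is zero because `T x` is a cogenerator and the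
  -- target is minimal. Up to lower weights, where `T` vanishes, `Q x` is the linear coderivation of
  -- `d` applied to `x`.
  have hOd : ∀ x ∈ wt 𝓛 (n + 1), O (LInfty.lin S.d x) = 0 := by
    intro x hx
    have h1 := hT0 _ (hS.Q_sub_lin_mem (wt_le_wtLe le_rfl hx))
    have h2 : T (S.Q x) = 0 := by
      have e1 : S.Q (S.Q x) = 0 := DFunLike.congr_fun S.sq_zero x
      have e2 : A.Q (A.Q (s x)) = 0 := DFunLike.congr_fun A.sq_zero (s x)
      have e3 : A.Q (T x) = 0 := by rw [hTι x hx, hA.Q_ι]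
      simp only [hT, LinearMap.sub_apply, LinearMap.comp_apply, map_sub, e1, e2, map_zero,
        sub_zero] at e3 ⊢
      rw [e3, sub_zero]
    rw [map_sub, h2, zero_sub, neg_eq_zero] at h1
    rw [hO, LinearMap.comp_apply, h1, map_zero]
  -- Up to lower weights `S(i) y` is `f y`. There `s Q f y = s f Q y = Q y`, as `Q` lowers weight on
  -- the minimal side, and `Q s f y = Q y`, as `s f y - y` is a cogenerator; so `T (f y) = 0`.
  have hOi : ∀ y ∈ wt 𝓗 (n + 1), O (mapSc f.linearPart C.i_deg y) = 0 := by
    intro y hy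
    have h1 := hT0 _ (f.isCoalgMap.sub_mapSc_mem C.i_deg f.apply_ι n hy)
    have hid : ∀ y ∈ wtLe 𝓗 n, (s ∘ₗ f.toCoalgHom.toLinearMap) y = (LinearMap.id : Sc 𝓗 →ₗ[K] Sc 𝓗) y := hs.retr
    have h2 := (hs.coalg.comp f.isCoalgMap).sub_eq_ι IsCoalgMap.id hid hy
    have h3 : T (f.toCoalgHom.toLinearMap y) = 0 := by
      have e1 : f.toCoalgHom.toLinearMap (A.Q y) = S.Q (f.toCoalgHom.toLinearMap y) := f.comm y
      have e2 := hid _ (hA.Q_mem_wtLe (wt_le_wtLe le_rfl hy))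
      have e3 := congrArg A.Q h2
      rw [hA.Q_ι, map_sub, sub_eq_zero] at e3
      simp only [LinearMap.comp_apply, LinearMap.id_apply] at e2 e3
      simp only [hT, LinearMap.sub_apply, LinearMap.comp_apply]
      rw [← e1, e2, e3, sub_self]
    rw [map_sub, h3, zero_sub, neg_eq_zero] at h1
    rw [hO, LinearMap.comp_apply, h1, map_zero]
  -- the homotopy
  have hhom : ∀ x, LInfty.lin S.d (LInfty.lin h x) + LInfty.lin h (LInfty.lin S.d x) = N x := by
    intro x
    rw [lin_anticomm C.d_deg C.h_deg odd_one (by decide), hN]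
    congr 2
    exact LinearMap.ext C.homotopy
  have hdd := lin_lin_eq_zero C.d_deg odd_one C.d_d
  have hNd : ∀ x, LInfty.lin S.d (N x) = N (LInfty.lin S.d x) := by
    intro x
    rw [← hhom, ← hhom, map_add, hdd, hdd, map_zero, zero_add, add_zero]
  have hMwt : ∀ x ∈ wt 𝓛 (n + 1), M x ∈ wt 𝓛 (n + 1) := fun x hx =>
    aeval_mem (fun y hy => lin_mem_wt hNdeg hy) p hx
  -- On eigenvectors with `v > 0` the operator `M N` is the identity; for `v = 0` both sides vanish
  -- because `O` kills the image of `S(i)`.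
  have hOMN : ∀ x ∈ wt 𝓛 (n + 1), O (M (N x)) = O x := by
    intro x hx
    have hx' := wt_le_span_eigenWords he (fun a => by simp [C.r_i]) (n + 1) hx
    have : Submodule.span K {x | ∃ v, IsEigenWord 𝓛 (f.linearPart ∘ₗ r) (n + 1) v x} ≤
        LinearMap.ker (O ∘ₗ M ∘ₗ N - O) := by
      refine Submodule.span_le.2 ?_
      rintro y ⟨v, hy⟩
      have hNy : N y = (v : K) • y := lin_eigenWord he hy
      change O (M (N y)) - O y = 0
      rw [hNy, map_smul, hM, aeval_of_apply_eq_smul hNy, smul_smul, map_smul]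
      rcases Nat.eq_zero_or_pos v with rfl | hv
      · rw [← mapSc_mapSc_eigenWord C.i_deg C.r_deg hy,
          hOi _ (mapSc_wt C.r_deg hy.mem_wt), smul_zero, sub_zero]
      · rw [mul_comm, hp v hv hy.le, one_smul, sub_self]
    exact sub_eq_zero.1 (this hx')
  -- Expand `N` as the anticommutator. Since `M` commutes with `d` and `O` kills the image of `d`,
  -- the term `d h` drops out.
  have hOh : ∀ x ∈ wt 𝓛 (n + 1), O (M (LInfty.lin h (LInfty.lin S.d x))) = O x := by
    intro x hx
    rw [← hOMN x hx, ← hhom, map_add, map_add, hM, aeval_comm hNd, ← hM,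
      hOd _ (hMwt _ (lin_mem_wt C.h_deg hx)), zero_add]
  -- degrees and filtrations
  have hOdeg : ∀ d, ∀ x ∈ LInfty.deg 𝓛 d, O x ∈ 𝓗 (d + 1 + 1) := fun d x hx =>
    proj_mem (Submodule.sub_mem _ (hs.deg _ _ (S.degree_one d x hx))
      (A.degree_one _ _ (hs.deg d x hx)))
  have hOfil : ∀ k, ∀ x ∈ scFil 𝓛 Φ.F k, O x ∈ ΦA.F k := fun k x hx =>
    proj_mem_fil ΦA.antitone (Submodule.sub_mem _ (hs.fil k _ (Φ.respects k x hx))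
      (ΦA.respects k _ (hs.fil k x hx)))
  have hEdeg : ∀ d, ∀ y ∈ LInfty.deg 𝓗 d, E y ∈ 𝓗 (d + 1) := fun d y hy =>
    proj_mem (Submodule.sub_mem _ (hs.deg _ _ (f.degree_zero d y hy)) hy)
  have hEfil : ∀ k, ∀ y ∈ scFil 𝓗 ΦA.F k, E y ∈ ΦA.F k := fun k y hy =>
    proj_mem_fil ΦA.antitone (Submodule.sub_mem _ (hs.fil k _ (hf k y hy)) hy)
  have hMdeg : ∀ d, ∀ x ∈ LInfty.deg 𝓛 d, M x ∈ LInfty.deg 𝓛 d := fun d x hx =>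
    aeval_mem (fun y hy => by
      have := conv_deg hNdeg.homog hy
      rwa [add_zero] at this) p hx
  have hNfil : ∀ k, ∀ a ∈ Φ.F k, ((LinearMap.id : L →ₗ[K] L) - f.linearPart ∘ₗ r) a ∈ Φ.F k := fun k a ha =>
    Submodule.sub_mem _ ha (C.i_fil k _ (C.r_fil k a ha))
  have hMfil : ∀ k, ∀ x ∈ scFil 𝓛 Φ.F k, M x ∈ scFil 𝓛 Φ.F k := fun k x hx =>
    aeval_mem (fun y hy => lin_mem_scFil Φ.homogeneous Φ.antitone hNdeg hNfil hy) p hx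
  -- The first summand repairs the retraction and vanishes on the image of `d` since `r d = 0`. The
  -- second repairs commutation and vanishes on the image of `S(i)` since `h i = 0`.
  refine ⟨-(E ∘ₗ (mapSc r C.r_deg).toLinearMap) - O ∘ₗ M ∘ₗ LInfty.lin h, fun x hx => ?_,
    fun d x hx => ?_, fun k x hx => ?_, fun x hx => ?_, fun y hy => ?_⟩
  · have h1 : E (mapSc r C.r_deg x) = 0 := by
      have : s (f.toCoalgHom.toLinearMap (mapSc r C.r_deg x)) = mapSc r C.r_deg x :=
        hs.retr _ (mapSc_wtLe C.r_deg hx)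
      simp only [hE, LinearMap.comp_apply, LinearMap.sub_apply, LinearMap.id_apply]
      rw [this, sub_self, map_zero]
    have h2 : O (M (LInfty.lin h x)) = 0 := by
      have : M (LInfty.lin h x) ∈ wtLe 𝓛 n :=
        aeval_mem (fun y hy => lin_mem_wtLe hy) p (lin_mem_wtLe hx)
      rw [hO, LinearMap.comp_apply, hT0 _ this, map_zero]
    simp [h1, h2]
  · refine Submodule.sub_mem _ (Submodule.neg_mem _ (hEdeg d _ (mapSc_deg C.r_deg hx))) ?_
    have := hOdeg _ _ (hMdeg _ _ (conv_deg C.h_deg.homog hx))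
    rwa [neg_add_cancel_right] at this
  · exact Submodule.sub_mem _
      (Submodule.neg_mem _ (hEfil k _ (mapSc_mem_scFil C.r_deg C.r_fil hx)))
      (hOfil k _ (hMfil k _ (lin_mem_scFil Φ.homogeneous Φ.antitone C.h_deg C.h_fil hx)))
  · have h1 := mapSc_lin C.d_deg C.r_deg C.r_d x
    have h2 := hTι x hx
    simp only [LinearMap.sub_apply, LinearMap.neg_apply, LinearMap.comp_apply,
      AlgHom.toLinearMap_apply]
    rw [h1, map_zero, neg_zero, zero_sub, hOh x hx, map_neg, ← h2]
    simp [hT]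
  · have h1 := lin_mapSc C.h_deg C.i_deg C.h_i y
    have h2 : mapSc r C.r_deg (mapSc f.linearPart C.i_deg y) = y := by
      have : (mapSc r C.r_deg).comp (mapSc f.linearPart C.i_deg) = AlgHom.id K (Sc 𝓗) :=
        algHom_ext_ι fun j a ha => by simp [C.r_i]
      exact DFunLike.congr_fun this y
    simp only [LinearMap.sub_apply, LinearMap.neg_apply, LinearMap.comp_apply,
      AlgHom.toLinearMap_apply]
    rw [h1, h2, map_zero, map_zero, sub_zero, hE, LinearMap.comp_apply, ← map_neg]
    congr 1
    exact neg_sub _ _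

/-- A partial retraction can be extended to the next weight. -/
lemma IsPartialRetraction.exists_succ (hA : A.IsMinimal) (hS : S.IsFlat) {n : ℕ} (hn : 1 ≤ n)
    {s : Sc 𝓛 →ₗ[K] Sc 𝓗} (C : IsContraction 𝓛 𝓗 Φ.F ΦA.F S.d f.linearPart r h)
    (hf : f.IsFiltered ΦA Φ) (hs : IsPartialRetraction f Φ.F ΦA.F r n s) :
    ∃ s', IsPartialRetraction f Φ.F ΦA.F r (n + 1) s' ∧ ∀ x ∈ wtLe 𝓛 n, s' x = s x := by
  obtain ⟨δ, hδ0, hδd, hδF, hδQ, hδi⟩ := hs.exists_obstruction_primitive hA hS C hf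
  obtain ⟨s', hc, hd, hF, hlow, htop⟩ := hs.exists_modification hn C hδ0 hδd hδF
  -- `s'` and `s` agree in lower weights, so the correction at `y` depends only on the leading term
  -- `x` of `y`.
  have hmod : ∀ x ∈ wt 𝓛 (n + 1), ∀ y, y - x ∈ wtLe 𝓛 n → s' y = s y + ι 𝓗 (δ x) := by
    intro x hx y hy
    have h1 := hlow _ hy
    rw [map_sub, map_sub, htop x hx, sub_eq_sub_iff_add_eq_add] at h1
    rw [add_comm (s x), ← add_assoc] at h1
    exact add_right_cancel h1
  refine ⟨s', ⟨hc, hd, hF, fun a => ?_, fun y hy => ?_, fun x hx => ?_⟩, hlow⟩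
  · rw [hlow _ (wt_le_wtLe hn (ι_mem_wt a)), hs.lin]
  · have hlow' : ∀ y ∈ wtLe 𝓗 n, (s' ∘ₗ f.toCoalgHom.toLinearMap) y =
        (LinearMap.id : Sc 𝓗 →ₗ[K] Sc 𝓗) y := by
      intro y hy
      have : f.toCoalgHom.toLinearMap y ∈ wtLe 𝓛 n :=
        f.isCoalgMap.mem_wtLe C.i_deg f.apply_ι hy
      rw [LinearMap.comp_apply, hlow _ this]
      exact hs.retr y hy
    have := eq_zero_of_wtLe_succ (f := s' ∘ₗ f.toCoalgHom.toLinearMap - LinearMap.id)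
      (fun y hy => by rw [LinearMap.sub_apply, hlow' y hy, sub_self]) (fun y hy => ?_) hy
    · exact sub_eq_zero.1 this
    · have h1 := (hc.comp f.isCoalgMap).sub_eq_ι IsCoalgMap.id hlow' hy
      have h2 := hmod _ (mapSc_wt C.i_deg hy) (f.toCoalgHom.toLinearMap y)
        (f.isCoalgMap.sub_mapSc_mem C.i_deg f.apply_ι n hy)
      have h3 : proj 𝓗 ((s' ∘ₗ f.toCoalgHom.toLinearMap) y - (LinearMap.id : Sc 𝓗 →ₗ[K] Sc 𝓗) y) = 0 := by
        rw [LinearMap.comp_apply, h2, hδi y hy, map_sub, map_add, proj_ι, map_sub,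
          LinearMap.id_apply]
        have : f.toCoalgHom.toLinearMap y = f.toCoalgHom y := rfl
        rw [this]; abel
      rw [LinearMap.sub_apply, h1, h3, map_zero]
  · have := eq_zero_of_wtLe_succ (f := s' ∘ₗ S.Q - A.Q ∘ₗ s') (fun x hx => ?_) (fun x hx => ?_) hx
    · exact sub_eq_zero.1 this
    · simp only [LinearMap.sub_apply, LinearMap.comp_apply]
      rw [hlow x hx, hlow _ (hS.Q_mem_wtLe hx), hs.comm x hx, sub_self]
    -- Only the value of `s'` at `Q x` contributes a correction: the one at `x` is a cogenerator,
    -- which the minimal codifferential kills.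
    · have h2 := hmod _ (lin_mem_wt C.d_deg hx) (S.Q x) (hS.Q_sub_lin_mem (wt_le_wtLe le_rfl hx))
      simp only [LinearMap.sub_apply, LinearMap.comp_apply]
      rw [h2, hδQ x hx, htop x hx, map_add, hA.Q_ι]
      abel

/-! ### Passage to the limit and the strict left inverse. -/

/-- Linear maps which stabilize in every weight have a limit. -/
lemma exists_limit {M : Type*} [AddCommGroup M] [Module K M] (σ : ℕ → Sc 𝓛 →ₗ[K] M)
    (hσ : ∀ n, ∀ x ∈ wtLe 𝓛 n, σ (n + 1) x = σ n x) :
    ∃ s : Sc 𝓛 →ₗ[K] M, ∀ n, ∀ x ∈ wtLe 𝓛 n, s x = σ n x := by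
  have hσ' : ∀ n k, ∀ x ∈ wtLe 𝓛 n, σ (n + k) x = σ n x := by
    intro n k x hx
    induction k with
    | zero => rfl
    | succ k ih => rw [← ih]; exact hσ (n + k) x (wtLe_mono (by omega) hx)
  choose N hN using exists_mem_wtLe (𝓛 := 𝓛)
  have key : ∀ n, ∀ x ∈ wtLe 𝓛 n, σ (N x) x = σ n x := by
    intro n x hx
    rw [← hσ' n (N x) x hx, ← hσ' (N x) n x (hN x), add_comm]
  refine ⟨{ toFun := fun x => σ (N x) x, map_add' := fun x y => ?_, map_smul' := fun c x => ?_ },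
    key⟩
  · have hx := wtLe_mono (le_max_left (N x) (N y)) (hN x)
    have hy := wtLe_mono (le_max_right (N x) (N y)) (hN y)
    rw [key _ _ (Submodule.add_mem _ hx hy), key _ _ hx, key _ _ hy, map_add]
  · rw [key _ _ (Submodule.smul_mem _ c (hN x)), map_smul]; rfl

/-- A filtered quasi-isomorphism from a minimal `L_∞`-algebra has a filtered left inverse. -/
theorem LInftyHom.exists_retraction (hA : A.IsMinimal) (hS : S.IsFlat) (f : LInftyHom A S)
    (hf : f.IsFilteredQuasiIso ΦA Φ) :
    ∃ g : LInftyHom S A, g.IsFiltered Φ ΦA ∧ ∀ y, g.toCoalgHom (f.toCoalgHom y) = y := by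
  obtain ⟨r, h, C⟩ := f.exists_isContraction hA.flat hA.d_eq_zero hS hf
  -- `next` is total, so the sequence can be defined by recursion before its terms are known to be
  -- partial retractions.
  choose! next hnext using fun n (hn : 1 ≤ n) s (hs : IsPartialRetraction f Φ.F ΦA.F r n s) =>
    hs.exists_succ hA hS hn C hf.1
  -- The index is shifted by one: `S(r)` is already correct in weights at most `1`, so `σ n` is
  -- correct in weights at most `n + 1`.
  let σ : ℕ → Sc 𝓛 →ₗ[K] Sc 𝓗 := fun n =>
    Nat.rec (mapSc r C.r_deg).toLinearMap (fun n s => next (n + 1) s) n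
  have hσ : ∀ n, IsPartialRetraction f Φ.F ΦA.F r (n + 1) (σ n) := by
    intro n
    induction n with
    | zero => exact C.isPartialRetraction hA hS
    | succ n ih => exact (hnext (n + 1) (by omega) _ ih).1
  obtain ⟨s, hs⟩ := exists_limit σ fun n x hx =>
    (hnext (n + 1) (by omega) _ (hσ n)).2 x (wtLe_mono (Nat.le_succ n) hx)
  -- A tensor is a finite sum, so the tensor squares stabilize on it as well. This carries the
  -- coproduct identity over to the limit.
  have hten : ∀ t : Sc 𝓛 ⊗[K] Sc 𝓛, ∃ n, ∀ k ≥ n,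
      TensorProduct.map (σ k) (σ k) t = TensorProduct.map s s t := by
    intro t
    induction t using TensorProduct.induction_on with
    | zero => exact ⟨0, fun k _ => by simp⟩
    | add x y hx hy =>
      obtain ⟨m, hm⟩ := hx
      obtain ⟨n, hn⟩ := hy
      exact ⟨max m n, fun k hk => by rw [map_add, map_add, hm k (by omega), hn k (by omega)]⟩
    | tmul u v =>
      obtain ⟨m, hm⟩ := exists_mem_wtLe u
      obtain ⟨n, hn⟩ := exists_mem_wtLe v
      refine ⟨max m n, fun k hk => ?_⟩
      rw [TensorProduct.map_tmul, TensorProduct.map_tmul, hs k u (wtLe_mono (by omega) hm),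
        hs k v (wtLe_mono (by omega) hn)]
  let g : Sc 𝓛 →ₗc[K] Sc 𝓗 :=
    { s with
      counit_comp := LinearMap.ext fun x => by
        obtain ⟨n, hn⟩ := exists_mem_wtLe x
        have := (hσ n).coalg.counit x
        rw [← hs n x hn] at this
        exact this
      map_comp_comul := LinearMap.ext fun x => by
        obtain ⟨m, hm⟩ := exists_mem_wtLe x
        obtain ⟨n, hn⟩ := hten (comul 𝓛 x)
        have h1 := DFunLike.congr_fun (hσ (max m n)).coalg.comul x
        rw [LinearMap.comp_apply, LinearMap.comp_apply, hn _ (le_max_right _ _),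
          ← hs _ x (wtLe_mono (le_max_left _ _) hm)] at h1
        exact h1.symm }
  have hg : ∀ n, ∀ x ∈ wtLe 𝓛 n, g x = σ n x := hs
  refine ⟨⟨g, fun d x hx => ?_, fun x => ?_⟩, fun k x hx => ?_, fun y => ?_⟩
  · obtain ⟨n, hn⟩ := exists_mem_wtLe x
    rw [hg n x hn]
    exact (hσ n).deg d x hx
  · obtain ⟨n, hn⟩ := exists_mem_wtLe x
    rw [hg n x hn, hg n _ (hS.Q_mem_wtLe hn)]
    exact (hσ n).comm x (wtLe_mono (Nat.le_succ n) hn)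
  · obtain ⟨n, hn⟩ := exists_mem_wtLe x
    change g x ∈ _
    rw [hg n x hn]
    exact (hσ n).fil k x hx
  · obtain ⟨n, hn⟩ := exists_mem_wtLe y
    change g (f.toCoalgHom y) = y
    rw [hg n (f.toCoalgHom y) (f.isCoalgMap.mem_wtLe C.i_deg f.apply_ι hn)]
    exact (hσ n).retr y (wtLe_mono (Nat.le_succ n) hn)

end Step

/-! ### Trivial filtrations, which reduce the unfiltered statement to the filtered one. -/

section TrivialFiltration

variable {K : Type u} [Field K] {L : Type v} [AddCommGroup L] [Module K L]
  {𝓛 : ℤ → Submodule K L} [DirectSum.Decomposition 𝓛]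
  {M : Type w} [AddCommGroup M] [Module K M] {𝓜 : ℤ → Submodule K M} [DirectSum.Decomposition 𝓜]

/-- The filtration with `F 0` the whole space and all other steps zero. -/
def trivialFil (K : Type u) [Field K] (L : Type v) [AddCommGroup L] [Module K L] (k : ℕ) :
    Submodule K L :=
  if k = 0 then ⊤ else ⊥

lemma trivialFil_pos {k : ℕ} (hk : k ≠ 0) : trivialFil K L k = ⊥ := if_neg hk

lemma scFil_zero {F : ℕ → Submodule K L} (hF : F 0 = ⊤) : scFil 𝓛 F 0 = ⊤ := by
  rw [eq_top_iff, ← span_words]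
  refine Submodule.span_le.2 ?_
  rintro x ⟨n, d, hx⟩
  induction hx with
  | one => exact IsFilWord.one.mem_scFil le_rfl
  | @cons n i d a x _ _ ih =>
    have ha : a ∈ F 0 := by rw [hF]; trivial
    have := ι_mul_mem_scFil (𝓛 := 𝓛) ha ih
    rwa [add_zero] at this

/-- A product of positive filtration index has a factor of positive index, and that factor is zero.
-/
lemma scFil_trivialFil {k : ℕ} (hk : k ≠ 0) : scFil 𝓛 (trivialFil K L) k = ⊥ := by
  have key : ∀ m x, IsFilWord 𝓛 (trivialFil K L) m x → m ≠ 0 → x = 0 := by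
    intro m x hx
    induction hx with
    | one => exact fun h => absurd rfl h
    | @cons j k a x ha _ ih =>
      intro hjk
      by_cases hj : j = 0
      · rw [ih (by omega), mul_zero]
      · rw [trivialFil_pos hj, Submodule.mem_bot] at ha
        rw [ha, map_zero, zero_mul]
  rw [eq_bot_iff]
  refine Submodule.span_le.2 ?_
  rintro x ⟨m, hm, hx⟩
  exact key m x hx (by omega)

/-- The trivial filtration is complete. -/
def CompleteFiltration.trivial (S : LInftyStructure 𝓛) : CompleteFiltration S where
  F := trivialFil K L
  zero := rfl
  antitone m n hmn := by
    by_cases hm : m = 0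
    · subst hm; exact le_top
    · rw [trivialFil_pos hm, trivialFil_pos (by omega)]
  homogeneous k i a ha := by
    by_cases hk : k = 0
    · subst hk; trivial
    · rw [trivialFil_pos hk, Submodule.mem_bot] at ha ⊢
      rw [ha, map_zero]
  separated := eq_bot_iff.2 ((iInf_le _ 1).trans (trivialFil_pos one_ne_zero).le)
  complete i u hu hcauchy := by
    have h : ∀ n, u (n + 1) = u 1 := by
      intro n
      induction n with
      | zero => rfl
      | succ n ih =>
        have := hcauchy (n + 1)
        rw [trivialFil_pos (by omega), Submodule.mem_bot, sub_eq_zero] at this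
        rw [this, ih]
    refine ⟨u 1, hu 1, fun n => ?_⟩
    cases n with
    | zero => trivial
    | succ n => rw [h n, sub_self]; exact Submodule.zero_mem _
  respects k x hx := by
    by_cases hk : k = 0
    · subst hk; rw [scFil_zero rfl]; trivial
    · rw [scFil_trivialFil hk, Submodule.mem_bot] at hx ⊢
      rw [hx, map_zero]

lemma LInftyHom.isFiltered_trivial {S : LInftyStructure 𝓛} {T : LInftyStructure 𝓜}
    (f : LInftyHom S T) :
    f.IsFiltered (CompleteFiltration.trivial S) (CompleteFiltration.trivial T) := by
  intro k x hx
  change x ∈ scFil 𝓛 (trivialFil K L) k at hx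
  change _ ∈ scFil 𝓜 (trivialFil K M) k
  by_cases hk : k = 0
  · subst hk; rw [scFil_zero rfl]; trivial
  · rw [scFil_trivialFil hk, Submodule.mem_bot] at hx
    rw [hx, map_zero]; exact Submodule.zero_mem _

lemma LInftyHom.IsQuasiIso.isFilteredQuasiIso_trivial {S : LInftyStructure 𝓛}
    {T : LInftyStructure 𝓜} {f : LInftyHom S T} (hf : f.IsQuasiIso) :
    f.IsFilteredQuasiIso (CompleteFiltration.trivial S) (CompleteFiltration.trivial T) := by
  refine ⟨f.isFiltered_trivial, fun k => ?_⟩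
  change f.IsQuasiIsoOn (trivialFil K L k) (trivialFil K M k)
  by_cases hk : k = 0
  · subst hk; exact hf
  · rw [trivialFil_pos hk, trivialFil_pos hk]
    refine ⟨fun b hb _ => ⟨0, Submodule.zero_mem _, map_zero _, 0, Submodule.zero_mem _, ?_⟩,
      fun a ha _ _ => ⟨0, Submodule.zero_mem _, ?_⟩⟩
    · rw [Submodule.mem_bot] at hb
      simp [hb]
    · rw [Submodule.mem_bot] at ha
      simp [ha]

end TrivialFiltration

/-- Minimality is all that the construction of the left inverse needs to know about the structure on
cohomology. -/
lemma LInftyStructure.isMinimal_cohomology {K : Type u} [Field K] [CharZero K] {L : Type v}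
    [AddCommGroup L] [Module K L] {𝓛 : ℤ → Submodule K L} [DirectSum.Decomposition 𝓛]
    {S : LInftyStructure 𝓛} (hS : S.IsFlat) : (S.cohomology hS).IsMinimal := by
  refine ⟨?_, LinearMap.ext fun x => ?_⟩
  · rw [LInftyStructure.IsFlat, coeff_cohomology, cohCoeff_one]
  · rw [d_apply, coeff_cohomology, cohCoeff_ι, LinearMap.zero_apply]

end LInfty

end

/-! ### The extension theorem. -/

theorem mainTheorem8 {K : Type*} [Field K] [CharZero K]
    {L : Type*} [AddCommGroup L] [Module K L] (𝓛 : ℤ → Submodule K L) [DirectSum.Decomposition 𝓛]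
    {L' : Type*} [AddCommGroup L'] [Module K L'] (𝓛' : ℤ → Submodule K L')
    [DirectSum.Decomposition 𝓛']
    -- two flat `L_∞`-algebras
    (S : LInfty.LInftyStructure 𝓛) (hS : S.IsFlat)
    (S' : LInfty.LInftyStructure 𝓛') (hS' : S'.IsFlat)
    -- formality: quasi-isomorphisms from the cohomologies
    (il : LInfty.LInftyHom (S.cohomology hS) S) (hil : il.IsQuasiIso)
    (ir : LInfty.LInftyHom (S'.cohomology hS') S') (hir : ir.IsQuasiIso)
    (f : LInfty.LInftyHom (S.cohomology hS) (S'.cohomology hS')) :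
    (∃ g : LInfty.LInftyHom S S', g.comp il = ir.comp f) ∧
    -- the same with all morphisms compatible with given complete filtrations
    (∀ (Φ : LInfty.CompleteFiltration S) (Φ' : LInfty.CompleteFiltration S')
        (ΦH : LInfty.CompleteFiltration (S.cohomology hS))
        (ΦH' : LInfty.CompleteFiltration (S'.cohomology hS')),
      il.IsFilteredQuasiIso ΦH Φ → ir.IsFiltered ΦH' Φ' → f.IsFiltered ΦH ΦH' →
      ∃ g : LInfty.LInftyHom S S', g.IsFiltered Φ Φ' ∧ g.comp il = ir.comp f) := by
  have filtered : ∀ (Φ : LInfty.CompleteFiltration S) (Φ' : LInfty.CompleteFiltration S')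
      (ΦH : LInfty.CompleteFiltration (S.cohomology hS))
      (ΦH' : LInfty.CompleteFiltration (S'.cohomology hS')),
      il.IsFilteredQuasiIso ΦH Φ → ir.IsFiltered ΦH' Φ' → f.IsFiltered ΦH ΦH' →
      ∃ g : LInfty.LInftyHom S S', g.IsFiltered Φ Φ' ∧ g.comp il = ir.comp f := by
    intro Φ Φ' ΦH ΦH' hl hr hf
    obtain ⟨r, hrF, hri⟩ := LInfty.LInftyHom.exists_retraction
      (LInfty.LInftyStructure.isMinimal_cohomology hS) hS il hl
    -- With a strict left inverse `r` of `il`, the composite `ir ∘ f ∘ r` restricts along `il` to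
    -- `ir ∘ f` exactly, not merely up to homotopy.
    refine ⟨(ir.comp f).comp r, fun k x hx => hr k _ (hf k _ (hrF k x hx)), ?_⟩
    refine LInfty.LInftyHom.ext (CoalgHom.ext fun y => ?_)
    change ir.toCoalgHom (f.toCoalgHom (r.toCoalgHom (il.toCoalgHom y))) =
      ir.toCoalgHom (f.toCoalgHom y)
    rw [hri]
  refine ⟨?_, filtered⟩
  -- For trivial filtrations every morphism is filtered and every quasi-isomorphism is a filtered
  -- one.
  obtain ⟨g, -, hg⟩ := filtered _ _ _ _ hil.isFilteredQuasiIso_trivial ir.isFiltered_trivial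
    f.isFiltered_trivial
  exact ⟨g, hg⟩
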